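/- **Notation.** Let $c_1,c_2>0$ be constants with $c_1^2>\tfrac43c_2^2$, and let $T>0$. For $u:[0,T]\times\mathbb R^3\to\mathbb R^3$ write $\partial=(\partial_0,\dots,\partial_3)=(\partial_t,\nabla)$, $r=|x|$, $\langle\rho\rangle=(1+\rho^2)^{1/2}$ (time derivatives are one-sided at $t=0,T$). Let $\tilde\Omega_\ell u=(x\wedge\nabla)_\ell u+U_\ell u$, $\ell=1,2,3$, where $U_\ell v=v\wedge e_\ell$, let $\tilde S=t\partial_t+r\partial_r-1$, and $\Gamma=(\Gamma_0,\dots,\Gamma_7)=(\partial,\tilde\Omega,\tilde S)$. For a finite sequence $a=(a_1,\dots,a_k)$ of indices in $\{0,\dots,7\}$ put $|a|=k$ and $\Gamma^a=\Gamma_{a_1}\cdots\Gamma_{a_k}$. Let $P_1v(x)=\frac xr\langle\frac xr,v(x)\rangle$ and $P_2=I-P_1$ (at $x=0$ put $P_1=0$, $P_2=I$). Define $$E_1(u(t))=\tfrac12\int_{\mathbb R^3}\big[|\partial_tu|^2+c_2^2|\nabla u|^2+(c_1^2-c_2^2)(\nabla\cdot u)^2\big]dx,\qquad E_\kappa(u(t))=\sum_{|a|\le\kappa-1}E_1(\Gamma^au(t)),$$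 $$\mathcal X_\kappa(u(t))=\sum_{\alpha=1}^2\sum_{\beta=0}^3\sum_{\ell=1}^3\sum_{|a|\le\kappa-2}\|\langle c_\alpha t-r\rangle P_\alpha\partial_\beta\partial_\ell\Gamma^au(t)\|_{L^2(\mathbb R^3)}\in[0,\infty].$$ For $\kappa\ge2$ let $\dot H^\kappa_\Gamma(T)$ be the closure of $C^\infty([0,T];C_0^\infty(\mathbb R^3)^3)$ in the norm $\sup_{0\le t<T}E_\kappa^{1/2}(u(t))$. Its elements are the pointwise limits $u$ on $[0,T]\times\mathbb R^3$ of sequences of such smooth fields that are Cauchy in this norm, and the derivatives $\partial_\beta\Gamma^au(t)\in L^2(\mathbb R^3)$, $|a|\le\kappa-1$, which occur in $E_\kappa(u(t))$ and $\mathcal X_\kappa(u(t))$, are the $L^2$ limits of those of the sequence. **Proposition 3.3.** For every $\kappa\ge2$ there is a constant $C$, depending only on $c_1,c_2,\kappa$, such that for all $T>0$ and all $u\in\dot H^\kappa_\Gamma(T)$ one has $u\in C^{\kappa-2}([0,T]\times\mathbb R^3)$ (so that the pointwise derivatives below are classical) and, for all $t\in[0,T]$, $x\in\mathbb R^3$,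 all $a$ and all $\beta\in\{0,1,2,3\}$, $$\langle r\rangle^{1/2}|\Gamma^au(t,x)|\le C\,E_\kappa^{1/2}(u(t)),\qquad |a|+2\le\kappa,$$ $$\langle r\rangle|\partial_\beta\Gamma^au(t,x)|\le C\,E_\kappa^{1/2}(u(t)),\qquad |a|+3\le\kappa,$$ and, if $\mathcal X_\kappa(u(t))<\infty$, for $\alpha=1,2$ and $\ell=1,2,3$, $$\langle r\rangle\langle c_\alpha t-r\rangle^{1/2}|P_\alpha\partial_\beta\Gamma^au(t,x)|\le C\big[E_\kappa^{1/2}(u(t))+\mathcal X_\kappa(u(t))\big],\qquad |a|+3\le\kappa,$$ $$\langle r\rangle\langle c_\alpha t-r\rangle|P_\alpha\partial_\beta\partial_\ell\Gamma^au(t,x)|\le C\,\mathcal X_\kappa(u(t)),\qquad |a|+4\le\kappa.$$ -/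

import Mathlib

open Set Filter Topology MeasureTheory

noncomputable section

namespace PrestressedElastic

/-- Euclidean space `ℝ³`. -/
abbrev E3 := EuclideanSpace ℝ (Fin 3)

/-- Time dependent vector fields `u(t, x)`; only the values for `t ∈ [0, T]` are ever used. -/
abbrev Field := ℝ → E3 → E3

/-- `⟨ρ⟩ = (1 + |ρ|²)^{1/2}`. -/
def jb (ρ : ℝ) : ℝ := Real.sqrt (1 + ρ ^ 2)

/-- `∂_t` on the slab `[0, T] × ℝ³` (one-sided at `t = 0` and at `t = T`). -/
def dt (T : ℝ) (u : Field) : Field :=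
  fun t x => derivWithin (fun s => u s x) (Icc 0 T) t

/-- The spatial partial derivative along the `i`-th coordinate axis. -/
def dx (i : Fin 3) (u : Field) : Field :=
  fun t x => fderiv ℝ (u t) x (EuclideanSpace.single i 1)

/-- `∂ = (∂_0, ∂_1, ∂_2, ∂_3) = (∂_t, ∇)`. -/
def pd (T : ℝ) (β : Fin 4) : Field → Field :=
  Fin.cases (dt T) dx β

/-- The matrices `U_1, U_2, U_3`. -/
def rotMat : Fin 3 → Matrix (Fin 3) (Fin 3) ℝ :=
  ![!![0, 0, 0; 0, 0, 1; 0, -1, 0],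
    !![0, 0, -1; 0, 0, 0; 1, 0, 0],
    !![0, 1, 0; -1, 0, 0; 0, 0, 0]]

/-- `Ω̃_ℓ = Ω_ℓ I + U_ℓ`, where `Ω = x ∧ ∇`. The indices are cyclic modulo 3. -/
def rot (l : Fin 3) (u : Field) : Field :=
  fun t x => (x (l + 1) • dx (l + 2) u t x - x (l + 2) • dx (l + 1) u t x)
    + Matrix.toEuclideanLin (rotMat l) (u t x)

/-- `S̃ = t ∂_t + r ∂_r - 1`, where `r ∂_r = x · ∇`. -/
def scal (T : ℝ) (u : Field) : Field :=
  fun t x => t • dt T u t x + (∑ i : Fin 3, x i • dx i u t x) - u t x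

/-- Labels of the eight vector fields `Γ = (∂, Ω̃, S̃)`. -/
abbrev GIdx := Fin 4 ⊕ Fin 3 ⊕ Unit

/-- The vector field `Γ_j`. -/
def gam (T : ℝ) : GIdx → Field → Field
  | Sum.inl β => pd T β
  | Sum.inr (Sum.inl l) => rot l
  | Sum.inr (Sum.inr _) => scal T

/-- The ordered product `Γ^a = Γ_{a_1} ⋯ Γ_{a_k}`, where `a = (a_1, …, a_k)` and `k = |a|`. -/
def gamPow (T : ℝ) (a : List GIdx) (u : Field) : Field :=
  a.foldr (gam T) u

/-- The projections `P_1` (label `0`, radial) and `P_2` (label `1`, transverse) at the point `x`.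
For `x = 0`, where `x / r` has no meaning, this gives `P_1 = 0` and `P_2 = I`. -/
def proj (α : Fin 2) (x v : E3) : E3 :=
  if α = 0 then inner ℝ (‖x‖⁻¹ • x) v • (‖x‖⁻¹ • x)
  else v - inner ℝ (‖x‖⁻¹ • x) v • (‖x‖⁻¹ • x)

/-- The energy `E_1` at a fixed time of a field whose derivatives `∂_β u(t)` are the `g β`:
`½ ∫ |∂_t u|² + c_2² |∇u|² + (c_1² - c_2²) (∇ · u)²`. Here `c 0 = c_1` and `c 1 = c_2`. -/
def energyOne (c : Fin 2 → ℝ) (g : Fin 4 → E3 → E3) : ℝ :=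
  1 / 2 * ∫ x, (‖g 0 x‖ ^ 2 + c 1 ^ 2 * ∑ i : Fin 3, ‖g i.succ x‖ ^ 2
    + (c 0 ^ 2 - c 1 ^ 2) * (∑ i : Fin 3, g i.succ x i) ^ 2)

/-- The energy `E_κ` at a fixed time of a field for which `D β a` is the derivative
`∂_β Γ^a u(t)`: the sum of `E_1(Γ^a u(t))` over all sequences `a` with `|a| ≤ κ - 1`. -/
def energy (c : Fin 2 → ℝ) (κ : ℕ) (D : Fin 4 → List GIdx → E3 → E3) : ℝ :=
  ∑ k ∈ Finset.range κ, ∑ a : Fin k → GIdx, energyOne c (fun β => D β (List.ofFn a))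

/-- The weighted norm `𝒳_κ` at the time `t`, with values in `[0, ∞]`, of a field for which
`D β a` is the derivative `∂_β Γ^a u(t)`: the sum over all `α`, `β`, `ℓ` and all sequences `a` with
`|a| ≤ κ - 2` of the `L²` norms of `⟨c_α t - r⟩ P_α ∂_β ∂_ℓ Γ^a u(t)`.
Note that `∂_ℓ Γ^a = Γ^(ℓ, a)`, as `∂_ℓ` is one of the fields `Γ`. -/
def wnorm (c : Fin 2 → ℝ) (κ : ℕ) (t : ℝ) (D : Fin 4 → List GIdx → E3 → E3) : ENNReal :=
  ∑ α : Fin 2, ∑ β : Fin 4, ∑ l : Fin 3, ∑ k ∈ Finset.range (κ - 1), ∑ a : Fin k → GIdx,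
    eLpNorm (fun x => jb (c α * t - ‖x‖) • proj α x (D β (Sum.inl l.succ :: List.ofFn a) x))
      2 volume

/-- The classical derivatives `∂_β Γ^a u(t)` of a smooth field. -/
def jet (T : ℝ) (u : Field) (t : ℝ) : Fin 4 → List GIdx → E3 → E3 :=
  fun β a => pd T β (gamPow T a u) t

/-- `C^∞([0, T]; C_0^∞(ℝ³)³)`: smooth up to the boundary on the slab `[0, T] × ℝ³`, with supports
in a common compact subset of `ℝ³`. -/
structure IsTest (T : ℝ) (φ : Field) : Prop where
  smooth : ContDiffOn ℝ ((⊤ : ℕ∞) : WithTop ℕ∞) (Function.uncurry φ) (Icc 0 T ×ˢ univ)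
  supp : ∃ K : Set E3, IsCompact K ∧ ∀ t ∈ Icc 0 T, ∀ x ∉ K, φ t x = 0

/-- `φ` is a Cauchy sequence for the norm `sup_{0 ≤ t < T} E_κ^{1/2}(u(t))`. -/
def IsEnergyCauchy (c : Fin 2 → ℝ) (κ : ℕ) (T : ℝ) (φ : ℕ → Field) : Prop :=
  ∀ ε > 0, ∃ N : ℕ, ∀ m ≥ N, ∀ n ≥ N, ∀ t ∈ Ico 0 T,
    Real.sqrt (energy c κ (jet T (φ m - φ n) t)) ≤ ε

/-- The space `Ḣ_Γ^κ(T)`, `κ ≥ 2`: the closure of `C^∞([0, T]; C_0^∞(ℝ³)³)` in the norm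
`sup_{0 ≤ t < T} E_κ^{1/2}(u(t))`. An element is the pointwise limit `u` on `[0, T] × ℝ³` of a
sequence of test fields that is Cauchy in this norm. It comes with its derivatives
`∂_β Γ^a u(t) ∈ L²`, `|a| ≤ κ - 1`, `t ∈ [0, T]`, which are by definition the `L²` limits of
those of the sequence (the operators `∂_β Γ^a` are extended by closure). -/
structure HGamma (c : Fin 2 → ℝ) (κ : ℕ) (T : ℝ) where
  /-- the function `u(t, x)` -/
  u : Field
  /-- `D t β a` is the generalized derivative `∂_β Γ^a u(t)`, for `|a| ≤ κ - 1` -/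
  D : ℝ → Fin 4 → List GIdx → E3 → E3
  memLp : ∀ t ∈ Icc 0 T, ∀ β a, a.length + 1 ≤ κ → MemLp (D t β a) 2 volume
  exists_approx : ∃ φ : ℕ → Field, (∀ n, IsTest T (φ n)) ∧ IsEnergyCauchy c κ T φ ∧
    (∀ t ∈ Icc 0 T, ∀ x, Tendsto (fun n => φ n t x) atTop (𝓝 (u t x))) ∧
    (∀ t ∈ Icc 0 T, ∀ β a, a.length + 1 ≤ κ →
      Tendsto (fun n => eLpNorm (jet T (φ n) t β a - D t β a) 2 volume) atTop (𝓝 0))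

namespace HGamma

variable {c : Fin 2 → ℝ} {κ : ℕ} {T : ℝ}

/-- `E_κ(u(t))` -/
def E (U : HGamma c κ T) (t : ℝ) : ℝ := energy c κ (U.D t)

/-- `𝒳_κ(u(t))` -/
def X (U : HGamma c κ T) (t : ℝ) : ENNReal := wnorm c κ t (U.D t)

end HGamma

end PrestressedElastic

end

/-!
The estimates are weighted Sobolev inequalities, proved first for smooth fields with compact support
and then carried over to the energy closure.

*Anisotropic Sobolev inequality.* On `ℝ³` one has
`|F(0)|² ≤ C ∫_B (|F|² + ∑ |∂_i F|² + ∑_{j ≠ 0} |∂_j ∂_i F|²)`, without the term `∂_0² F`. On the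
Fourier side this is the integrability of the reciprocal of the symbol (`integrable_inv_symb`), and
a cutoff localizes it (`exists_sobolev_local`). It is used in polar coordinates, with the `0`-th
coordinate radial of scale `s ≤ r` and the other two the angles of rotations about coordinate axes.
If the field is rotated back to a fixed base point, then the angular derivatives are the fields
`Ω̃_l`, and the projections `P_α` become constant (`pull`, `norm_proj_pull`). The change of variables
has Jacobian comparable to `s r²`, which yields (`exists_norm_proj_le_shellNorm`)
`s^{1/2} r |P_α v(x)| ≤ C ∑ (‖P_α Ω̃^a v‖ + s ‖P_α ∂_m Ω̃^b v‖)`, `|a| ≤ 2`, `|b| ≤ 1`, with the `L²`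
norms over the shell `||y| - r| ≤ s / 4`. As `∂_0²` does not occur, there is only one factor `s`, and
a single power of the weights `⟨c_α t - r⟩` suffices below.

*Estimates without `P_α`.* With `s = r`, and the bound `R ‖∇v‖` for `v` in `L²` of a ball of radius
`R`, which is Sobolev's inequality for the exponent `6`, the shell inequality gives the decay
`⟨r⟩^{1/2}` (`exists_sqrt_decay`). With `s = 1` it gives the decay `⟨r⟩` (`exists_full_decay`).

*Estimates with the weights `⟨c_α t - r⟩`.* Let `τ = max(1, δ t)` with small `δ`. For `r > τ` the
value `L = ⟨c_α t - r⟩` is at most `M r`, so that `s = L / M` is admissible in the shell inequality,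
and on the shell the weight is comparable to `L`. For `r ≤ τ` both weights are comparable to `τ` on
the ball of radius `2 τ`; there all second derivatives gain the factor `τ`, and the unweighted decay
estimates apply to the field cut off at radius `τ` by a radial function, which commutes with `Ω̃_l`
and whose derivatives are `O(1 / τ)`. The results are `exists_weighted_decay_jet` and
`exists_weighted_decay_second`. The commutator of `Ω̃_l` with `∂_β` being zero or, up to
the sign, a spatial derivative, all quantities on the right-hand side are controlled by `E_κ` and `𝒳_κ`.

*Passage to the limit.* The energy is coercive, so the decay `⟨r⟩^{1/2}` applied to differences shows
that `Γ^a φ_n`, `|a| ≤ κ - 2`, is uniformly Cauchy on the slab for an approximating sequence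
(`IsEnergyCauchy.uniformCauchySeqOn`). Hence the limit is of class `C^{κ-2}` and its derivatives are
the limits of those of the `φ_n` (`contDiffOn_gamPow`, `tendsto_gamPow`). The weighted norms of `φ_n`
need not converge to those of the limit; but for fixed `(t, x)` the estimates involve only the
weighted norms over a fixed ball, on which the weight is bounded, and these do converge.
-/

noncomputable section

namespace PrestressedElastic

open SchwartzMap LineDeriv FourierTransform
open scoped ContDiff

/-! ### The anisotropic Sobolev inequality -/

/-- The partial derivative of a function on `ℝ³` along the `i`-th coordinate axis. -/
def pdv {V : Type*} [NormedAddCommGroup V] [NormedSpace ℝ V] (i : Fin 3)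
    (f : E3 → V) : E3 → V :=
  fun x => fderiv ℝ f x (EuclideanSpace.single i 1)

/-- The Cauchy–Schwarz inequality `(∫ |g|)² ≤ ∫ 1/W · ∫ W |g|²`. -/
theorem sq_integral_le_of_weight {X : Type*} [MeasurableSpace X] {μ : Measure X} {W g : X → ℝ}
    (hW : ∀ x, 0 < W x) (hWi : Integrable (fun x => (W x)⁻¹) μ) (hg : Integrable g μ)
    (hWg : Integrable (fun x => W x * g x ^ 2) μ) :
    (∫ x, g x ∂μ) ^ 2 ≤ (∫ x, (W x)⁻¹ ∂μ) * ∫ x, W x * g x ^ 2 ∂μ := by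
  have key : ∀ s : ℝ, 0 ≤ (∫ x, (W x)⁻¹ ∂μ) * (s * s) + (-2 * ∫ x, g x ∂μ) * s
      + ∫ x, W x * g x ^ 2 ∂μ := by
    intro s
    have h1 : 0 ≤ ∫ x, ((W x)⁻¹ * (s * s) + (-2 * s) * g x + W x * g x ^ 2) ∂μ := by
      refine integral_nonneg fun x => ?_
      have : (W x)⁻¹ * (s * s) + (-2 * s) * g x + W x * g x ^ 2
          = (s - W x * g x) ^ 2 / W x := by
        have := (hW x).ne'
        field_simp
        ring
      rw [Pi.zero_apply, this]
      have := hW x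
      positivity
    have i1 : Integrable (fun x => (W x)⁻¹ * (s * s)) μ := hWi.mul_const _
    have i2 : Integrable (fun x => (-2 * s) * g x) μ := hg.const_mul _
    have i12 : Integrable (fun x => (W x)⁻¹ * (s * s) + (-2 * s) * g x) μ := i1.add i2
    rw [integral_add i12 hWg, integral_add i1 i2, integral_mul_const,
      integral_const_mul] at h1
    linarith
  have := discrim_le_zero key
  unfold discrim at this
  nlinarith

/-- The symbol of the quadratic form `‖f‖² + ∑ ‖∂_i f‖² + ∑_{j ≠ 0} ‖∂_j ∂_i f‖²`. -/
def symb (ξ : E3) : ℝ :=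
  1 + ∑ i : Fin 3, (2 * Real.pi * ξ i) ^ 2
    + ∑ i : Fin 3, ∑ j : Fin 2, (2 * Real.pi * ξ i) ^ 2 * (2 * Real.pi * ξ j.succ) ^ 2

theorem symb_pos (ξ : E3) : 0 < symb ξ := by unfold symb; positivity

/-- Although `∂_0²` is missing, the symbol dominates the `2/3`-power of `∏ (1 + ξ_i²)`: the
exponents of this product lie inside the Newton polygon of the symbol. -/
theorem prod_rpow_le_symb (ξ : E3) :
    ∏ i : Fin 3, (1 + (ξ i) ^ 2) ^ (2 / 3 : ℝ) ≤ 3 * symb ξ := by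
  set a := (ξ 0) ^ 2 with ha
  set b := (ξ 1) ^ 2 with hb
  set c := (ξ 2) ^ 2 with hc
  have ha0 : 0 ≤ a := sq_nonneg _
  have hb0 : 0 ≤ b := sq_nonneg _
  have hc0 : 0 ≤ c := sq_nonneg _
  have hpi : 1 ≤ (2 * Real.pi) ^ 2 := by nlinarith [Real.pi_gt_three]
  have hs : 1 + (a + b + c) + (a + b + c) * (b + c) ≤ symb ξ := by
    have e : symb ξ = 1 + (2 * Real.pi) ^ 2 * (a + b + c)
        + (2 * Real.pi) ^ 2 * (2 * Real.pi) ^ 2 * ((a + b + c) * (b + c)) := by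
      simp only [symb, Fin.sum_univ_three, Fin.sum_univ_two, ha, hb, hc]
      have e1 : (Fin.succ (0 : Fin 2)) = (1 : Fin 3) := rfl
      have e2 : (Fin.succ (1 : Fin 2)) = (2 : Fin 3) := rfl
      rw [e1, e2]
      ring
    rw [e]
    have h1 : 1 ≤ (2 * Real.pi) ^ 2 * (2 * Real.pi) ^ 2 := by nlinarith
    have h2 : 0 ≤ (a + b + c) * (b + c) := by positivity
    nlinarith
  have hp : ∏ i : Fin 3, (1 + (ξ i) ^ 2) ^ (2 / 3 : ℝ)
      = (((1 + a) * (1 + b) * (1 + c)) ^ 2) ^ (1 / 3 : ℝ) := by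
    rw [Fin.prod_univ_three, ← Real.mul_rpow (by positivity) (by positivity),
      ← Real.mul_rpow (by positivity) (by positivity),
      ← Real.rpow_natCast ((1 + a) * (1 + b) * (1 + c)), ← Real.rpow_mul (by positivity)]
    norm_num [ha, hb, hc]
  set B := 1 + b + c with hB
  have hle : ((1 + a) * (1 + b) * (1 + c)) ^ 2 ≤ ((1 + a) * B + B ^ 2) ^ 3 := by
    have h1 : (1 + b) * (1 + c) ≤ B ^ 2 := by nlinarith
    have h0 : (1 + a) * (1 + b) * (1 + c) ≤ (1 + a) * B ^ 2 := by nlinarith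
    have hB0 : 0 ≤ (1 + a) * B := by positivity
    have hB1 : 0 ≤ B ^ 2 := by positivity
    calc ((1 + a) * (1 + b) * (1 + c)) ^ 2 ≤ ((1 + a) * B ^ 2) ^ 2 := by gcongr
      _ = ((1 + a) * B) ^ 2 * B ^ 2 := by ring
      _ ≤ ((1 + a) * B + B ^ 2) ^ 3 := by
        nlinarith [pow_nonneg hB0 3, pow_nonneg hB1 3, mul_nonneg (pow_nonneg hB0 2) hB1,
          mul_nonneg hB0 (pow_nonneg hB1 2)]
  rw [hp]
  calc (((1 + a) * (1 + b) * (1 + c)) ^ 2) ^ (1 / 3 : ℝ)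
      ≤ (((1 + a) * B + B ^ 2) ^ 3) ^ (1 / 3 : ℝ) :=
        Real.rpow_le_rpow (by positivity) hle (by norm_num)
    _ = (1 + a) * B + B ^ 2 := by
        rw [← Real.rpow_natCast, ← Real.rpow_mul (by positivity)]; norm_num
    _ ≤ 3 * symb ξ := by nlinarith [mul_nonneg ha0 hb0, mul_nonneg ha0 hc0]

theorem measurable_symb : Measurable symb := by unfold symb; fun_prop

/-- Without `∂_0²` the exponent `2/3 > 1/2` in each variable still makes the symbol large enough. -/
theorem integrable_inv_symb : Integrable (fun ξ => (symb ξ)⁻¹) := by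
  have h1 : Integrable (fun x : ℝ => (1 + x ^ 2) ^ (-(2 / 3) : ℝ)) := by
    have := integrable_rpow_neg_one_add_norm_sq (E := ℝ) (μ := volume) (r := 4 / 3)
      (by norm_num)
    simpa [show (-(4 / 3) / 2 : ℝ) = -(2 / 3) by norm_num] using this
  have h2 : Integrable (fun x : Fin 3 → ℝ => ∏ i, (1 + (x i) ^ 2) ^ (-(2 / 3) : ℝ)) :=
    Integrable.fintype_prod (μ := fun _ => volume) (fun _ => h1)
  have h3 : Integrable (fun ξ : E3 => ∏ i, (1 + (ξ i) ^ 2) ^ (-(2 / 3) : ℝ)) := by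
    rw [← (PiLp.volume_preserving_toLp (Fin 3)).integrable_comp_emb
      (MeasurableEquiv.toLp 2 _).measurableEmbedding]
    exact h2
  refine (h3.const_mul 3).mono' measurable_symb.inv.aestronglyMeasurable
    (Eventually.of_forall fun ξ => ?_)
  have hp := prod_rpow_le_symb ξ
  have hpos : 0 < ∏ i : Fin 3, (1 + (ξ i) ^ 2) ^ (2 / 3 : ℝ) :=
    Finset.prod_pos fun i _ => by positivity
  have e : ∏ i : Fin 3, (1 + (ξ i) ^ 2) ^ (-(2 / 3) : ℝ)
      = (∏ i : Fin 3, (1 + (ξ i) ^ 2) ^ (2 / 3 : ℝ))⁻¹ := by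
    rw [← Finset.prod_inv_distrib]
    exact Finset.prod_congr rfl fun i _ => Real.rpow_neg (by positivity) _
  rw [e, Real.norm_of_nonneg (inv_nonneg.2 (symb_pos ξ).le), ← div_eq_mul_inv,
    inv_le_comm₀ (symb_pos ξ) (by positivity), inv_div]
  linarith

variable {H : Type*} [NormedAddCommGroup H] [InnerProductSpace ℂ H]

theorem norm_le_integral_norm_fourier [CompleteSpace H] (f : 𝓢(E3, H)) (x : E3) :
    ‖f x‖ ≤ ∫ ξ, ‖𝓕 f ξ‖ := by
  set g : 𝓢(E3, H) := 𝓕 f with hg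
  have h : f x = 𝓕⁻ (g : E3 → H) x := by
    rw [← SchwartzMap.fourierInv_coe, hg, FourierTransform.fourierInv_fourier_eq]
  rw [h]
  exact VectorFourier.norm_fourierIntegral_le_integral_norm _ _ _ _ _

theorem norm_fourier_lineDeriv (f : 𝓢(E3, H)) (i : Fin 3) (ξ : E3) :
    ‖𝓕 (∂_{(EuclideanSpace.single i 1 : E3)} f) ξ‖ ^ 2 = (2 * Real.pi * ξ i) ^ 2 * ‖𝓕 f ξ‖ ^ 2 := by
  rw [SchwartzMap.fourier_lineDerivOp_eq]
  have : (fun x : E3 => (inner ℝ x (EuclideanSpace.single i (1 : ℝ)))).HasTemperateGrowth :=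
    by fun_prop
  rw [smul_apply, SchwartzMap.smulLeftCLM_apply_apply this, norm_smul, norm_smul]
  simp [mul_pow, EuclideanSpace.inner_single_right]
  ring

theorem integrable_norm_sq_schwartz (f : 𝓢(E3, H)) : Integrable (fun x => ‖f x‖ ^ 2) := by
  have := f.memLp 2 volume
  exact this.integrable_norm_pow (by norm_num)

/-- The anisotropic Sobolev inequality on `ℝ³` for Schwartz functions. The second derivative along
the `0`-th axis does not occur. -/
theorem exists_sobolev_schwartz [CompleteSpace H] : ∃ C : ℝ, 0 ≤ C ∧ ∀ (f : 𝓢(E3, H)) (x : E3),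
    ‖f x‖ ^ 2 ≤ C * ((∫ y, ‖f y‖ ^ 2)
      + (∑ i : Fin 3, ∫ y, ‖(∂_{(EuclideanSpace.single i 1 : E3)} f) y‖ ^ 2)
      + ∑ i : Fin 3, ∑ j : Fin 2, ∫ y, ‖(∂_{(EuclideanSpace.single j.succ 1 : E3)}
          (∂_{(EuclideanSpace.single i 1 : E3)} f)) y‖ ^ 2) := by
  refine ⟨∫ ξ, (symb ξ)⁻¹, integral_nonneg fun ξ => inv_nonneg.2 (symb_pos ξ).le, fun f x => ?_⟩
  have e0 : ∀ ξ, symb ξ * ‖𝓕 f ξ‖ ^ 2 = ‖𝓕 f ξ‖ ^ 2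
      + (∑ i : Fin 3, ‖𝓕 (∂_{(EuclideanSpace.single i 1 : E3)} f) ξ‖ ^ 2)
      + ∑ i : Fin 3, ∑ j : Fin 2, ‖𝓕 (∂_{(EuclideanSpace.single j.succ 1 : E3)}
          (∂_{(EuclideanSpace.single i 1 : E3)} f)) ξ‖ ^ 2 := by
    intro ξ
    simp only [norm_fourier_lineDeriv]
    simp only [symb, add_mul, Finset.sum_mul, one_mul]
    congr 1
    exact Finset.sum_congr rfl fun i _ => Finset.sum_congr rfl fun j _ => by ring
  have i0 := fun g : 𝓢(E3, H) => integrable_norm_sq_schwartz (𝓕 g)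
  have i1 : Integrable (fun ξ => ∑ i : Fin 3, ‖𝓕 (∂_{(EuclideanSpace.single i 1 : E3)} f) ξ‖ ^ 2) :=
    integrable_finsetSum _ fun i _ => i0 _
  have i2 : ∀ i : Fin 3, Integrable (fun ξ => ∑ j : Fin 2, ‖𝓕 (∂_{(EuclideanSpace.single j.succ 1 : E3)}
          (∂_{(EuclideanSpace.single i 1 : E3)} f)) ξ‖ ^ 2) := fun i =>
    integrable_finsetSum _ fun i _ => i0 _
  have i01 : Integrable (fun ξ => ‖𝓕 f ξ‖ ^ 2
      + ∑ i : Fin 3, ‖𝓕 (∂_{(EuclideanSpace.single i 1 : E3)} f) ξ‖ ^ 2) := (i0 _).add i1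
  have i3 := integrable_finsetSum Finset.univ fun i _ => i2 i
  have hJ := sq_integral_le_of_weight (g := fun ξ => ‖𝓕 f ξ‖) symb_pos integrable_inv_symb
    (𝓕 f).integrable.norm (by simp only [e0]; exact i01.add i3)
  refine le_trans (pow_le_pow_left₀ (norm_nonneg _) (norm_le_integral_norm_fourier f x) 2)
    (hJ.trans (le_of_eq ?_))
  congr 1
  simp only [e0]
  rw [integral_add i01 i3, integral_add (i0 _) i1, integral_finsetSum _ fun i _ => i0 _,
    integral_finsetSum _ fun i _ => i2 i]
  simp only [integral_finsetSum _ fun i _ => i0 _, SchwartzMap.integral_norm_sq_fourier]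

section pdv

variable {V : Type*} [NormedAddCommGroup V] [NormedSpace ℝ V]

theorem _root_.ContDiff.pdv {f : E3 → V} (hf : ContDiff ℝ ∞ f) (i : Fin 3) : ContDiff ℝ ∞ (pdv i f) :=
  (hf.fderiv_right (m := ∞) (by simp)).clm_apply contDiff_const

theorem pdv_eq_of_hasDerivAt {f : E3 → V} {x : E3} {i : Fin 3} {f' : V}
    (hf : DifferentiableAt ℝ f x)
    (h : HasDerivAt (fun s : ℝ => f (x + s • EuclideanSpace.single i 1)) f' 0) :
    pdv i f x = f' := by
  have := hf.lineDeriv_eq_fderiv (v := (EuclideanSpace.single i 1 : E3))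
  rw [pdv, ← this]
  exact HasDerivAt.deriv h

theorem pdv_add {f g : E3 → V} {x : E3} (hf : DifferentiableAt ℝ f x)
    (hg : DifferentiableAt ℝ g x) (i : Fin 3) :
    pdv i (fun y => f y + g y) x = pdv i f x + pdv i g x := by
  simp only [pdv]
  rw [fderiv_fun_add hf hg, add_apply]

theorem pdv_smul {χ : E3 → ℝ} {f : E3 → V} {x : E3} (hχ : DifferentiableAt ℝ χ x)
    (hf : DifferentiableAt ℝ f x) (i : Fin 3) :
    pdv i (fun y => χ y • f y) x = χ x • pdv i f x + pdv i χ x • f x := by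
  simp only [pdv]
  rw [fderiv_fun_smul hχ hf]
  simp

theorem pdv_clm {W : Type*} [NormedAddCommGroup W] [NormedSpace ℝ W] (L : V →L[ℝ] W) {f : E3 → V}
    {x : E3} (hf : DifferentiableAt ℝ f x) (i : Fin 3) :
    pdv i (fun y => L (f y)) x = L (pdv i f x) := by
  simp only [pdv]
  rw [show (fun y => L (f y)) = L ∘ f from rfl, (L.hasFDerivAt.comp x hf.hasFDerivAt).fderiv]
  rfl

theorem _root_.ContDiff.differentiableAt_infty {f : E3 → V} (hf : ContDiff ℝ ∞ f) (x : E3) :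
    DifferentiableAt ℝ f x :=
  hf.differentiable (by simp) x

theorem pdv_pdv_smul {χ : E3 → ℝ} {f : E3 → V} (hχ : ContDiff ℝ ∞ χ) (hf : ContDiff ℝ ∞ f)
    (i j : Fin 3) (x : E3) :
    pdv j (pdv i (fun y => χ y • f y)) x = χ x • pdv j (pdv i f) x + pdv j χ x • pdv i f x
      + (pdv i χ x • pdv j f x + pdv j (pdv i χ) x • f x) := by
  have e : pdv i (fun y => χ y • f y) = fun y => χ y • pdv i f y + pdv i χ y • f y :=
    funext fun y => pdv_smul (hχ.differentiableAt_infty y) (hf.differentiableAt_infty y) i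
  have d1 : DifferentiableAt ℝ (fun y => χ y • pdv i f y) x :=
    (hχ.smul (hf.pdv i)).differentiableAt_infty x
  have d2 : DifferentiableAt ℝ (fun y => pdv i χ y • f y) x :=
    ((hχ.pdv i).smul hf).differentiableAt_infty x
  rw [e, pdv_add d1 d2, pdv_smul (hχ.differentiableAt_infty x) ((hf.pdv i).differentiableAt_infty x),
    pdv_smul ((hχ.pdv i).differentiableAt_infty x) (hf.differentiableAt_infty x)]

theorem _root_.HasCompactSupport.pdv {f : E3 → V} (hf : HasCompactSupport f) (i : Fin 3) :
    HasCompactSupport (pdv i f) :=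
  hf.fderiv_apply ℝ _

theorem pdv_eq_zero_of_notMem_tsupport {f : E3 → V} {x : E3} (hx : x ∉ tsupport f) (i : Fin 3) :
    pdv i f x = 0 := by
  rw [pdv, fderiv_of_notMem_tsupport ℝ hx]
  rfl

theorem tsupport_pdv_subset (f : E3 → V) (i : Fin 3) : tsupport (pdv i f) ⊆ tsupport f :=
  closure_minimal (fun _ hx => by_contra fun h => hx (pdv_eq_zero_of_notMem_tsupport h i))
    (isClosed_tsupport f)

end pdv

/-- The real vectors inside `ℂ³`. -/
def toComplex : E3 →L[ℝ] EuclideanSpace ℂ (Fin 3) :=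
  LinearMap.toContinuousLinearMap
    { toFun := fun x => WithLp.toLp 2 fun i => (x i : ℂ)
      map_add' := fun x y => by ext i; simp
      map_smul' := fun a x => by ext i; simp }

theorem norm_toComplex (x : E3) : ‖toComplex x‖ = ‖x‖ := by
  simp [EuclideanSpace.norm_eq, toComplex]

/-- The integrand `|F|² + ∑ |∂_i F|² + ∑_{j ≠ 0} |∂_j ∂_i F|²` of the anisotropic Sobolev
inequality. -/
def sobolevDensity (F : E3 → E3) (z : E3) : ENNReal :=
  ‖F z‖ₑ ^ 2 + (∑ i : Fin 3, ‖pdv i F z‖ₑ ^ 2)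
    + ∑ i : Fin 3, ∑ j : Fin 2, ‖pdv j.succ (pdv i F) z‖ₑ ^ 2

theorem ofReal_integral_norm_sq {F : E3 → E3} (hF : Continuous F) (hs : HasCompactSupport F) :
    ENNReal.ofReal (∫ x, ‖F x‖ ^ 2) = ∫⁻ x, ‖F x‖ₑ ^ 2 := by
  have hc : HasCompactSupport (fun x => ‖F x‖ ^ 2) := by
    refine hs.mono fun x hx => ?_
    rw [Function.mem_support] at hx ⊢
    contrapose! hx
    rw [hx, norm_zero, zero_pow two_ne_zero]
  have hi : Integrable (fun x => ‖F x‖ ^ 2) :=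
    (hF.norm.pow 2).integrable_of_hasCompactSupport hc
  rw [ofReal_integral_eq_lintegral_ofReal hi (Eventually.of_forall fun x => sq_nonneg _)]
  refine lintegral_congr fun x => ?_
  rw [ENNReal.ofReal_pow (norm_nonneg _), ofReal_norm]

theorem exists_sobolev_compactSupport : ∃ C : NNReal, ∀ G : E3 → E3, ContDiff ℝ ∞ G →
    HasCompactSupport G → ∀ x, ‖G x‖ₑ ^ 2 ≤ C * ∫⁻ z, sobolevDensity G z := by
  obtain ⟨C, hC0, hC⟩ := exists_sobolev_schwartz (H := EuclideanSpace ℂ (Fin 3))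
  refine ⟨C.toNNReal, fun G hG hs x => ?_⟩
  have hcs : HasCompactSupport (fun x => toComplex (G x)) := hs.comp_left (map_zero _)
  have hcd : ContDiff ℝ ∞ (fun x => toComplex (G x)) := toComplex.contDiff.comp hG
  set f := hcs.toSchwartzMap hcd with hf
  have f0 : (f : E3 → EuclideanSpace ℂ (Fin 3)) = fun x => toComplex (G x) := rfl
  have f1 : ∀ i : Fin 3, ((∂_{(EuclideanSpace.single i 1 : E3)} f : 𝓢(E3, _)) :
      E3 → EuclideanSpace ℂ (Fin 3)) = fun x => toComplex (pdv i G x) := by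
    intro i
    ext1 x
    rw [SchwartzMap.lineDerivOp_apply_eq_fderiv]
    exact pdv_clm toComplex (hG.differentiableAt_infty x) i
  have f2 : ∀ i j : Fin 3, ((∂_{(EuclideanSpace.single j 1 : E3)}
      (∂_{(EuclideanSpace.single i 1 : E3)} f) : 𝓢(E3, _)) :
      E3 → EuclideanSpace ℂ (Fin 3)) = fun x => toComplex (pdv j (pdv i G) x) := by
    intro i j
    ext1 x
    rw [SchwartzMap.lineDerivOp_apply_eq_fderiv, f1]
    exact pdv_clm toComplex ((hG.pdv i).differentiableAt_infty x) j
  have h := hC f x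
  simp only [f0, f1, f2, norm_toComplex] at h
  have h' := ENNReal.ofReal_le_ofReal h
  rw [ENNReal.ofReal_pow (norm_nonneg _), ofReal_norm, ENNReal.ofReal_mul hC0] at h'
  refine h'.trans (le_of_eq ?_)
  have n0 : ∀ F : E3 → E3, 0 ≤ ∫ x, ‖F x‖ ^ 2 := fun F => integral_nonneg fun x => by positivity
  rw [show ENNReal.ofReal C = (C.toNNReal : ENNReal) from rfl]
  congr 1
  have m0 : ∀ {F : E3 → E3}, ContDiff ℝ ∞ F → Measurable fun x => ‖F x‖ₑ ^ 2 := fun hF =>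
    (hF.continuous.measurable.enorm).pow_const 2
  rw [ENNReal.ofReal_add (add_nonneg (n0 _) (Finset.sum_nonneg fun i _ => n0 _))
      (Finset.sum_nonneg fun i _ => Finset.sum_nonneg fun i _ => n0 _),
    ENNReal.ofReal_add (n0 _) (Finset.sum_nonneg fun i _ => n0 _),
    ENNReal.ofReal_sum_of_nonneg fun i _ => n0 _,
    ENNReal.ofReal_sum_of_nonneg fun i _ => Finset.sum_nonneg fun i _ => n0 _]
  simp only [ENNReal.ofReal_sum_of_nonneg fun i _ => n0 _]
  unfold sobolevDensity
  have mi : Measurable fun z => ∑ i : Fin 3, ‖pdv i G z‖ₑ ^ 2 :=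
    Finset.measurable_sum _ fun i _ => m0 (hG.pdv i)
  have m1 : Measurable fun z => ‖G z‖ₑ ^ 2 + ∑ i : Fin 3, ‖pdv i G z‖ₑ ^ 2 := (m0 hG).add mi
  rw [lintegral_add_left m1, lintegral_add_left (m0 hG),
    lintegral_finsetSum _ fun i _ => m0 (hG.pdv i),
    lintegral_finsetSum _ fun i _ => Finset.measurable_sum _ fun j _ => m0 ((hG.pdv i).pdv j.succ)]
  simp only [lintegral_finsetSum _ fun (j : Fin 2) _ => m0 ((hG.pdv _).pdv j.succ)]
  rw [ofReal_integral_norm_sq hG.continuous hs]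
  congr 1
  · congr 1
    exact Finset.sum_congr rfl fun i _ =>
      ofReal_integral_norm_sq (hG.pdv i).continuous (hs.pdv i)
  · exact Finset.sum_congr rfl fun i _ => Finset.sum_congr rfl fun j _ =>
      ofReal_integral_norm_sq ((hG.pdv i).pdv _).continuous ((hs.pdv i).pdv _)

theorem ENNReal_le_rpow_half {a S : ENNReal} (h : a ^ 2 ≤ S) : a ≤ S ^ (1 / 2 : ℝ) := by
  have := ENNReal.rpow_le_rpow h (show (0 : ℝ) ≤ 1 / 2 by norm_num)
  rwa [← ENNReal.rpow_natCast, ← ENNReal.rpow_mul, show ((2 : ℕ) : ℝ) * (1 / 2) = 1 by norm_num,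
    ENNReal.rpow_one] at this

theorem ENNReal_rpow_half_sq (S : ENNReal) : (S ^ (1 / 2 : ℝ)) ^ 2 = S := by
  rw [← ENNReal.rpow_natCast, ← ENNReal.rpow_mul, show (1 / 2 : ℝ) * ((2 : ℕ) : ℝ) = 1 by norm_num,
    ENNReal.rpow_one]

theorem exists_bound_pdv {χ : E3 → ℝ} (hχ : ContDiff ℝ ∞ χ) (hs : HasCompactSupport χ) :
    ∃ M : ℝ, 0 ≤ M ∧ ∀ x, |χ x| ≤ M ∧ (∀ i, |pdv i χ x| ≤ M) ∧
      ∀ i j, |pdv j (pdv i χ) x| ≤ M := by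
  have bd : ∀ {f : E3 → ℝ}, ContDiff ℝ ∞ f → HasCompactSupport f → ∃ M, ∀ x, |f x| ≤ M :=
    fun hf h => h.exists_bound_of_continuous hf.continuous
  obtain ⟨M0, h0⟩ := bd hχ hs
  choose M1 h1 using fun i => bd (hχ.pdv i) (hs.pdv i)
  choose M2 h2 using fun i j => bd ((hχ.pdv i).pdv j) ((hs.pdv i).pdv j)
  have n0 : 0 ≤ M0 := (abs_nonneg _).trans (h0 0)
  have n1 : ∀ i, 0 ≤ M1 i := fun i => (abs_nonneg _).trans (h1 i 0)
  have n2 : ∀ i j, 0 ≤ M2 i j := fun i j => (abs_nonneg _).trans (h2 i j 0)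
  have s1 : 0 ≤ ∑ i, M1 i := Finset.sum_nonneg fun i _ => n1 i
  have s2 : 0 ≤ ∑ i, ∑ j, M2 i j := Finset.sum_nonneg fun i _ => Finset.sum_nonneg fun j _ => n2 i j
  refine ⟨M0 + ∑ i, M1 i + ∑ i, ∑ j, M2 i j, by positivity, fun x => ⟨?_, fun i => ?_, fun i j => ?_⟩⟩
  · linarith [h0 x]
  · have := Finset.single_le_sum (f := M1) (fun i _ => n1 i) (Finset.mem_univ i)
    linarith [h1 i x]
  · have e1 := Finset.single_le_sum (f := fun j => M2 i j) (fun j _ => n2 i j) (Finset.mem_univ j)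
    have e2 := Finset.single_le_sum (f := fun i => ∑ j, M2 i j)
      (fun i _ => Finset.sum_nonneg fun j _ => n2 i j) (Finset.mem_univ i)
    linarith [h2 i j x]

theorem sobolevDensity_smul_le {χ : E3 → ℝ} {F : E3 → E3} (hχ : ContDiff ℝ ∞ χ)
    (hF : ContDiff ℝ ∞ F) {M : NNReal} {z : E3} (h0 : |χ z| ≤ M) (h1 : ∀ i, |pdv i χ z| ≤ M)
    (h2 : ∀ i j, |pdv j (pdv i χ) z| ≤ M) :
    sobolevDensity (fun y => χ y • F y) z ≤ (160 * M ^ 2 : NNReal) * sobolevDensity F z := by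
  set S := sobolevDensity F z with hS
  set s := S ^ (1 / 2 : ℝ) with hs
  have a0 : ‖F z‖ₑ ≤ s := by
    refine ENNReal_le_rpow_half ?_
    rw [hS, sobolevDensity, add_assoc]
    exact le_self_add
  have a1 : ∀ i, ‖pdv i F z‖ₑ ≤ s := fun i => by
    refine ENNReal_le_rpow_half ?_
    refine (Finset.single_le_sum (f := fun i => ‖pdv i F z‖ₑ ^ 2) (fun _ _ => zero_le)
      (Finset.mem_univ i)).trans ?_
    rw [hS, sobolevDensity, add_right_comm]
    exact le_add_self
  have a2 : ∀ (i : Fin 3) (j : Fin 2), ‖pdv j.succ (pdv i F) z‖ₑ ≤ s := fun i j => by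
    refine ENNReal_le_rpow_half ?_
    refine (Finset.single_le_sum (f := fun j : Fin 2 => ‖pdv j.succ (pdv i F) z‖ₑ ^ 2)
      (fun _ _ => zero_le) (Finset.mem_univ j)).trans ?_
    refine (Finset.single_le_sum (f := fun i => ∑ j : Fin 2, ‖pdv j.succ (pdv i F) z‖ₑ ^ 2)
      (fun _ _ => zero_le) (Finset.mem_univ i)).trans ?_
    rw [hS, sobolevDensity]
    exact le_add_self
  have sm : ∀ {c : ℝ} {v : E3}, |c| ≤ M → ‖v‖ₑ ≤ s → ‖c • v‖ₑ ≤ M * s := fun {c v} hc hv => by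
    rw [enorm_smul]
    gcongr
    rw [← ofReal_norm, Real.norm_eq_abs]
    exact (ENNReal.ofReal_le_ofReal hc).trans (by simp)
  have b0 : ‖χ z • F z‖ₑ ^ 2 ≤ (4 * (M * s)) ^ 2 := by
    gcongr
    exact (sm h0 a0).trans (le_mul_of_one_le_left' (by norm_num))
  have b1 : ∀ i, ‖pdv i (fun y => χ y • F y) z‖ₑ ^ 2 ≤ (4 * (M * s)) ^ 2 := fun i => by
    gcongr
    rw [pdv_smul (hχ.differentiableAt_infty z) (hF.differentiableAt_infty z)]
    refine (enorm_add_le _ _).trans ((add_le_add (sm h0 (a1 i)) (sm (h1 i) a0)).trans ?_)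
    rw [← two_mul]
    gcongr
    norm_num
  have b2 : ∀ (i : Fin 3) (j : Fin 2),
      ‖pdv j.succ (pdv i (fun y => χ y • F y)) z‖ₑ ^ 2 ≤ (4 * (M * s)) ^ 2 := fun i j => by
    gcongr
    rw [pdv_pdv_smul hχ hF]
    refine (enorm_add_le _ _).trans ((add_le_add ((enorm_add_le _ _).trans
      (add_le_add (sm h0 (a2 i j)) (sm (h1 j.succ) (a1 i)))) ((enorm_add_le _ _).trans
      (add_le_add (sm (h1 i) (a1 j.succ)) (sm (h2 i j.succ) a0)))).trans (le_of_eq ?_))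
    ring
  have e : (4 * (M * s)) ^ 2 = 16 * M ^ 2 * S := by
    rw [mul_pow, mul_pow, hs, ENNReal_rpow_half_sq]; ring
  rw [e] at b0 b1 b2
  have t1 := Finset.sum_le_sum fun (i : Fin 3) (_ : i ∈ Finset.univ) => b1 i
  have t2 := Finset.sum_le_sum fun (i : Fin 3) (_ : i ∈ Finset.univ) =>
    Finset.sum_le_sum fun (j : Fin 2) (_ : j ∈ Finset.univ) => b2 i j
  refine (add_le_add (add_le_add b0 t1) t2).trans (le_of_eq ?_)
  simp only [Finset.sum_const, Finset.card_univ, Fintype.card_fin, nsmul_eq_mul]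
  push_cast
  ring

/-- The local anisotropic Sobolev inequality on `ℝ³`. -/
theorem exists_sobolev_local : ∃ C : NNReal, ∀ F : E3 → E3, ContDiff ℝ ∞ F →
    ‖F 0‖ₑ ^ 2 ≤ C * ∫⁻ z in Metric.closedBall 0 (1 / 4), sobolevDensity F z := by
  obtain ⟨C, hC⟩ := exists_sobolev_compactSupport
  let χ : ContDiffBump (0 : E3) := ⟨1 / 8, 1 / 4, by norm_num, by norm_num⟩
  have hχ : ContDiff ℝ ∞ (χ : E3 → ℝ) := χ.contDiff
  obtain ⟨M, hM0, hM⟩ := exists_bound_pdv hχ χ.hasCompactSupport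
  refine ⟨C * (160 * M.toNNReal ^ 2), fun F hF => ?_⟩
  have h := hC (fun y => χ y • F y) (hχ.smul hF) χ.hasCompactSupport.smul_right 0
  have h1 : χ 0 = 1 := χ.one_of_mem_closedBall (Metric.mem_closedBall_self (by norm_num))
  simp only [h1, one_smul] at h
  refine h.trans ?_
  rw [ENNReal.coe_mul, mul_assoc]
  gcongr
  rw [← lintegral_const_mul' _ _ ENNReal.coe_ne_top, ← lintegral_indicator
    Metric.isClosed_closedBall.measurableSet]
  refine lintegral_mono fun z => ?_
  by_cases hz : z ∈ Metric.closedBall (0 : E3) (1 / 4)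
  · rw [indicator_of_mem hz]
    have hM' : ((M.toNNReal : NNReal) : ℝ) = M := Real.coe_toNNReal _ hM0
    exact sobolevDensity_smul_le hχ hF (by rw [hM']; exact (hM z).1)
      (by rw [hM']; exact (hM z).2.1) (by rw [hM']; exact (hM z).2.2)
  · rw [indicator_of_notMem hz]
    have ht : z ∉ tsupport (fun y => χ y • F y) := fun h' => hz (by
      have := tsupport_smul_subset_left (χ : E3 → ℝ) F h'
      rwa [χ.tsupport_eq] at this)
    refine le_of_eq ?_
    have t1 : ∀ i, z ∉ tsupport (pdv i (fun y => χ y • F y)) := fun i h' =>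
      ht (tsupport_pdv_subset _ i h')
    have e0 : χ z • F z = 0 :=
      image_eq_zero_of_notMem_tsupport (f := fun y => χ y • F y) ht
    simp only [sobolevDensity, e0, pdv_eq_zero_of_notMem_tsupport ht,
      pdv_eq_zero_of_notMem_tsupport (t1 _)]
    simp

/-! ### Rotations and polar coordinates -/

/-- The infinitesimal rotation `y ↦ e_l ∧ y` about the `l`-th coordinate axis. -/
def gen (l : Fin 3) : E3 →L[ℝ] E3 :=
  (EuclideanSpace.proj (l + 1) : E3 →L[ℝ] ℝ).smulRight (EuclideanSpace.single (l + 2) 1)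
    - (EuclideanSpace.proj (l + 2) : E3 →L[ℝ] ℝ).smulRight (EuclideanSpace.single (l + 1) 1)

theorem gen_apply (l : Fin 3) (y : E3) :
    gen l y = y (l + 1) • EuclideanSpace.single (l + 2) 1
      - y (l + 2) • EuclideanSpace.single (l + 1) 1 := rfl

/-- The rotation by the angle `θ` about the `l`-th coordinate axis, in Rodrigues' form. -/
def rotation (l : Fin 3) (θ : ℝ) : E3 →L[ℝ] E3 :=
  ContinuousLinearMap.id ℝ E3 + Real.sin θ • gen l + (1 - Real.cos θ) • (gen l).comp (gen l)

theorem rotation_apply (l : Fin 3) (θ : ℝ) (y : E3) :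
    rotation l θ y = y + Real.sin θ • gen l y + (1 - Real.cos θ) • gen l (gen l y) := rfl

theorem gen_gen_gen (l : Fin 3) (y : E3) : gen l (gen l (gen l y)) = -gen l y := by
  ext m
  simp only [gen_apply]
  fin_cases l <;> fin_cases m <;> simp

theorem rotation_apply_self (l : Fin 3) (θ : ℝ) (y : E3) : rotation l θ y l = y l := by
  rw [rotation_apply]; simp only [gen_apply]; fin_cases l <;> simp

theorem rotation_apply_add_one (l : Fin 3) (θ : ℝ) (y : E3) :
    rotation l θ y (l + 1) = Real.cos θ * y (l + 1) - Real.sin θ * y (l + 2) := by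
  rw [rotation_apply]; simp only [gen_apply]; fin_cases l <;> simp <;> ring

theorem rotation_apply_add_two (l : Fin 3) (θ : ℝ) (y : E3) :
    rotation l θ y (l + 2) = Real.sin θ * y (l + 1) + Real.cos θ * y (l + 2) := by
  rw [rotation_apply]; simp only [gen_apply]; fin_cases l <;> simp <;> ring

theorem gen_rotation (l : Fin 3) (θ : ℝ) (y : E3) :
    gen l (rotation l θ y) = rotation l θ (gen l y) := by
  simp only [rotation_apply, map_add, map_smul]

theorem rotation_neg_apply (l : Fin 3) (θ : ℝ) (y : E3) :
    rotation l (-θ) (rotation l θ y) = y := by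
  simp only [rotation_apply, Real.sin_neg, Real.cos_neg, map_add, map_smul, gen_gen_gen, map_neg]
  have := Real.sin_sq_add_cos_sq θ
  match_scalars
  · ring
  · ring
  · linear_combination -this

theorem rotation_apply_neg (l : Fin 3) (θ : ℝ) (y : E3) : rotation l θ (rotation l (-θ) y) = y := by
  simpa using rotation_neg_apply l (-θ) y

theorem inner_rotation (l : Fin 3) (θ : ℝ) (y w : E3) :
    inner ℝ (rotation l θ y) (rotation l θ w) = inner ℝ y w := by
  have := Real.sin_sq_add_cos_sq θ
  have e : ∀ a b : E3, inner ℝ a b = a l * b l + a (l + 1) * b (l + 1) + a (l + 2) * b (l + 2) := by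
    intro a b
    simp only [PiLp.inner_apply, Fin.sum_univ_three]
    fin_cases l <;> simp <;> ring
  rw [e, e, rotation_apply_self, rotation_apply_self, rotation_apply_add_one,
    rotation_apply_add_one, rotation_apply_add_two, rotation_apply_add_two]
  linear_combination (y (l + 1) * w (l + 1) + y (l + 2) * w (l + 2)) * this

theorem norm_rotation (l : Fin 3) (θ : ℝ) (y : E3) : ‖rotation l θ y‖ = ‖y‖ := by
  rw [@norm_eq_sqrt_real_inner _ _ _ (rotation l θ y), inner_rotation, ← norm_eq_sqrt_real_inner]

theorem hasDerivAt_rotation_apply (l : Fin 3) {a : ℝ → ℝ} {f : ℝ → E3} {a' : ℝ} {f' : E3} {θ : ℝ}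
    (ha : HasDerivAt a a' θ) (hf : HasDerivAt f f' θ) :
    HasDerivAt (fun t => rotation l (a t) (f t))
      (a' • gen l (rotation l (a θ) (f θ)) + rotation l (a θ) f') θ := by
  have g1 := (gen l).hasFDerivAt.comp_hasDerivAt θ hf
  have g2 := (gen l).hasFDerivAt.comp_hasDerivAt θ g1
  have h := (hf.add (ha.sin.smul g1)).add ((ha.cos.const_sub 1).smul g2)
  refine (h.congr_deriv ?_).congr_of_eventuallyEq (Eventually.of_forall fun t => rfl)
  simp only [rotation_apply, map_add, map_smul, gen_gen_gen, Function.comp_apply]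
  module

theorem contDiff_rotation_apply (l : Fin 3) {a : E3 → ℝ} {f : E3 → E3} (ha : ContDiff ℝ ∞ a)
    (hf : ContDiff ℝ ∞ f) : ContDiff ℝ ∞ (fun z => rotation l (a z) (f z)) := by
  have g1 := (gen l).contDiff.comp hf
  have g2 := (gen l).contDiff.comp g1
  exact (hf.add (ha.sin.smul g1)).add ((contDiff_const.sub ha.cos).smul g2)

/-- The conjugate of an infinitesimal rotation by a rotation about another axis. -/
theorem rotation_gen_add_one (i : Fin 3) (θ : ℝ) (y : E3) :
    rotation i θ (gen (i + 1) y) = Real.cos θ • gen (i + 1) (rotation i θ y)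
      + Real.sin θ • gen (i + 2) (rotation i θ y) := by
  have := Real.sin_sq_add_cos_sq θ
  ext m
  simp only [PiLp.add_apply, PiLp.smul_apply, smul_eq_mul, rotation_apply, gen_apply]
  fin_cases i <;> fin_cases m <;> simp <;> grind

/-- The vector field `Ω̃_l` acting on functions of `x` alone. -/
def rotv (l : Fin 3) (v : E3 → E3) : E3 → E3 :=
  fun x => (x (l + 1) • pdv (l + 2) v x - x (l + 2) • pdv (l + 1) v x)
    + Matrix.toEuclideanLin (rotMat l) (v x)

theorem toEuclideanLin_rotMat (l : Fin 3) (w : E3) :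
    Matrix.toEuclideanLin (rotMat l) w = -gen l w := by
  ext m
  rw [gen_apply, Matrix.toLpLin_apply]
  fin_cases l <;> fin_cases m <;> simp [rotMat, Matrix.mulVec, dotProduct, Fin.sum_univ_three]

theorem rotv_eq (l : Fin 3) (v : E3 → E3) (x : E3) :
    rotv l v x = fderiv ℝ v x (gen l x) - gen l (v x) := by
  rw [rotv, toEuclideanLin_rotMat, gen_apply l x, map_sub, map_smul, map_smul, pdv, pdv,
    sub_eq_add_neg (_ - _)]

theorem _root_.ContDiff.rotv {v : E3 → E3} (hv : ContDiff ℝ ∞ v) (l : Fin 3) :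
    ContDiff ℝ ∞ (rotv l v) := by
  have : PrestressedElastic.rotv l v = fun x => fderiv ℝ v x (gen l x) - gen l (v x) :=
    funext fun x => rotv_eq l v x
  rw [this]
  exact ((hv.fderiv_right (m := ∞) (by simp)).clm_apply (gen l).contDiff).sub
    ((gen l).contDiff.comp hv)

/-- Differentiating the rotated field `R⁻¹ v(R y)` in the angle produces `Ω̃_l`. -/
theorem hasDerivAt_rotate {v : E3 → E3} (hv : ContDiff ℝ ∞ v) (l : Fin 3) (y : E3) (θ : ℝ) :
    HasDerivAt (fun θ => rotation l (-θ) (v (rotation l θ y)))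
      (rotation l (-θ) (rotv l v (rotation l θ y))) θ := by
  have h1 := hasDerivAt_rotation_apply l (hasDerivAt_id θ) (hasDerivAt_const θ y)
  have h2 := (hv.differentiableAt_infty (rotation l θ y)).hasFDerivAt.comp_hasDerivAt θ h1
  refine (hasDerivAt_rotation_apply l (hasDerivAt_neg θ) h2).congr_deriv ?_
  rw [rotv_eq, gen_rotation]
  simp [sub_eq_neg_add]

/-- Polar coordinates near the point `r ν`: a radial one of scale `s` and the angles of two
successive rotations about coordinate axes. -/
def chart (i : Fin 3) (r s : ℝ) (ν z : E3) : E3 :=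
  (r + s * z 0) • rotation i (z 1) (rotation (i + 1) (z 2) ν)

/-- The field `v` in the coordinates `chart`, rotated back to the base point. With this choice the
derivatives in the angles are given by the fields `Ω̃`, and those of the projections `P_α v` too. -/
def pull (i : Fin 3) (r s : ℝ) (ν : E3) (v : E3 → E3) (z : E3) : E3 :=
  rotation (i + 1) (-z 2) (rotation i (-z 1) (v (chart i r s ν z)))

theorem contDiff_coord (m : Fin 3) : ContDiff ℝ ∞ (fun z : E3 => z m) :=
  (EuclideanSpace.proj m : E3 →L[ℝ] ℝ).contDiff

theorem contDiff_chart (i : Fin 3) (r s : ℝ) (ν : E3) : ContDiff ℝ ∞ (chart i r s ν) :=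
  (contDiff_const.add (contDiff_const.mul (contDiff_coord 0))).smul
    (contDiff_rotation_apply i (contDiff_coord 1)
      (contDiff_rotation_apply (i + 1) (contDiff_coord 2) contDiff_const))

theorem contDiff_pull (i : Fin 3) (r s : ℝ) (ν : E3) {v : E3 → E3} (hv : ContDiff ℝ ∞ v) :
    ContDiff ℝ ∞ (pull i r s ν v) :=
  contDiff_rotation_apply (i + 1) (contDiff_coord 2).neg
    (contDiff_rotation_apply i (contDiff_coord 1).neg (hv.comp (contDiff_chart i r s ν)))

theorem fderiv_eq_sum_pdv {V : Type*} [NormedAddCommGroup V] [NormedSpace ℝ V] (f : E3 → V)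
    (x w : E3) : fderiv ℝ f x w = ∑ m : Fin 3, w m • pdv m f x := by
  have e : w = ∑ m : Fin 3, w m • (EuclideanSpace.single m (1 : ℝ) : E3) := by
    ext k
    fin_cases k <;> simp [Fin.sum_univ_three]
  conv_lhs => rw [e]
  simp [map_sum, pdv]

section deriv

variable (i : Fin 3) (r s : ℝ) (ν : E3) {v : E3 → E3}

theorem hasDerivAt_add_mul (a b : ℝ) : HasDerivAt (fun t : ℝ => r + s * (a + t * b)) (s * b) 0 := by
  have h := ((((hasDerivAt_id (0 : ℝ)).mul_const b).const_add a).const_mul s).const_add r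
  simpa using h

theorem pdv_zero_pull (hv : ContDiff ℝ ∞ v) (z : E3) :
    pdv 0 (pull i r s ν v) z
      = s • ∑ m : Fin 3, (rotation i (z 1) (rotation (i + 1) (z 2) ν)) m
          • pull i r s ν (pdv m v) z := by
  refine pdv_eq_of_hasDerivAt ((contDiff_pull i r s ν hv).differentiableAt_infty z) ?_
  set n := rotation i (z 1) (rotation (i + 1) (z 2) ν) with hn
  have h1 : HasDerivAt (fun t : ℝ => (r + s * (z 0 + t * 1)) • n) ((s * 1) • n) 0 :=
    (hasDerivAt_add_mul r s (z 0) 1).smul_const n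
  have e0 : (r + s * (z 0 + 0 * 1)) • n = chart i r s ν z := by simp [chart, hn]
  have hv' := (hv.differentiableAt_infty (chart i r s ν z)).hasFDerivAt
  rw [← e0] at hv'
  have h2 := hv'.comp_hasDerivAt (0 : ℝ) h1
  have h3 := ((rotation (i + 1) (-z 2)).hasFDerivAt.comp_hasDerivAt (0 : ℝ)
    ((rotation i (-z 1)).hasFDerivAt.comp_hasDerivAt (0 : ℝ) h2))
  rw [e0] at h3
  refine (h3.congr_deriv ?_).congr_of_eventuallyEq (Eventually.of_forall fun t => ?_)
  · rw [mul_one, map_smul, fderiv_eq_sum_pdv]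
    simp [map_sum, pull]
  · simp [pull, chart, hn]

theorem pdv_one_pull (hv : ContDiff ℝ ∞ v) (z : E3) :
    pdv 1 (pull i r s ν v) z = pull i r s ν (rotv i v) z := by
  refine pdv_eq_of_hasDerivAt ((contDiff_pull i r s ν hv).differentiableAt_infty z) ?_
  set y := (r + s * z 0) • rotation (i + 1) (z 2) ν with hy
  have h0 : HasDerivAt (fun t : ℝ => z 1 + t) 1 0 := (hasDerivAt_id (0 : ℝ)).const_add _
  have h1 := hasDerivAt_rotate hv i y (z 1 + 0)
  have h2 := h1.scomp (0 : ℝ) h0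
  have h3 := (rotation (i + 1) (-z 2)).hasFDerivAt.comp_hasDerivAt (0 : ℝ) h2
  refine (h3.congr_deriv ?_).congr_of_eventuallyEq (Eventually.of_forall fun t => ?_)
  · simp [pull, chart, hy]
  · simp [pull, chart, hy]

/-- The field `Ω̃_{i+1}` of a field rotated about the `i`-th axis. -/
theorem rotv_rotate (hv : ContDiff ℝ ∞ v) (θ : ℝ) (y : E3) :
    rotv (i + 1) (fun y => rotation i (-θ) (v (rotation i θ y))) y
      = rotation i (-θ) (Real.cos θ • rotv (i + 1) v (rotation i θ y)
          + Real.sin θ • rotv (i + 2) v (rotation i θ y)) := by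
  have e1 := rotation_gen_add_one i θ
  have hv' := (hv.differentiableAt_infty (rotation i θ y)).hasFDerivAt
  have hf : fderiv ℝ (fun y => rotation i (-θ) (v (rotation i θ y))) y
      = (rotation i (-θ)).comp ((fderiv ℝ v (rotation i θ y)).comp (rotation i θ)) :=
    ((rotation i (-θ)).hasFDerivAt.comp y (hv'.comp y (rotation i θ).hasFDerivAt)).fderiv
  rw [rotv_eq, hf]
  have a2 : gen (i + 1) (rotation i (-θ) (v (rotation i θ y)))
      = rotation i (-θ) (Real.cos θ • gen (i + 1) (v (rotation i θ y))
        + Real.sin θ • gen (i + 2) (v (rotation i θ y))) := by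
    have := e1 (rotation i (-θ) (v (rotation i θ y)))
    rw [rotation_apply_neg] at this
    rw [← this, rotation_neg_apply]
  rw [a2, ContinuousLinearMap.comp_apply, ContinuousLinearMap.comp_apply, e1, rotv_eq, rotv_eq,
    ← map_sub]
  congr 1
  rw [map_add, map_smul, map_smul]
  module

theorem pdv_two_pull (hv : ContDiff ℝ ∞ v) (z : E3) :
    pdv 2 (pull i r s ν v) z = Real.cos (z 1) • pull i r s ν (rotv (i + 1) v) z
      + Real.sin (z 1) • pull i r s ν (rotv (i + 2) v) z := by
  refine pdv_eq_of_hasDerivAt ((contDiff_pull i r s ν hv).differentiableAt_infty z) ?_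
  set y := (r + s * z 0) • ν with hy
  have hw : ContDiff ℝ ∞ (fun y => rotation i (-z 1) (v (rotation i (z 1) y))) :=
    (rotation i (-z 1)).contDiff.comp (hv.comp (rotation i (z 1)).contDiff)
  have h0 : HasDerivAt (fun t : ℝ => z 2 + t) 1 0 := (hasDerivAt_id (0 : ℝ)).const_add _
  have h1 := hasDerivAt_rotate hw (i + 1) y (z 2 + 0)
  have h2 := h1.scomp (0 : ℝ) h0
  refine (h2.congr_deriv ?_).congr_of_eventuallyEq (Eventually.of_forall fun t => ?_)
  · rw [rotv_rotate i hv]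
    simp [pull, chart, hy]
  · simp [pull, chart, hy]

end deriv

/-! ### Projections, and derivatives in polar coordinates -/

/-- The projections `P_α` at the point `x` as continuous linear maps. -/
def projL (α : Fin 2) (x : E3) : E3 →L[ℝ] E3 :=
  if α = 0 then (innerSL ℝ (‖x‖⁻¹ • x)).smulRight (‖x‖⁻¹ • x)
  else ContinuousLinearMap.id ℝ E3 - (innerSL ℝ (‖x‖⁻¹ • x)).smulRight (‖x‖⁻¹ • x)

theorem projL_apply (α : Fin 2) (x v : E3) : projL α x v = proj α x v := by
  unfold projL proj
  split_ifs <;> simp [real_inner_smul_left]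

theorem proj_zero_add_proj_one (x v : E3) : proj 0 x v + proj 1 x v = v := by simp [proj]

theorem norm_proj_le (α : Fin 2) (x v : E3) : ‖proj α x v‖ ≤ ‖v‖ := by
  set n := ‖x‖⁻¹ • x with hn
  have hle : ‖n‖ ≤ 1 := by
    rw [hn, norm_smul, norm_inv, norm_norm]
    exact inv_mul_le_one
  have hsq : inner ℝ n n = ‖n‖ ^ 2 := real_inner_self_eq_norm_sq n
  unfold proj
  rw [← hn]
  split_ifs
  · rw [norm_smul]
    calc ‖inner ℝ n v‖ * ‖n‖ ≤ (‖n‖ * ‖v‖) * ‖n‖ := by gcongr; exact norm_inner_le_norm n v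
      _ ≤ (1 * ‖v‖) * 1 := by gcongr
      _ = ‖v‖ := by ring
  · refine abs_le_of_sq_le_sq' ?_ (norm_nonneg _) |>.2
    rw [norm_sub_sq_real, norm_smul, inner_smul_right, real_inner_comm]
    have h1 : ‖n‖ ^ 2 ≤ 1 := by nlinarith [norm_nonneg n]
    rw [mul_pow, Real.norm_eq_abs, sq_abs]
    nlinarith [sq_nonneg (inner ℝ n v)]

theorem proj_smul_left {ρ : ℝ} (hρ : 0 < ρ) (α : Fin 2) (x v : E3) :
    proj α (ρ • x) v = proj α x v := by
  have : ‖ρ • x‖⁻¹ • ρ • x = ‖x‖⁻¹ • x := by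
    rw [norm_smul, Real.norm_of_nonneg hρ.le, smul_smul, mul_inv, mul_right_comm,
      inv_mul_cancel₀ hρ.ne', one_mul]
  simp only [proj, this]

theorem proj_rotation (α : Fin 2) (l : Fin 3) (θ : ℝ) (x v : E3) :
    proj α (rotation l θ x) (rotation l θ v) = rotation l θ (proj α x v) := by
  have : ∀ x v : E3, inner ℝ (‖rotation l θ x‖⁻¹ • rotation l θ x) (rotation l θ v)
      = inner ℝ (‖x‖⁻¹ • x) v := fun x v => by
    rw [norm_rotation, ← map_smul, inner_rotation]
  simp only [proj, this]
  rw [norm_rotation]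
  split_ifs <;> simp

/-- Since `P_α` commutes with rotations, the projections of the rotated field are taken at the base
point `ν`, that is, they do not depend on `z`. -/
theorem norm_proj_pull (α : Fin 2) (i : Fin 3) {r s : ℝ} (ν : E3) (v : E3 → E3) {z : E3}
    (hz : 0 < r + s * z 0) :
    ‖proj α ν (pull i r s ν v z)‖ = ‖proj α (chart i r s ν z) (v (chart i r s ν z))‖ := by
  have e : v (chart i r s ν z)
      = rotation i (z 1) (rotation (i + 1) (z 2) (pull i r s ν v z)) := by
    have h1 := rotation_apply_neg (i + 1) (z 2) (rotation i (-z 1) (v (chart i r s ν z)))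
    rw [pull, h1, rotation_apply_neg]
  rw [e]
  conv_rhs => rw [chart, proj_smul_left hz, proj_rotation, norm_rotation, proj_rotation,
    norm_rotation]

/-- The integrand of the weighted Sobolev inequality on a spherical shell. -/
def shellDensity (α : Fin 2) (s : ℝ) (v : E3 → E3) (y : E3) : ENNReal :=
  ‖proj α y (v y)‖ₑ ^ 2 + (∑ l : Fin 3, ‖proj α y (rotv l v y)‖ₑ ^ 2)
    + (∑ l : Fin 3, ∑ m : Fin 3, ‖proj α y (rotv m (rotv l v) y)‖ₑ ^ 2)
    + (∑ m : Fin 3, ‖s • proj α y (pdv m v y)‖ₑ ^ 2)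
    + ∑ l : Fin 3, ∑ m : Fin 3, ‖s • proj α y (pdv m (rotv l v) y)‖ₑ ^ 2

theorem pdv_comm {V : Type*} [NormedAddCommGroup V] [NormedSpace ℝ V] {f : E3 → V}
    (hf : ContDiff ℝ ∞ f) (i j : Fin 3) (x : E3) : pdv i (pdv j f) x = pdv j (pdv i f) x := by
  have hd : DifferentiableAt ℝ (fderiv ℝ f) x :=
    (hf.fderiv_right (m := ∞) (by simp)).differentiable (by simp) x
  have e : ∀ i j : Fin 3, pdv i (pdv j f) x
      = fderiv ℝ (fderiv ℝ f) x (EuclideanSpace.single i 1) (EuclideanSpace.single j 1) := by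
    intro i j
    have : fderiv ℝ (pdv j f) x = (fderiv ℝ (fderiv ℝ f) x).flip (EuclideanSpace.single j 1) :=
      (hd.hasFDerivAt.clm_apply (hasFDerivAt_const _ _)).fderiv.trans (by simp)
    rw [pdv, this]
    rfl
  rw [e, e]
  have hs : IsSymmSndFDerivAt ℝ f x := by
    refine hf.contDiffAt.isSymmSndFDerivAt ?_
    simp only [minSmoothness_of_isRCLikeNormedField]
    exact WithTop.coe_le_coe.2 (le_top : (2 : ℕ∞) ≤ ⊤)
  exact hs _ _

theorem pdv_const_mul_coord {i k : Fin 3} (hik : i ≠ k) {g : ℝ → ℝ} (hg : ContDiff ℝ ∞ g)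
    {f : E3 → E3} (hf : ContDiff ℝ ∞ f) (z : E3) :
    pdv i (fun z => g (z k) • f z) z = g (z k) • pdv i f z := by
  have hg' : ContDiff ℝ ∞ (fun z : E3 => g (z k)) := hg.comp (contDiff_coord k)
  rw [pdv_smul (hg'.differentiableAt_infty z) (hf.differentiableAt_infty z)]
  have : pdv i (fun z : E3 => g (z k)) z = 0 := by
    refine pdv_eq_of_hasDerivAt (hg'.differentiableAt_infty z) ?_
    have : (fun s : ℝ => g ((z + s • (EuclideanSpace.single i 1 : E3)) k)) = fun _ => g (z k) := by
      funext s
      simp [hik.symm]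
    rw [this]
    exact hasDerivAt_const _ _
  rw [this, zero_smul, add_zero]

theorem abs_coord_le_norm (y : E3) (m : Fin 3) : |y m| ≤ ‖y‖ := by
  simpa using PiLp.norm_apply_le y m

/-- In polar coordinates the anisotropic Sobolev density is controlled by the fields `Ω̃`, and by
the Cartesian derivatives multiplied by the radial scale. -/
theorem sobolevDensity_pull_le (α : Fin 2) (i : Fin 3) {r s : ℝ} {ν : E3} (hν : ‖ν‖ = 1)
    {v : E3 → E3} (hv : ContDiff ℝ ∞ v) {z : E3} (hz : 0 < r + s * z 0) :
    sobolevDensity (fun z => projL α ν (pull i r s ν v z)) z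
      ≤ 360 * shellDensity α s v (chart i r s ν z) := by
  set y := chart i r s ν z with hy
  set P := projL α ν with hP
  set S := shellDensity α s v y with hS
  set t := S ^ (1 / 2 : ℝ) with ht
  have dl : ∀ a b : ENNReal, a ≤ a + b := fun _ _ => le_self_add
  have dr : ∀ a b : ENNReal, b ≤ a + b := fun _ _ => le_add_self
  -- the individual terms of the density
  have q : ∀ w : E3 → E3, ‖P (pull i r s ν w z)‖ₑ = ‖proj α y (w y)‖ₑ := fun w => by
    rw [← ofReal_norm, ← ofReal_norm, hP, projL_apply, norm_proj_pull α i ν w hz]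
  have q0 : ‖P (pull i r s ν v z)‖ₑ ≤ t := by
    rw [q]
    refine ENNReal_le_rpow_half ?_
    rw [hS, shellDensity, add_assoc, add_assoc, add_assoc]
    exact dl _ _
  have q1 : ∀ l, ‖P (pull i r s ν (rotv l v) z)‖ₑ ≤ t := fun l => by
    rw [q]
    refine ENNReal_le_rpow_half ((Finset.single_le_sum
      (f := fun l => ‖proj α y (rotv l v y)‖ₑ ^ 2) (fun _ _ => zero_le)
      (Finset.mem_univ l)).trans ?_)
    rw [hS, shellDensity]
    exact (dr _ _).trans ((dl _ _).trans ((dl _ _).trans (dl _ _)))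
  have q2 : ∀ l m, ‖P (pull i r s ν (rotv m (rotv l v)) z)‖ₑ ≤ t := fun l m => by
    rw [q]
    refine ENNReal_le_rpow_half ((Finset.single_le_sum
      (f := fun m => ‖proj α y (rotv m (rotv l v) y)‖ₑ ^ 2) (fun _ _ => zero_le)
      (Finset.mem_univ m)).trans ((Finset.single_le_sum
      (f := fun l => ∑ m, ‖proj α y (rotv m (rotv l v) y)‖ₑ ^ 2) (fun _ _ => zero_le)
      (Finset.mem_univ l)).trans ?_))
    rw [hS, shellDensity]
    exact (dr _ _).trans ((dl _ _).trans (dl _ _))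
  have q3 : ∀ m, ‖s • P (pull i r s ν (pdv m v) z)‖ₑ ≤ t := fun m => by
    rw [enorm_smul, q, ← enorm_smul]
    refine ENNReal_le_rpow_half ((Finset.single_le_sum
      (f := fun m => ‖s • proj α y (pdv m v y)‖ₑ ^ 2) (fun _ _ => zero_le)
      (Finset.mem_univ m)).trans ?_)
    rw [hS, shellDensity]
    exact (dr _ _).trans (dl _ _)
  have q4 : ∀ l m, ‖s • P (pull i r s ν (pdv m (rotv l v)) z)‖ₑ ≤ t := fun l m => by
    rw [enorm_smul, q, ← enorm_smul]
    refine ENNReal_le_rpow_half ((Finset.single_le_sum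
      (f := fun m => ‖s • proj α y (pdv m (rotv l v) y)‖ₑ ^ 2) (fun _ _ => zero_le)
      (Finset.mem_univ m)).trans ((Finset.single_le_sum
      (f := fun l => ∑ m, ‖s • proj α y (pdv m (rotv l v) y)‖ₑ ^ 2) (fun _ _ => zero_le)
      (Finset.mem_univ l)).trans ?_))
    rw [hS, shellDensity]
    exact dr _ _
  -- linear combinations with coefficients bounded by one
  have sm : ∀ {c : ℝ} {w : E3} {T : ENNReal}, |c| ≤ 1 → ‖w‖ₑ ≤ T → ‖c • w‖ₑ ≤ T :=
    fun {c w T} hc hw => by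
      rw [enorm_smul]
      refine (mul_le_mul' (b := 1) ?_ hw).trans (one_mul T).le
      rw [← ofReal_norm, Real.norm_eq_abs]
      exact (ENNReal.ofReal_le_ofReal hc).trans (by simp)
  set n := rotation i (z 1) (rotation (i + 1) (z 2) ν) with hn
  have hn1 : ∀ m, |n m| ≤ 1 := fun m => by
    refine (abs_coord_le_norm n m).trans (le_of_eq ?_)
    rw [hn, norm_rotation, norm_rotation, hν]
  have comb0 : ∀ {w : E3 → E3}, ContDiff ℝ ∞ w →
      (∀ m, ‖s • P (pull i r s ν (pdv m w) z)‖ₑ ≤ t) →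
      ‖P (pdv 0 (pull i r s ν w) z)‖ₑ ≤ 3 * t := fun {w} hw h => by
    rw [pdv_zero_pull i r s ν hw z, ← hn, Finset.smul_sum, map_sum]
    refine (enorm_sum_le _ _).trans ((Finset.sum_le_sum fun m _ => ?_).trans_eq
      (by simp : ∑ m : Fin 3, t = 3 * t))
    rw [smul_comm, map_smul, map_smul]
    exact sm (hn1 m) (h m)
  have comb2 : ∀ {w₁ w₂ : E3} {T : ENNReal}, ‖w₁‖ₑ ≤ T → ‖w₂‖ₑ ≤ T →
      ‖Real.cos (z 1) • w₁ + Real.sin (z 1) • w₂‖ₑ ≤ 2 * T := fun {w₁ w₂ T} h1 h2 => by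
    refine (enorm_add_le _ _).trans ((add_le_add (sm (Real.abs_cos_le_one _) h1)
      (sm (Real.abs_sin_le_one _) h2)).trans_eq (two_mul T).symm)
  have hpull : ∀ {w : E3 → E3}, ContDiff ℝ ∞ w → ContDiff ℝ ∞ (pull i r s ν w) :=
    fun hw => contDiff_pull i r s ν hw
  have hPd : ∀ {w : E3 → E3}, ContDiff ℝ ∞ w → ∀ m,
      pdv m (fun z => P (w z)) = fun z => P (pdv m w z) :=
    fun hw m => funext fun z => pdv_clm P (hw.differentiableAt_infty z) m
  have e1 : pdv 1 (pull i r s ν v) = pull i r s ν (rotv i v) :=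
    funext fun z => pdv_one_pull i r s ν hv z
  have e2 : pdv 2 (pull i r s ν v) = fun z => Real.cos (z 1) • pull i r s ν (rotv (i + 1) v) z
      + Real.sin (z 1) • pull i r s ν (rotv (i + 2) v) z :=
    funext fun z => pdv_two_pull i r s ν hv z
  have hcs : ∀ {m : Fin 3}, m ≠ 1 → pdv m (pdv 2 (pull i r s ν v)) z
      = Real.cos (z 1) • pdv m (pull i r s ν (rotv (i + 1) v)) z
        + Real.sin (z 1) • pdv m (pull i r s ν (rotv (i + 2) v)) z := fun {m} hm => by
    have c1 : ContDiff ℝ ∞ (fun z : E3 => Real.cos (z 1) • pull i r s ν (rotv (i + 1) v) z) :=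
      (contDiff_coord 1).cos.smul (hpull (hv.rotv _))
    have c2 : ContDiff ℝ ∞ (fun z : E3 => Real.sin (z 1) • pull i r s ν (rotv (i + 2) v) z) :=
      (contDiff_coord 1).sin.smul (hpull (hv.rotv _))
    rw [e2, pdv_add (c1.differentiableAt_infty z) (c2.differentiableAt_infty z),
      pdv_const_mul_coord hm Real.contDiff_cos (hpull (hv.rotv _)),
      pdv_const_mul_coord hm Real.contDiff_sin (hpull (hv.rotv _))]
  -- the derivatives of first order
  have f0 : ‖P (pdv 0 (pull i r s ν v) z)‖ₑ ≤ 3 * t := comb0 hv q3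
  have f1 : ‖P (pdv 1 (pull i r s ν v) z)‖ₑ ≤ t := by rw [e1]; exact q1 i
  have f2 : ‖P (pdv 2 (pull i r s ν v) z)‖ₑ ≤ 2 * t := by
    rw [e2, map_add, map_smul, map_smul]
    exact comb2 (q1 _) (q1 _)
  -- the derivatives of second order
  have f11 : ‖P (pdv 1 (pdv 1 (pull i r s ν v)) z)‖ₑ ≤ t := by
    rw [e1, pdv_one_pull i r s ν (hv.rotv i)]
    exact q2 i i
  have f21 : ‖P (pdv 2 (pdv 1 (pull i r s ν v)) z)‖ₑ ≤ 2 * t := by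
    rw [e1, pdv_two_pull i r s ν (hv.rotv i), map_add, map_smul, map_smul]
    exact comb2 (q2 _ _) (q2 _ _)
  have f12 : ‖P (pdv 1 (pdv 2 (pull i r s ν v)) z)‖ₑ ≤ 2 * t := by
    rw [pdv_comm (hpull hv)]; exact f21
  have f10 : ‖P (pdv 1 (pdv 0 (pull i r s ν v)) z)‖ₑ ≤ 3 * t := by
    rw [pdv_comm (hpull hv), e1]
    exact comb0 (hv.rotv i) (q4 i)
  have f20 : ‖P (pdv 2 (pdv 0 (pull i r s ν v)) z)‖ₑ ≤ 2 * (3 * t) := by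
    rw [pdv_comm (hpull hv), hcs (by decide), map_add, map_smul, map_smul]
    exact comb2 (comb0 (hv.rotv _) (q4 _)) (comb0 (hv.rotv _) (q4 _))
  have f22 : ‖P (pdv 2 (pdv 2 (pull i r s ν v)) z)‖ₑ ≤ 2 * (2 * t) := by
    rw [hcs (by decide), map_add, map_smul, map_smul, pdv_two_pull i r s ν (hv.rotv _),
      pdv_two_pull i r s ν (hv.rotv _), map_add, map_smul, map_smul, map_add, map_smul, map_smul]
    exact comb2 (comb2 (q2 _ _) (q2 _ _)) (comb2 (q2 _ _) (q2 _ _))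
  have up : ∀ {a : ENNReal} {k : ENNReal}, k ≤ 6 → a ≤ k * t → a ^ 2 ≤ 36 * S :=
    fun {a k} hk h => by
      have : a ≤ 6 * t := h.trans (by gcongr)
      calc a ^ 2 ≤ (6 * t) ^ 2 := by gcongr
        _ = 36 * S := by rw [mul_pow, ht, ENNReal_rpow_half_sq]; norm_num
  have up1 : ∀ {a : ENNReal}, a ≤ t → a ^ 2 ≤ 36 * S := fun {a} h =>
    up (k := 1) (by norm_num) (by rwa [one_mul])
  rw [sobolevDensity]
  simp only [hPd (hpull hv), hPd ((hpull hv).pdv _), Fin.sum_univ_three, Fin.sum_univ_two]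
  rw [show (Fin.succ (0 : Fin 2)) = (1 : Fin 3) from rfl,
    show (Fin.succ (1 : Fin 2)) = (2 : Fin 3) from rfl]
  calc _ ≤ 36 * S + (36 * S + 36 * S + 36 * S) + ((36 * S + 36 * S) + (36 * S + 36 * S)
        + (36 * S + 36 * S)) := by
        refine add_le_add (add_le_add (up1 q0) (add_le_add (add_le_add (up (by norm_num) f0)
          (up1 f1)) (up (by norm_num) f2))) (add_le_add (add_le_add (add_le_add
          (up (by norm_num) f10) ?_) (add_le_add (up1 f11) (up (by norm_num) f21)))
          (add_le_add (up (by norm_num) f12) ?_))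
        · exact up (k := 6) le_rfl (f20.trans_eq (by rw [← mul_assoc]; norm_num))
        · exact up (k := 4) (by norm_num) (f22.trans_eq (by rw [← mul_assoc]; norm_num))
    _ = 360 * S := by ring

/-! ### The Sobolev inequality on a spherical shell -/

theorem rotation_add_one_apply_two (i : Fin 3) (θ : ℝ) (y : E3) :
    rotation (i + 1) θ y (i + 2) = Real.cos θ * y (i + 2) - Real.sin θ * y i := by
  have := rotation_apply_add_one (i + 1) θ y
  rwa [show i + 1 + 1 = i + 2 by fin_cases i <;> rfl, show i + 1 + 2 = i by fin_cases i <;> rfl]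
    at this

theorem rotation_add_one_apply_zero (i : Fin 3) (θ : ℝ) (y : E3) :
    rotation (i + 1) θ y i = Real.sin θ * y (i + 2) + Real.cos θ * y i := by
  have := rotation_apply_add_two (i + 1) θ y
  rwa [show i + 1 + 1 = i + 2 by fin_cases i <;> rfl, show i + 1 + 2 = i by fin_cases i <;> rfl]
    at this

/-- A choice of the axes for which the Jacobian does not vanish at `ν`. -/
theorem exists_large_coord {ν : E3} (hν : ‖ν‖ = 1) :
    ∃ i : Fin 3, 1 / 2 ≤ |ν (i + 2)| ∧ |ν i| ≤ |ν (i + 2)| := by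
  obtain ⟨k, hk⟩ := Finite.exists_max fun k : Fin 3 => |ν k|
  have h2 : ν 0 ^ 2 + ν 1 ^ 2 + ν 2 ^ 2 = 1 := by
    have := EuclideanSpace.real_norm_sq_eq ν
    rw [hν, Fin.sum_univ_three] at this
    linarith
  refine ⟨k + 1, ?_, ?_⟩
  · rw [show k + 1 + 2 = k by fin_cases k <;> rfl]
    have h0 := hk 0
    have h1 := hk 1
    have h3 := hk 2
    by_contra! h
    have a : ∀ m, |ν m| ≤ |ν k| → ν m ^ 2 < 1 / 4 := fun m hm => by
      rw [← sq_abs]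
      nlinarith [abs_nonneg (ν m)]
    linarith [a 0 h0, a 1 h1, a 2 h3]
  · rw [show k + 1 + 2 = k by fin_cases k <;> rfl]
    exact hk _

theorem cos_sub_abs_sin_ge {θ : ℝ} (h : |θ| ≤ 1 / 4) : 1 / 2 ≤ Real.cos θ - |Real.sin θ| := by
  have h1 := Real.one_sub_sq_div_two_le_cos (x := θ)
  have h2 : |Real.sin θ| ≤ |θ| := Real.abs_sin_le_abs
  have h3 : θ ^ 2 ≤ 1 / 16 := by rw [← sq_abs]; nlinarith [abs_nonneg θ]
  linarith

/-- The factor of the Jacobian of `chart` that depends on the angles stays away from zero. -/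
theorem abs_comb_ge {a b θ : ℝ} (ha : 1 / 2 ≤ |a|) (hab : |b| ≤ |a|) (h : |θ| ≤ 1 / 4) :
    1 / 4 ≤ |Real.cos θ * a - Real.sin θ * b| := by
  have h1 := cos_sub_abs_sin_ge h
  have h2 : |Real.cos θ * a| - |Real.sin θ * b| ≤ |Real.cos θ * a - Real.sin θ * b| :=
    abs_sub_abs_le_abs_sub _ _
  have h3 : Real.cos θ ≤ |Real.cos θ| := le_abs_self _
  rw [abs_mul, abs_mul] at h2
  nlinarith [abs_nonneg (Real.sin θ), abs_nonneg a, abs_nonneg b]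

theorem abs_coord_le_of_mem {z : E3} {ρ : ℝ} (hz : z ∈ Metric.closedBall (0 : E3) ρ) (m : Fin 3) :
    |z m| ≤ ρ :=
  (abs_coord_le_norm z m).trans (by simpa using hz)

section chart

variable {i : Fin 3} {r s : ℝ} {ν : E3}

theorem pdv_zero_chart (z : E3) :
    pdv 0 (chart i r s ν) z = s • rotation i (z 1) (rotation (i + 1) (z 2) ν) := by
  refine pdv_eq_of_hasDerivAt ((contDiff_chart i r s ν).differentiableAt_infty z) ?_
  have h1 := (hasDerivAt_add_mul r s (z 0) 1).smul_const
    (rotation i (z 1) (rotation (i + 1) (z 2) ν))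
  refine (h1.congr_deriv (by simp)).congr_of_eventuallyEq (Eventually.of_forall fun t => ?_)
  simp [chart]

theorem pdv_one_chart (z : E3) :
    pdv 1 (chart i r s ν) z
      = (r + s * z 0) • rotation i (z 1) (gen i (rotation (i + 1) (z 2) ν)) := by
  refine pdv_eq_of_hasDerivAt ((contDiff_chart i r s ν).differentiableAt_infty z) ?_
  have h0 : HasDerivAt (fun t : ℝ => z 1 + t) 1 0 := (hasDerivAt_id (0 : ℝ)).const_add _
  have h1 := (hasDerivAt_rotation_apply i h0
    (hasDerivAt_const (0 : ℝ) (rotation (i + 1) (z 2) ν))).const_smul (r + s * z 0)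
  refine (h1.congr_deriv ?_).congr_of_eventuallyEq (Eventually.of_forall fun t => ?_)
  · rw [gen_rotation]; simp
  · simp [chart]

theorem pdv_two_chart (z : E3) :
    pdv 2 (chart i r s ν) z
      = (r + s * z 0) • rotation i (z 1) (gen (i + 1) (rotation (i + 1) (z 2) ν)) := by
  refine pdv_eq_of_hasDerivAt ((contDiff_chart i r s ν).differentiableAt_infty z) ?_
  have h0 : HasDerivAt (fun t : ℝ => z 2 + t) 1 0 := (hasDerivAt_id (0 : ℝ)).const_add _
  have h1 := ((rotation i (z 1)).hasFDerivAt.comp_hasDerivAt (0 : ℝ)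
    (hasDerivAt_rotation_apply (i + 1) h0
      (hasDerivAt_const (0 : ℝ) ν))).const_smul (r + s * z 0)
  refine (h1.congr_deriv ?_).congr_of_eventuallyEq (Eventually.of_forall fun t => ?_)
  · simp
  · simp [chart]

theorem det_eq_det_columns (L : E3 →L[ℝ] E3) :
    L.det = (Matrix.of fun k m : Fin 3 => L (EuclideanSpace.single m 1) k).det := by
  rw [ContinuousLinearMap.det, ← LinearMap.det_toMatrix (EuclideanSpace.basisFun (Fin 3) ℝ).toBasis]
  rfl

theorem det_rotation (l : Fin 3) (θ : ℝ) : (rotation l θ).det = 1 := by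
  have := Real.sin_sq_add_cos_sq θ
  rw [det_eq_det_columns, Matrix.det_fin_three]
  simp only [Matrix.of_apply, rotation_apply, gen_apply]
  fin_cases l <;> simp <;> linear_combination this

/-- The Jacobian determinant of the polar coordinates. -/
theorem det_fderiv_chart (hν : ‖ν‖ = 1) (z : E3) :
    (fderiv ℝ (chart i r s ν) z).det
      = s * (r + s * z 0) ^ 2 * (rotation (i + 1) (z 2) ν) (i + 2) := by
  set p := rotation (i + 1) (z 2) ν with hp
  have hp1 : p 0 ^ 2 + p 1 ^ 2 + p 2 ^ 2 = 1 := by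
    have := EuclideanSpace.real_norm_sq_eq p
    rw [hp, norm_rotation, hν, Fin.sum_univ_three] at this
    rw [hp]
    linarith
  set ρ := r + s * z 0 with hρ
  let M : E3 →L[ℝ] E3 :=
    (EuclideanSpace.proj 0 : E3 →L[ℝ] ℝ).smulRight (s • p)
      + (EuclideanSpace.proj 1 : E3 →L[ℝ] ℝ).smulRight (ρ • gen i p)
      + (EuclideanSpace.proj 2 : E3 →L[ℝ] ℝ).smulRight (ρ • gen (i + 1) p)
  have hM : fderiv ℝ (chart i r s ν) z = (rotation i (z 1)).comp M := by
    ext w : 1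
    rw [fderiv_eq_sum_pdv, Fin.sum_univ_three, pdv_zero_chart, pdv_one_chart, pdv_two_chart]
    simp [M, map_smul, ← hp, ← hρ]
  have hdet : (fderiv ℝ (chart i r s ν) z).det = (rotation i (z 1)).det * M.det := by
    rw [hM]
    exact LinearMap.det_comp _ _
  rw [hdet, det_rotation, one_mul, det_eq_det_columns, Matrix.det_fin_three]
  have c0 : M (EuclideanSpace.single 0 1) = s • p := by simp [M]
  have c1 : M (EuclideanSpace.single 1 1) = ρ • gen i p := by simp [M]
  have c2 : M (EuclideanSpace.single 2 1) = ρ • gen (i + 1) p := by simp [M]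
  simp only [Matrix.of_apply, c0, c1, c2, gen_apply]
  clear_value p ρ
  clear hM hdet c0 c1 c2 M
  fin_cases i
  · simp
    linear_combination s * ρ ^ 2 * p 2 * hp1
  · simp
    linear_combination s * ρ ^ 2 * p 0 * hp1
  · simp
    linear_combination s * ρ ^ 2 * p 1 * hp1

/-- The norm of a point determines the radial coordinate, its `i`-th coordinate the inner angle, and
the other two coordinates the outer angle. -/
theorem chart_injOn (hν : ‖ν‖ = 1) (h1 : 1 / 2 ≤ |ν (i + 2)|) (h2 : |ν i| ≤ |ν (i + 2)|)
    (hs : 0 < s) (hsr : s ≤ r) : InjOn (chart i r s ν) (Metric.closedBall 0 (1 / 4)) := by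
  intro z hz w hw h
  have cz := abs_coord_le_of_mem hz
  have cw := abs_coord_le_of_mem hw
  have pos : ∀ a : ℝ, |a| ≤ 1 / 4 → 0 < r + s * a := fun a ha => by
    have := abs_le.1 ha
    nlinarith
  have hn : ∀ z : E3, |z 0| ≤ 1 / 4 → ‖chart i r s ν z‖ = r + s * z 0 := fun z h => by
    rw [chart, norm_smul, norm_rotation, norm_rotation, hν, mul_one,
      Real.norm_of_nonneg (pos _ h).le]
  have e0 : z 0 = w 0 := by
    have h' := congrArg norm h
    rw [hn z (cz 0), hn w (cw 0)] at h'
    exact mul_left_cancel₀ hs.ne' (by linarith)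
  have hR : rotation i (z 1) (rotation (i + 1) (z 2) ν)
      = rotation i (w 1) (rotation (i + 1) (w 2) ν) := by
    rw [chart, chart, ← e0] at h
    exact smul_right_injective E3 (pos _ (cz 0)).ne' h
  have e2 : z 2 = w 2 := by
    have h' := congrArg (fun y : E3 => y i) hR
    simp only [rotation_apply_self, rotation_add_one_apply_zero] at h'
    have hd : |(z 2 - w 2) / 2| ≤ 1 / 4 := by
      have a := abs_le.1 (cz 2)
      have b := abs_le.1 (cw 2)
      rw [abs_le]; constructor <;> linarith
    have hm : |(z 2 + w 2) / 2| ≤ 1 / 4 := by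
      have a := abs_le.1 (cz 2)
      have b := abs_le.1 (cw 2)
      rw [abs_le]; constructor <;> linarith
    have hne := abs_comb_ge h1 h2 hm
    have hprod : Real.sin ((z 2 - w 2) / 2)
        * (Real.cos ((z 2 + w 2) / 2) * ν (i + 2) - Real.sin ((z 2 + w 2) / 2) * ν i) = 0 := by
      have s1 := Real.sin_sub_sin (z 2) (w 2)
      have s2 := Real.cos_sub_cos (z 2) (w 2)
      linear_combination (1 / 2) * h' - (1 / 2) * ν (i + 2) * s1 - (1 / 2) * ν i * s2
    rcases mul_eq_zero.1 hprod with h0 | h0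
    · have := Real.injOn_sin (x₁ := (z 2 - w 2) / 2) (x₂ := 0)
        ⟨by linarith [(abs_le.1 hd).1, Real.pi_gt_three],
          by linarith [(abs_le.1 hd).2, Real.pi_gt_three]⟩
        ⟨by linarith [Real.pi_gt_three], by linarith [Real.pi_gt_three]⟩ (by rw [h0, Real.sin_zero])
      linarith
    · rw [h0, abs_zero] at hne
      norm_num at hne
  have e1 : z 1 = w 1 := by
    rw [← e2] at hR
    set p := rotation (i + 1) (z 2) ν with hp
    have hpk : 1 / 4 ≤ |p (i + 2)| := by
      rw [hp, rotation_add_one_apply_two]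
      exact abs_comb_ge h1 h2 (cz 2)
    have a1 := congrArg (fun y : E3 => y (i + 1)) hR
    have a2 := congrArg (fun y : E3 => y (i + 2)) hR
    simp only [rotation_apply_add_one, rotation_apply_add_two] at a1 a2
    have hpos : 0 < p (i + 1) ^ 2 + p (i + 2) ^ 2 := by
      have : 0 < |p (i + 2)| ^ 2 := by positivity
      rw [sq_abs] at this
      positivity
    have hsin : Real.sin (z 1) = Real.sin (w 1) := by
      have : (p (i + 1) ^ 2 + p (i + 2) ^ 2) * (Real.sin (z 1) - Real.sin (w 1)) = 0 := by
        linear_combination p (i + 1) * a2 - p (i + 2) * a1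
      rcases mul_eq_zero.1 this with h0 | h0
      · exact absurd h0 hpos.ne'
      · linarith
    exact Real.injOn_sin
      ⟨by linarith [(abs_le.1 (cz 1)).1, Real.pi_gt_three],
        by linarith [(abs_le.1 (cz 1)).2, Real.pi_gt_three]⟩
      ⟨by linarith [(abs_le.1 (cw 1)).1, Real.pi_gt_three],
        by linarith [(abs_le.1 (cw 1)).2, Real.pi_gt_three]⟩ hsin
  ext m
  fin_cases m
  · exact e0
  · exact e1
  · exact e2

/-- The spherical shell of radius `r` and half-width `δ`. -/
def shell (r δ : ℝ) : Set E3 := {y | |‖y‖ - r| ≤ δ}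

theorem measurableSet_shell (r δ : ℝ) : MeasurableSet (shell r δ) := by
  unfold shell
  exact measurableSet_le (by fun_prop) measurable_const

theorem lintegral_chart_le (hν : ‖ν‖ = 1) (h1 : 1 / 2 ≤ |ν (i + 2)|) (h2 : |ν i| ≤ |ν (i + 2)|)
    (hs : 0 < s) (hsr : s ≤ r) (g : E3 → ENNReal) :
    ENNReal.ofReal (s * r ^ 2) * ∫⁻ z in Metric.closedBall 0 (1 / 4), g (chart i r s ν z)
      ≤ 8 * ∫⁻ y in shell r (s / 4), g y := by
  have hms : MeasurableSet (Metric.closedBall (0 : E3) (1 / 4)) :=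
    Metric.isClosed_closedBall.measurableSet
  have hr : 0 < r := hs.trans_le hsr
  have hcv := lintegral_image_eq_lintegral_abs_det_fderiv_mul volume hms
    (fun z _ => ((contDiff_chart i r s ν).differentiableAt_infty z).hasFDerivAt.hasFDerivWithinAt)
    (chart_injOn hν h1 h2 hs hsr) g
  have hsub : chart i r s ν '' Metric.closedBall 0 (1 / 4) ⊆ shell r (s / 4) := by
    rintro _ ⟨z, hz, rfl⟩
    have cz := abs_coord_le_of_mem hz 0
    have hz' := abs_le.1 cz
    have : 0 ≤ r + s * z 0 := by nlinarith
    rw [shell, mem_ofPred_eq, chart, norm_smul, norm_rotation, norm_rotation, hν, mul_one,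
      Real.norm_of_nonneg this, add_sub_cancel_left, abs_mul, abs_of_pos hs]
    nlinarith
  have hle : ENNReal.ofReal (s * r ^ 2 / 8)
      * ∫⁻ z in Metric.closedBall 0 (1 / 4), g (chart i r s ν z)
      ≤ ∫⁻ y in shell r (s / 4), g y := by
    rw [← lintegral_const_mul' _ _ ENNReal.ofReal_ne_top]
    refine le_trans ?_ (hcv.symm.le.trans (lintegral_mono_set hsub))
    refine setLIntegral_mono' hms fun z hz => ?_
    gcongr
    have cz := abs_coord_le_of_mem hz
    have hz' := abs_le.1 (cz 0)
    have hp : 1 / 4 ≤ |(rotation (i + 1) (z 2) ν) (i + 2)| := by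
      rw [rotation_add_one_apply_two]
      exact abs_comb_ge h1 h2 (cz 2)
    rw [det_fderiv_chart hν, abs_mul, abs_of_nonneg (by positivity : 0 ≤ s * (r + s * z 0) ^ 2)]
    have hρ : 3 / 4 * r ≤ r + s * z 0 := by nlinarith
    have : (3 / 4 * r) ^ 2 ≤ (r + s * z 0) ^ 2 := by gcongr
    calc s * r ^ 2 / 8 ≤ s * (3 / 4 * r) ^ 2 * (1 / 4) := by nlinarith [mul_pos hs (pow_pos hr 2)]
      _ ≤ s * (r + s * z 0) ^ 2 * |(rotation (i + 1) (z 2) ν) (i + 2)| := by gcongr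
  have e : ENNReal.ofReal (s * r ^ 2) = 8 * ENNReal.ofReal (s * r ^ 2 / 8) := by
    rw [← ENNReal.ofReal_ofNat, ← ENNReal.ofReal_mul (by norm_num)]
    congr 1
    ring
  rw [e, mul_assoc]
  gcongr

end chart

/-- The weighted Sobolev inequality on a spherical shell of radius `r = |x|` and width
comparable to `s`. -/
theorem exists_sobolev_shell : ∃ C : NNReal, ∀ (v : E3 → E3), ContDiff ℝ ∞ v →
    ∀ (α : Fin 2) (x : E3) (s : ℝ), 0 < s → s ≤ ‖x‖ →
      ENNReal.ofReal (s * ‖x‖ ^ 2) * ‖proj α x (v x)‖ₑ ^ 2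
        ≤ C * ∫⁻ y in shell ‖x‖ (s / 4), shellDensity α s v y := by
  obtain ⟨C, hC⟩ := exists_sobolev_local
  refine ⟨C * 360 * 8, fun v hv α x s hs hsr => ?_⟩
  have hr : 0 < ‖x‖ := hs.trans_le hsr
  set r := ‖x‖ with hrd
  set ν := r⁻¹ • x with hνd
  have hν : ‖ν‖ = 1 := by
    rw [hνd, norm_smul, norm_inv, hrd, norm_norm, inv_mul_cancel₀ hr.ne']
  obtain ⟨i, h1, h2⟩ := exists_large_coord hν
  have hx : chart i r s ν 0 = x := by
    have : r • r⁻¹ • x = x := by rw [smul_smul, mul_inv_cancel₀ hr.ne', one_smul]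
    simp [chart, rotation_apply, hνd, this]
  have h0 := hC (fun z => projL α ν (pull i r s ν v z))
    ((projL α ν).contDiff.comp (contDiff_pull i r s ν hv))
  have e0 : ‖projL α ν (pull i r s ν v 0)‖ₑ = ‖proj α x (v x)‖ₑ := by
    rw [← ofReal_norm, ← ofReal_norm, projL_apply, norm_proj_pull α i ν v (by simpa using hr), hx]
  rw [e0] at h0
  calc _ ≤ ENNReal.ofReal (s * r ^ 2) * (C * ∫⁻ z in Metric.closedBall 0 (1 / 4),
        360 * shellDensity α s v (chart i r s ν z)) := by
        refine mul_le_mul' le_rfl (h0.trans (mul_le_mul' le_rfl ?_))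
        refine setLIntegral_mono' (Metric.isClosed_closedBall (x := (0 : E3))).measurableSet
          fun z hz => ?_
        refine sobolevDensity_pull_le α i hν hv ?_
        have := abs_le.1 (abs_coord_le_of_mem hz 0)
        nlinarith
    _ = C * 360 * (ENNReal.ofReal (s * r ^ 2) * ∫⁻ z in Metric.closedBall 0 (1 / 4),
        shellDensity α s v (chart i r s ν z)) := by
        rw [lintegral_const_mul' _ _ (by norm_num)]
        ring
    _ ≤ C * 360 * (8 * ∫⁻ y in shell r (s / 4), shellDensity α s v y) := by
        refine mul_le_mul' le_rfl ?_
        exact lintegral_chart_le hν h1 h2 hs hsr (shellDensity α s v)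
    _ = _ := by
        push_cast
        ring

/-! ### Sobolev inequalities for `L²` norms -/

/-- The `L²` norm of `P_α f` with respect to the measure `μ`. -/
def projNorm (μ : Measure E3) (α : Fin 2) (f : E3 → E3) : ENNReal :=
  eLpNorm (fun x => proj α x (f x)) 2 μ

/-- The sum of the `L²` norms of the spatial partial derivatives. -/
def gradNorm (f : E3 → E3) : ENNReal := ∑ i : Fin 3, eLpNorm (pdv i f) 2 volume

theorem eLpNorm_two_sq {μ : Measure E3} (f : E3 → E3) :
    eLpNorm f 2 μ ^ 2 = ∫⁻ x, ‖f x‖ₑ ^ 2 ∂μ := by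
  have := eLpNorm_nnreal_pow_eq_lintegral (f := f) (μ := μ) (p := 2) (by norm_num)
  simpa using this

theorem measurable_proj (α : Fin 2) {f : E3 → E3} (hf : Measurable f) :
    Measurable (fun x => proj α x (f x)) := by
  have h : Measurable (fun x : E3 => ‖x‖⁻¹ • x) := by fun_prop
  have h1 : Measurable (fun x : E3 => inner ℝ (‖x‖⁻¹ • x) (f x) • (‖x‖⁻¹ • x)) :=
    Measurable.smul (h.inner (𝕜 := ℝ) hf : Measurable fun x : E3 => inner ℝ (‖x‖⁻¹ • x) (f x)) h
  unfold proj
  split_ifs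
  · exact h1
  · exact hf.sub h1

theorem projNorm_le (μ : Measure E3) (α : Fin 2) (f : E3 → E3) :
    projNorm μ α f ≤ eLpNorm f 2 μ :=
  eLpNorm_mono fun _ => norm_proj_le _ _ _

theorem eLpNorm_restrict_le (S : Set E3) (f : E3 → E3) :
    eLpNorm f 2 (volume.restrict S) ≤ eLpNorm f 2 volume :=
  eLpNorm_mono_measure f Measure.restrict_le_self

theorem sum_sq_le_sq_sum {ι : Type*} (s : Finset ι) (a : ι → ENNReal) :
    ∑ i ∈ s, a i ^ 2 ≤ (∑ i ∈ s, a i) ^ 2 := by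
  rw [sq, Finset.sum_mul]
  refine Finset.sum_le_sum fun i hi => ?_
  rw [sq]
  gcongr
  exact Finset.single_le_sum (fun _ _ => zero_le) hi

theorem add_sq_le_sq_add (a b : ENNReal) : a ^ 2 + b ^ 2 ≤ (a + b) ^ 2 := by
  calc a ^ 2 + b ^ 2 ≤ a ^ 2 + b ^ 2 + 2 * a * b := le_self_add
    _ = (a + b) ^ 2 := by ring

theorem le_of_sq_le_sq {a b : ENNReal} (h : a ^ 2 ≤ b ^ 2) : a ≤ b :=
  (ENNReal_le_rpow_half h).trans_eq (by
    rw [← ENNReal.rpow_natCast, ← ENNReal.rpow_mul]; norm_num)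

/-- The right-hand side of the Sobolev inequality on a spherical shell. -/
def shellNorm (μ : Measure E3) (α : Fin 2) (s : ℝ) (v : E3 → E3) : ENNReal :=
  projNorm μ α v + ∑ l, projNorm μ α (rotv l v) + (∑ l, ∑ m, projNorm μ α (rotv m (rotv l v)))
    + ENNReal.ofReal s * ∑ m, projNorm μ α (pdv m v)
    + ENNReal.ofReal s * ∑ l, ∑ m, projNorm μ α (pdv m (rotv l v))

theorem lintegral_shellDensity_le (μ : Measure E3) (α : Fin 2) {s : ℝ} (hs : 0 ≤ s) {v : E3 → E3}
    (hv : ContDiff ℝ ∞ v) : ∫⁻ y, shellDensity α s v y ∂μ ≤ shellNorm μ α s v ^ 2 := by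
  have hm : ∀ {w : E3 → E3}, ContDiff ℝ ∞ w → Measurable fun y => ‖proj α y (w y)‖ₑ ^ 2 :=
    fun hw => (measurable_proj α hw.continuous.measurable).enorm.pow_const 2
  have hm' : ∀ {w : E3 → E3}, ContDiff ℝ ∞ w → Measurable fun y => ‖s • proj α y (w y)‖ₑ ^ 2 :=
    fun hw => ((measurable_proj α hw.continuous.measurable).const_smul s).enorm.pow_const 2
  have e : ∀ w : E3 → E3, ∫⁻ y, ‖proj α y (w y)‖ₑ ^ 2 ∂μ = projNorm μ α w ^ 2 :=
    fun w => (eLpNorm_two_sq _).symm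
  have e' : ∀ w : E3 → E3, ∫⁻ y, ‖s • proj α y (w y)‖ₑ ^ 2 ∂μ
      = (ENNReal.ofReal s * projNorm μ α w) ^ 2 := fun w => by
    simp only [enorm_smul, mul_pow]
    rw [lintegral_const_mul' _ _ (by simp), e, ← ofReal_norm, Real.norm_of_nonneg hs]
  have m1 : Measurable fun y => ∑ l : Fin 3, ‖proj α y (rotv l v y)‖ₑ ^ 2 :=
    Finset.measurable_sum _ fun l _ => hm (hv.rotv l)
  have m2 : Measurable fun y => ∑ l : Fin 3, ∑ m : Fin 3, ‖proj α y (rotv m (rotv l v) y)‖ₑ ^ 2 :=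
    Finset.measurable_sum _ fun l _ => Finset.measurable_sum _ fun m _ => hm ((hv.rotv l).rotv m)
  have m3 : Measurable fun y => ∑ m : Fin 3, ‖s • proj α y (pdv m v y)‖ₑ ^ 2 :=
    Finset.measurable_sum _ fun l _ => hm' (hv.pdv l)
  have m01 : Measurable fun y => ‖proj α y (v y)‖ₑ ^ 2
    + ∑ l : Fin 3, ‖proj α y (rotv l v y)‖ₑ ^ 2 := (hm hv).add m1
  have m02 : Measurable fun y => ‖proj α y (v y)‖ₑ ^ 2
    + (∑ l : Fin 3, ‖proj α y (rotv l v y)‖ₑ ^ 2)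
    + ∑ l : Fin 3, ∑ m : Fin 3, ‖proj α y (rotv m (rotv l v) y)‖ₑ ^ 2 := m01.add m2
  have m03 : Measurable fun y => ‖proj α y (v y)‖ₑ ^ 2
    + (∑ l : Fin 3, ‖proj α y (rotv l v y)‖ₑ ^ 2)
    + (∑ l : Fin 3, ∑ m : Fin 3, ‖proj α y (rotv m (rotv l v) y)‖ₑ ^ 2)
    + ∑ m : Fin 3, ‖s • proj α y (pdv m v y)‖ₑ ^ 2 := m02.add m3
  unfold shellDensity
  rw [lintegral_add_left m03, lintegral_add_left m02, lintegral_add_left m01,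
    lintegral_add_left (hm hv), lintegral_finsetSum _ fun l _ => hm (hv.rotv l),
    lintegral_finsetSum _ fun l _ => Finset.measurable_sum _ fun m _ => hm ((hv.rotv l).rotv m),
    lintegral_finsetSum _ fun l _ => hm' (hv.pdv l),
    lintegral_finsetSum _ fun l _ => Finset.measurable_sum _ fun m _ => hm' ((hv.rotv l).pdv m)]
  simp only [lintegral_finsetSum _ fun (m : Fin 3) _ => hm ((hv.rotv _).rotv m),
    lintegral_finsetSum _ fun (m : Fin 3) _ => hm' ((hv.rotv _).pdv m), e, e']
  have t2 : ∀ f : Fin 3 → Fin 3 → ENNReal, ∑ l, ∑ m, f l m ^ 2 ≤ (∑ l, ∑ m, f l m) ^ 2 :=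
    fun f => (Finset.sum_le_sum fun l _ => sum_sq_le_sq_sum _ _).trans (sum_sq_le_sq_sum _ _)
  unfold shellNorm
  simp only [Finset.mul_sum]
  refine le_trans (add_le_add (le_trans (add_le_add (le_trans (add_le_add (le_trans (add_le_add
    le_rfl (sum_sq_le_sq_sum _ _)) (add_sq_le_sq_add _ _)) (t2 _)) (add_sq_le_sq_add _ _))
    (sum_sq_le_sq_sum _ _)) (add_sq_le_sq_add _ _)) (t2 _)) (add_sq_le_sq_add _ _)

/-- The Sobolev inequality on a spherical shell, for `L²` norms. -/
theorem exists_norm_proj_le_shellNorm : ∃ C : NNReal, ∀ (v : E3 → E3), ContDiff ℝ ∞ v →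
    ∀ (α : Fin 2) (x : E3) (s : ℝ), 0 < s → s ≤ ‖x‖ →
      ENNReal.ofReal (Real.sqrt s * ‖x‖) * ‖proj α x (v x)‖ₑ
        ≤ C * shellNorm (volume.restrict (shell ‖x‖ (s / 4))) α s v := by
  obtain ⟨C, hC⟩ := exists_sobolev_shell
  refine ⟨NNReal.sqrt C, fun v hv α x s hs hsx => le_of_sq_le_sq ?_⟩
  have h := (hC v hv α x s hs hsx).trans
    (mul_le_mul' le_rfl (lintegral_shellDensity_le _ α hs.le hv))
  rw [mul_pow, mul_pow, ← ENNReal.ofReal_pow (by positivity), mul_pow, Real.sq_sqrt hs.le,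
    ← ENNReal.coe_pow, NNReal.sq_sqrt]
  exact h

/-- The local Sobolev inequality in Cartesian coordinates. -/
theorem exists_norm_le_ball : ∃ C : NNReal, ∀ (v : E3 → E3), ContDiff ℝ ∞ v → ∀ x : E3,
    ‖v x‖ₑ ≤ C * (eLpNorm v 2 (volume.restrict (Metric.closedBall x 1)) + gradNorm v
      + ∑ i, gradNorm (pdv i v)) := by
  obtain ⟨C, hC⟩ := exists_sobolev_local
  refine ⟨NNReal.sqrt C, fun v hv x => le_of_sq_le_sq ?_⟩
  have hT : ContDiff ℝ ∞ (fun z => v (x + z)) := hv.comp (contDiff_const.add contDiff_id)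
  have hp : ∀ w : E3 → E3, ∀ i, pdv i (fun z => w (x + z)) = fun z => pdv i w (x + z) :=
    fun w i => funext fun z => by simp only [pdv, fderiv_comp_add_left]
  have h := hC _ hT
  rw [add_zero] at h
  have e : ∫⁻ z in Metric.closedBall 0 (1 / 4), sobolevDensity (fun z => v (x + z)) z
      = ∫⁻ y in Metric.closedBall x (1 / 4), sobolevDensity v y := by
    have hpre : (fun z => x + z) ⁻¹' Metric.closedBall x (1 / 4) = Metric.closedBall 0 (1 / 4) := by
      ext z; simp
    have h' := (measurePreserving_add_left volume x).setLIntegral_comp_preimage_emb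
      (measurableEmbedding_addLeft x) (sobolevDensity v) (Metric.closedBall x (1 / 4))
    rw [hpre] at h'
    rw [← h']
    simp only [sobolevDensity, hp]
  rw [e] at h
  refine h.trans ?_
  rw [mul_pow, ← ENNReal.coe_pow, NNReal.sq_sqrt]
  refine mul_le_mul' le_rfl ?_
  set μ := volume.restrict (Metric.closedBall x (1 / 4)) with hμ
  have hm : ∀ {w : E3 → E3}, ContDiff ℝ ∞ w → Measurable fun y => ‖w y‖ₑ ^ 2 :=
    fun hw => hw.continuous.measurable.enorm.pow_const 2
  have m1 : Measurable fun y => ∑ i : Fin 3, ‖pdv i v y‖ₑ ^ 2 :=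
    Finset.measurable_sum _ fun l _ => hm (hv.pdv l)
  have m01 : Measurable fun y => ‖v y‖ₑ ^ 2 + ∑ i : Fin 3, ‖pdv i v y‖ₑ ^ 2 := (hm hv).add m1
  unfold sobolevDensity
  rw [lintegral_add_left m01, lintegral_add_left (hm hv),
    lintegral_finsetSum _ fun l _ => hm (hv.pdv l),
    lintegral_finsetSum _ fun l _ => Finset.measurable_sum _ fun m _ => hm ((hv.pdv l).pdv _)]
  simp only [lintegral_finsetSum _ fun (m : Fin 2) _ => hm ((hv.pdv _).pdv m.succ),
    ← eLpNorm_two_sq]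
  have r0 : eLpNorm v 2 μ ≤ eLpNorm v 2 (volume.restrict (Metric.closedBall x 1)) :=
    eLpNorm_mono_measure _ (Measure.restrict_mono (Metric.closedBall_subset_closedBall
      (by norm_num)) le_rfl)
  have r1 : ∀ w : E3 → E3, eLpNorm w 2 μ ≤ eLpNorm w 2 volume := eLpNorm_restrict_le _
  refine le_trans (add_le_add (le_trans (add_le_add (pow_le_pow_left₀ zero_le r0 2) (le_trans
    (sum_sq_le_sq_sum _ _) (pow_le_pow_left₀ zero_le (Finset.sum_le_sum fun i _ =>
    r1 (pdv i v)) 2))) (add_sq_le_sq_add _ _)) (le_trans (Finset.sum_le_sum fun i _ =>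
    le_trans (sum_sq_le_sq_sum _ _) (pow_le_pow_left₀ zero_le ?_ 2)) (sum_sq_le_sq_sum _
    (fun i => gradNorm (pdv i v))))) (add_sq_le_sq_add _ _)
  rw [gradNorm, Fin.sum_univ_succ (fun j => eLpNorm (pdv j (pdv i v)) 2 volume)]
  exact le_add_left (Finset.sum_le_sum fun j _ => r1 _)

theorem norm_fderiv_le_sum (f : E3 → E3) (x : E3) : ‖fderiv ℝ f x‖ ≤ ∑ i : Fin 3, ‖pdv i f x‖ := by
  refine ContinuousLinearMap.opNorm_le_bound _ (Finset.sum_nonneg fun i _ => norm_nonneg _)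
    fun w => ?_
  rw [fderiv_eq_sum_pdv, Finset.sum_mul]
  refine (norm_sum_le _ _).trans (Finset.sum_le_sum fun i _ => ?_)
  rw [norm_smul, mul_comm]
  gcongr
  exact abs_coord_le_norm w i

theorem eLpNorm_fderiv_le {f : E3 → E3} (hf : ContDiff ℝ ∞ f) :
    eLpNorm (fderiv ℝ f) 2 volume ≤ gradNorm f := by
  have h1 : eLpNorm (fderiv ℝ f) 2 volume
      ≤ eLpNorm (∑ i : Fin 3, fun x => ‖pdv i f x‖) 2 volume := by
    refine eLpNorm_mono_real fun x => ?_
    simpa using norm_fderiv_le_sum f x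
  refine h1.trans ((eLpNorm_sum_le (fun i _ => ?_) (by norm_num)).trans_eq ?_)
  · exact (hf.pdv i).continuous.norm.aestronglyMeasurable
  · simp only [eLpNorm_norm, gradNorm]

/-- On a ball of radius `R` a compactly supported function is controlled in `L²` by `R` times its
gradient, by Sobolev's inequality `‖v‖_{L⁶} ≤ C ‖∇v‖_{L²}` and Hölder's inequality. -/
theorem exists_eLpNorm_ball_le_gradNorm : ∃ C : NNReal, ∀ (v : E3 → E3), ContDiff ℝ ∞ v →
    HasCompactSupport v → ∀ (x : E3) (R : ℝ), 0 ≤ R →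
      eLpNorm v 2 (volume.restrict (Metric.closedBall x R))
        ≤ C * ENNReal.ofReal R * gradNorm v := by
  set K := SNormLESNormFDerivOfEqConst E3 (volume : Measure E3) 2
  set B := (volume (Metric.ball (0 : E3) 1)) with hB
  have hBtop : B ≠ ⊤ := measure_ball_lt_top.ne
  have hB3 : B ^ (1 / 3 : ℝ) ≠ ⊤ := ENNReal.rpow_ne_top_of_nonneg (by norm_num) hBtop
  refine ⟨(B ^ (1 / 3 : ℝ)).toNNReal * K, fun v hv hs x R hR => ?_⟩
  have hG : eLpNorm v 6 volume ≤ K * eLpNorm (fderiv ℝ v) 2 volume := by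
    have := eLpNorm_le_eLpNorm_fderiv_of_eq (μ := (volume : Measure E3)) (p := 2) (p' := 6)
      (hv.of_le (by simp)) hs (by norm_num) (by simp) (by simp; norm_num)
    simpa using this
  have hH := eLpNorm_le_eLpNorm_mul_rpow_measure_univ (p := 2) (q := 6)
    (μ := volume.restrict (Metric.closedBall x R)) (f := v) (by norm_num)
    hv.continuous.aestronglyMeasurable
  have hvol : (volume.restrict (Metric.closedBall x R)) univ ^ (1 / (2 : ENNReal).toReal
      - 1 / (6 : ENNReal).toReal) = ENNReal.ofReal R * B ^ (1 / 3 : ℝ) := by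
    rw [Measure.restrict_apply_univ, Measure.addHaar_closedBall _ _ hR, finrank_euclideanSpace_fin,
      ← hB, ENNReal.mul_rpow_of_nonneg _ _ (by norm_num)]
    have e : (1 / (2 : ENNReal).toReal - 1 / (6 : ENNReal).toReal) = 1 / 3 := by
      simp; norm_num
    rw [e, ENNReal.ofReal_rpow_of_nonneg (by positivity) (by norm_num), ← Real.rpow_natCast,
      ← Real.rpow_mul hR]
    norm_num
  rw [hvol] at hH
  refine hH.trans ?_
  calc _ ≤ (K * gradNorm v) * (ENNReal.ofReal R * B ^ (1 / 3 : ℝ)) := by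
        gcongr
        exact (eLpNorm_mono_measure _ Measure.restrict_le_self).trans
          (hG.trans (mul_le_mul' le_rfl (eLpNorm_fderiv_le hv)))
    _ = _ := by
        rw [ENNReal.coe_mul, ENNReal.coe_toNNReal hB3]
        ring

/-! ### Decay without weights -/

theorem shellNorm_le {μ : Measure E3} {α : Fin 2} {s : ℝ} {v : E3 → E3} {T : ENNReal}
    (h0 : projNorm μ α v ≤ T) (h1 : ∀ l, projNorm μ α (rotv l v) ≤ T)
    (h2 : ∀ l m, projNorm μ α (rotv m (rotv l v)) ≤ T)
    (h3 : ∀ m, ENNReal.ofReal s * projNorm μ α (pdv m v) ≤ T)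
    (h4 : ∀ l m, ENNReal.ofReal s * projNorm μ α (pdv m (rotv l v)) ≤ T) :
    shellNorm μ α s v ≤ 25 * T := by
  unfold shellNorm
  simp only [Finset.mul_sum]
  refine (add_le_add (add_le_add (add_le_add (add_le_add h0 (Finset.sum_le_sum fun l _ => h1 l))
    (Finset.sum_le_sum fun l _ => Finset.sum_le_sum fun m _ => h2 l m))
    (Finset.sum_le_sum fun m _ => h3 m))
    (Finset.sum_le_sum fun l _ => Finset.sum_le_sum fun m _ => h4 l m)).trans_eq ?_
  simp only [Finset.sum_const, Finset.card_univ, Fintype.card_fin, nsmul_eq_mul]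
  push_cast
  ring

theorem norm_gen_le (l : Fin 3) (y : E3) : ‖gen l y‖ ≤ ‖y‖ := by
  refine abs_le_of_sq_le_sq' ?_ (norm_nonneg _) |>.2
  rw [EuclideanSpace.real_norm_sq_eq, EuclideanSpace.real_norm_sq_eq, Fin.sum_univ_three,
    Fin.sum_univ_three]
  simp only [gen_apply]
  fin_cases l <;> simp <;> nlinarith [sq_nonneg (y 0), sq_nonneg (y 1), sq_nonneg (y 2)]

theorem eLpNorm_pdv_le_gradNorm (f : E3 → E3) (i : Fin 3) :
    eLpNorm (pdv i f) 2 volume ≤ gradNorm f :=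
  Finset.single_le_sum (f := fun i => eLpNorm (pdv i f) 2 volume) (fun _ _ => zero_le)
    (Finset.mem_univ i)

theorem eLpNorm_rotv_ball_le {f : E3 → E3} (hf : ContDiff ℝ ∞ f) (l : Fin 3) {R : ℝ}
    (hR : 0 ≤ R) :
    eLpNorm (rotv l f) 2 (volume.restrict (Metric.closedBall 0 R))
      ≤ 2 * ENNReal.ofReal R * gradNorm f
        + eLpNorm f 2 (volume.restrict (Metric.closedBall 0 R)) := by
  set μ := (volume : Measure E3).restrict (Metric.closedBall 0 R) with hμ
  have c1 := (hf.pdv (l + 1)).continuous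
  have c2 := (hf.pdv (l + 2)).continuous
  have h1 : eLpNorm (rotv l f) 2 μ ≤ eLpNorm (((fun x => R * ‖pdv (l + 2) f x‖)
      + fun x => R * ‖pdv (l + 1) f x‖) + fun x => ‖f x‖) 2 μ := by
    refine eLpNorm_mono_ae_real ((ae_restrict_iff' Metric.isClosed_closedBall.measurableSet).2
      (Eventually.of_forall fun x hx => ?_))
    have hx' : ∀ m, |x m| ≤ R := abs_coord_le_of_mem hx
    rw [rotv, toEuclideanLin_rotMat]
    refine (norm_add_le _ _).trans (add_le_add ((norm_sub_le _ _).trans (add_le_add ?_ ?_)) ?_)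
    · rw [norm_smul]
      exact mul_le_mul_of_nonneg_right (hx' _) (norm_nonneg _)
    · rw [norm_smul]
      exact mul_le_mul_of_nonneg_right (hx' _) (norm_nonneg _)
    · rw [norm_neg]
      exact norm_gen_le l _
  have m1 : AEStronglyMeasurable (fun x => R * ‖pdv (l + 2) f x‖) μ :=
    (continuous_const.mul c2.norm).aestronglyMeasurable
  have m2 : AEStronglyMeasurable (fun x => R * ‖pdv (l + 1) f x‖) μ :=
    (continuous_const.mul c1.norm).aestronglyMeasurable
  have e : ∀ i, eLpNorm (fun x => R * ‖pdv i f x‖) 2 μ ≤ ENNReal.ofReal R * gradNorm f := by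
    intro i
    have := eLpNorm_const_smul R (fun x => ‖pdv i f x‖) 2 μ
    rw [show (fun x => R * ‖pdv i f x‖) = R • fun x => ‖pdv i f x‖ from rfl, this, eLpNorm_norm,
      ← ofReal_norm, Real.norm_of_nonneg hR]
    gcongr
    exact (eLpNorm_restrict_le _ _).trans (eLpNorm_pdv_le_gradNorm f i)
  refine h1.trans ((eLpNorm_add_le (m1.add m2) hf.continuous.norm.aestronglyMeasurable
    (by norm_num)).trans (add_le_add ((eLpNorm_add_le m1 m2 (by norm_num)).trans
    ((add_le_add (e _) (e _)).trans_eq ?_)) (eLpNorm_norm _).le))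
  ring

theorem jb_nonneg (ρ : ℝ) : 0 ≤ jb ρ := Real.sqrt_nonneg _

theorem one_le_jb (ρ : ℝ) : 1 ≤ jb ρ := by
  rw [jb, Real.one_le_sqrt]; nlinarith [sq_nonneg ρ]

theorem abs_le_jb (ρ : ℝ) : |ρ| ≤ jb ρ := Real.abs_le_sqrt (by linarith)

theorem jb_le_one_add_abs (ρ : ℝ) : jb ρ ≤ 1 + |ρ| := by
  rw [jb, Real.sqrt_le_left (by positivity)]
  nlinarith [abs_nonneg ρ, sq_abs ρ]

/-- The decay estimate `⟨r⟩^{1/2} |w| ≤ C (‖∇w‖ + ‖∇∂w‖ + ‖∇Ω̃w‖)`. -/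
theorem exists_sqrt_decay : ∃ C : NNReal, ∀ (w : E3 → E3), ContDiff ℝ ∞ w → HasCompactSupport w →
    ∀ x : E3, ENNReal.ofReal (Real.sqrt (jb ‖x‖)) * ‖w x‖ₑ
      ≤ C * (gradNorm w + ∑ j, gradNorm (pdv j w) + ∑ l, gradNorm (rotv l w)) := by
  obtain ⟨C₁, hC₁⟩ := exists_norm_proj_le_shellNorm
  obtain ⟨C₂, hC₂⟩ := exists_norm_le_ball
  obtain ⟨K, hK⟩ := exists_eLpNorm_ball_le_gradNorm
  refine ⟨2 * (2 * (C₁ * (25 * (6 + 2 * K)))) + 2 * (C₂ * (1 + K)), fun w hw hs x => ?_⟩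
  set G := gradNorm w + ∑ j, gradNorm (pdv j w) + ∑ l, gradNorm (rotv l w) with hG
  have g0 : gradNorm w ≤ G := by rw [hG, add_assoc]; exact le_self_add
  have g2 : ∀ l, gradNorm (rotv l w) ≤ G := fun l =>
    (Finset.single_le_sum (f := fun l => gradNorm (rotv l w)) (fun _ _ => zero_le)
      (Finset.mem_univ l)).trans (by rw [hG]; exact le_add_self)
  have hcs : ∀ l, HasCompactSupport (rotv l w) := fun l => by
    refine hs.mono' fun y hy => by_contra fun h => hy ?_
    simp [rotv, pdv_eq_zero_of_notMem_tsupport h, image_eq_zero_of_notMem_tsupport h]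
  rcases le_total ‖x‖ 1 with hx | hx
  · have h := hC₂ w hw x
    have hb := hK w hw hs x 1 zero_le_one
    rw [ENNReal.ofReal_one, mul_one] at hb
    have hj : Real.sqrt (jb ‖x‖) ≤ 2 := by
      rw [Real.sqrt_le_left (by norm_num)]
      have := jb_le_one_add_abs ‖x‖
      rw [abs_norm] at this
      linarith
    calc _ ≤ ENNReal.ofReal 2 * (C₂ * (K * G + G)) := by
          gcongr
          refine h.trans (mul_le_mul' le_rfl ?_)
          rw [add_assoc]
          refine add_le_add (hb.trans (by gcongr)) ?_
          rw [hG]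
          exact le_self_add
      _ = (2 * (C₂ * (1 + K)) : NNReal) * G := by
          push_cast
          rw [ENNReal.ofReal_ofNat]
          ring
      _ ≤ _ := by
          gcongr
          exact le_add_self
  · have hr : 0 < ‖x‖ := by linarith
    set r := ‖x‖ with hrd
    have hsub : shell r (r / 4) ⊆ Metric.closedBall 0 (2 * r) := by
      intro y hy
      have := abs_le.1 (show |‖y‖ - r| ≤ r / 4 from hy)
      rw [mem_closedBall_zero_iff]
      linarith
    set T := ENNReal.ofReal r * ((6 + 2 * K) * G) with hT
    have hres : ∀ (α : Fin 2) (f : E3 → E3), projNorm (volume.restrict (shell r (r / 4))) α f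
        ≤ eLpNorm f 2 (volume.restrict (Metric.closedBall 0 (2 * r))) := fun α f =>
      (projNorm_le _ _ _).trans (eLpNorm_mono_measure _ (Measure.restrict_mono hsub le_rfl))
    have h2r : ENNReal.ofReal (2 * r) = 2 * ENNReal.ofReal r := by
      rw [ENNReal.ofReal_mul (by norm_num), ENNReal.ofReal_ofNat]
    have hb : ∀ {f : E3 → E3}, ContDiff ℝ ∞ f → HasCompactSupport f → gradNorm f ≤ G →
        eLpNorm f 2 (volume.restrict (Metric.closedBall 0 (2 * r)))
          ≤ ENNReal.ofReal r * (2 * K * G) := fun {f} hf hfs hfG => by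
      refine (hK f hf hfs 0 (2 * r) (by positivity)).trans ?_
      rw [h2r]
      calc _ ≤ K * (2 * ENNReal.ofReal r) * G := by gcongr
        _ = _ := by ring
    have hT1 : ENNReal.ofReal r * (2 * K * G) ≤ T := by
      rw [hT]
      gcongr
      exact le_add_self
    have hT2 : ENNReal.ofReal r * G ≤ T := by
      rw [hT]
      gcongr
      refine le_mul_of_one_le_left' ?_
      exact le_add_right (by norm_num)
    have hP : ∀ α, ENNReal.ofReal (Real.sqrt r * r) * ‖proj α x (w x)‖ₑ ≤ C₁ * (25 * T) := by
      intro α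
      refine (hC₁ w hw α x r hr le_rfl).trans ?_
      gcongr
      refine shellNorm_le ?_ (fun l => ?_) (fun l m => ?_) (fun m => ?_) (fun l m => ?_)
      · exact (hres α w).trans ((hb hw hs g0).trans hT1)
      · exact (hres α _).trans ((hb (hw.rotv l) (hcs l) (g2 l)).trans hT1)
      · refine (hres α _).trans ((eLpNorm_rotv_ball_le (hw.rotv l) m (by positivity)).trans ?_)
        refine (add_le_add le_rfl (hb (hw.rotv l) (hcs l) (g2 l))).trans ?_
        rw [h2r, hT]
        calc _ ≤ 2 * (2 * ENNReal.ofReal r) * G + ENNReal.ofReal r * (2 * K * G) := by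
              gcongr
              exact g2 l
          _ = ENNReal.ofReal r * ((4 + 2 * K) * G) := by ring
          _ ≤ _ := by
              gcongr
              norm_num
      · refine le_trans ?_ hT2
        gcongr
        exact (hres α _).trans ((eLpNorm_restrict_le _ _).trans
          ((eLpNorm_pdv_le_gradNorm w m).trans g0))
      · refine le_trans ?_ hT2
        gcongr
        exact (hres α _).trans ((eLpNorm_restrict_le _ _).trans
          ((eLpNorm_pdv_le_gradNorm _ m).trans (g2 l)))
    -- cancel the factor `r`
    have hfin : ENNReal.ofReal r * (ENNReal.ofReal (Real.sqrt r) * ‖w x‖ₑ)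
        ≤ ENNReal.ofReal r * (2 * (C₁ * (25 * ((6 + 2 * K) * G)))) := by
      have e1 : ENNReal.ofReal (Real.sqrt r * r) * ‖w x‖ₑ ≤ 2 * (C₁ * (25 * T)) := by
        calc _ ≤ ENNReal.ofReal (Real.sqrt r * r) * (‖proj 0 x (w x)‖ₑ + ‖proj 1 x (w x)‖ₑ) := by
              gcongr
              conv_lhs => rw [← proj_zero_add_proj_one x (w x)]
              exact enorm_add_le _ _
          _ ≤ C₁ * (25 * T) + C₁ * (25 * T) := by
              rw [mul_add]
              exact add_le_add (hP 0) (hP 1)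
          _ = _ := (two_mul _).symm
      rw [ENNReal.ofReal_mul (Real.sqrt_nonneg _)] at e1
      calc _ = ENNReal.ofReal (Real.sqrt r) * ENNReal.ofReal r * ‖w x‖ₑ := by ring
        _ ≤ _ := e1
        _ = _ := by rw [hT]; ring
    have hfin' := (ENNReal.mul_le_mul_iff_right (by simpa using hr) ENNReal.ofReal_ne_top).1 hfin
    have hj : Real.sqrt (jb r) ≤ 2 * Real.sqrt r := by
      rw [Real.sqrt_le_left (by positivity), mul_pow, Real.sq_sqrt hr.le]
      have := jb_le_one_add_abs r
      rw [abs_of_pos hr] at this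
      linarith
    calc _ ≤ ENNReal.ofReal (2 * Real.sqrt r) * ‖w x‖ₑ := by gcongr
      _ = 2 * (ENNReal.ofReal (Real.sqrt r) * ‖w x‖ₑ) := by
          rw [ENNReal.ofReal_mul (by norm_num), ENNReal.ofReal_ofNat, mul_assoc]
      _ ≤ 2 * (2 * (C₁ * (25 * ((6 + 2 * K) * G)))) := by gcongr
      _ = (2 * (2 * (C₁ * (25 * (6 + 2 * K)))) : NNReal) * G := by
          push_cast
          ring
      _ ≤ _ := by
          gcongr
          exact le_self_add

/-- The decay estimate `⟨r⟩ |w| ≤ C T`, where `T` bounds the `L²` norms of `w` and of its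
derivatives of order at most two along the fields `∂_i` and `Ω̃_l`. -/
theorem exists_full_decay : ∃ C : NNReal, ∀ (w : E3 → E3), ContDiff ℝ ∞ w → ∀ T : ENNReal,
    eLpNorm w 2 volume ≤ T → (∀ l, eLpNorm (rotv l w) 2 volume ≤ T) →
    (∀ l m, eLpNorm (rotv m (rotv l w)) 2 volume ≤ T) → (∀ m, eLpNorm (pdv m w) 2 volume ≤ T) →
    (∀ l m, eLpNorm (pdv m (rotv l w)) 2 volume ≤ T) →
    (∀ i j, eLpNorm (pdv j (pdv i w)) 2 volume ≤ T) →
    ∀ x : E3, ENNReal.ofReal (jb ‖x‖) * ‖w x‖ₑ ≤ C * T := by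
  obtain ⟨C₁, hC₁⟩ := exists_norm_proj_le_shellNorm
  obtain ⟨C₂, hC₂⟩ := exists_norm_le_ball
  refine ⟨2 * (2 * (C₁ * 25)) + 2 * (C₂ * 13), fun w hw T h0 h1 h2 h3 h4 h5 x => ?_⟩
  rcases le_total ‖x‖ 1 with hx | hx
  · have hj : jb ‖x‖ ≤ 2 := by
      have := jb_le_one_add_abs ‖x‖
      rw [abs_norm] at this
      linarith
    calc _ ≤ ENNReal.ofReal 2 * (C₂ * (T + ∑ i : Fin 3, T + ∑ i : Fin 3, ∑ j : Fin 3, T)) := by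
          gcongr
          refine (hC₂ w hw x).trans ?_
          refine mul_le_mul' le_rfl (add_le_add (add_le_add
            ((eLpNorm_restrict_le _ _).trans h0) ?_) ?_)
          · exact Finset.sum_le_sum fun i _ => h3 i
          · exact Finset.sum_le_sum fun i _ => Finset.sum_le_sum fun j _ => h5 i j
      _ = (2 * (C₂ * 13) : NNReal) * T := by
          simp only [Finset.sum_const, Finset.card_univ, Fintype.card_fin, nsmul_eq_mul,
            ENNReal.ofReal_ofNat]
          push_cast
          ring
      _ ≤ _ := by
          gcongr
          exact le_add_self
  · have hr : 0 < ‖x‖ := by linarith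
    have hres : ∀ (α : Fin 2) (f : E3 → E3),
        projNorm (volume.restrict (shell ‖x‖ (1 / 4))) α f ≤ eLpNorm f 2 volume := fun α f =>
      (projNorm_le _ _ _).trans (eLpNorm_restrict_le _ _)
    have hP : ∀ α, ENNReal.ofReal ‖x‖ * ‖proj α x (w x)‖ₑ ≤ C₁ * (25 * T) := by
      intro α
      have := hC₁ w hw α x 1 one_pos hx
      rw [Real.sqrt_one, one_mul] at this
      refine this.trans ?_
      gcongr
      refine shellNorm_le ((hres _ _).trans h0) (fun l => (hres _ _).trans (h1 l))
        (fun l m => (hres _ _).trans (h2 l m)) (fun m => ?_) (fun l m => ?_)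
      · rw [ENNReal.ofReal_one, one_mul]
        exact (hres _ _).trans (h3 m)
      · rw [ENNReal.ofReal_one, one_mul]
        exact (hres _ _).trans (h4 l m)
    have hj : jb ‖x‖ ≤ 2 * ‖x‖ := by
      have := jb_le_one_add_abs ‖x‖
      rw [abs_norm] at this
      linarith
    calc _ ≤ ENNReal.ofReal (2 * ‖x‖) * (‖proj 0 x (w x)‖ₑ + ‖proj 1 x (w x)‖ₑ) := by
          gcongr
          conv_lhs => rw [← proj_zero_add_proj_one x (w x)]
          exact enorm_add_le _ _
      _ = 2 * (ENNReal.ofReal ‖x‖ * ‖proj 0 x (w x)‖ₑ + ENNReal.ofReal ‖x‖ * ‖proj 1 x (w x)‖ₑ) := by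
          rw [ENNReal.ofReal_mul (by norm_num), ENNReal.ofReal_ofNat]
          ring
      _ ≤ 2 * (C₁ * (25 * T) + C₁ * (25 * T)) := by
          exact mul_le_mul' le_rfl (add_le_add (hP 0) (hP 1))
      _ = (2 * (2 * (C₁ * 25)) : NNReal) * T := by
          push_cast
          ring
      _ ≤ _ := by
          gcongr
          exact le_self_add

/-! ### Test fields on the slab -/

/-- The slab `[0, T] × ℝ³`. -/
def slab (T : ℝ) : Set (ℝ × E3) := Icc 0 T ×ˢ univ

/-- The coordinate directions of space-time. -/
def dir (β : Fin 4) : ℝ × E3 :=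
  Fin.cases ((1, 0) : ℝ × E3) (fun i => (0, EuclideanSpace.single i 1)) β

theorem uniqueDiffOn_slab {T : ℝ} (hT : 0 < T) : UniqueDiffOn ℝ (slab T) :=
  (uniqueDiffOn_Icc hT).prod uniqueDiffOn_univ

theorem mem_slab {T t : ℝ} (ht : t ∈ Icc 0 T) (x : E3) : (t, x) ∈ slab T := ⟨ht, mem_univ x⟩

/-- A derivative within the slab determines the one-sided derivative in `t` and the derivatives in
`x`. -/
theorem pd_eq_of_hasFDerivWithinAt {T : ℝ} (hT : 0 < T) {u : Field} {L : ℝ × E3 →L[ℝ] E3} {t : ℝ}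
    {x : E3} (ht : t ∈ Icc 0 T) (h : HasFDerivWithinAt (Function.uncurry u) L (slab T) (t, x))
    (β : Fin 4) : pd T β u t x = L (dir β) := by
  refine Fin.cases ?_ (fun i => ?_) β
  · have h1 : HasDerivWithinAt (fun s : ℝ => (s, x)) ((1 : ℝ), (0 : E3)) (Icc 0 T) t :=
      ((hasDerivAt_id t).prodMk (hasDerivAt_const t x)).hasDerivWithinAt
    have h2 := h.comp_hasDerivWithinAt t h1 (fun s hs => mem_slab hs x)
    exact h2.derivWithin (uniqueDiffOn_Icc hT t ht)
  · have h1 : HasFDerivWithinAt (fun y : E3 => (t, y)) (ContinuousLinearMap.inr ℝ ℝ E3) univ x :=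
      (hasFDerivAt_prodMk_right t x).hasFDerivWithinAt
    have h2 := h.comp x h1 (fun y _ => mem_slab ht y)
    rw [hasFDerivWithinAt_univ] at h2
    change fderiv ℝ (u t) x (EuclideanSpace.single i 1) = _
    have h3 : HasFDerivAt (u t) (L.comp (ContinuousLinearMap.inr ℝ ℝ E3)) x := h2
    rw [h3.fderiv]
    rfl

namespace IsTest

variable {T : ℝ} {u v : Field}

theorem hasFDerivWithinAt (hu : IsTest T u) {t : ℝ} (ht : t ∈ Icc 0 T) (x : E3) :
    HasFDerivWithinAt (Function.uncurry u)
      (fderivWithin ℝ (Function.uncurry u) (slab T) (t, x)) (slab T) (t, x) :=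
  ((hu.smooth.differentiableOn (by simp)) (t, x) (mem_slab ht x)).hasFDerivWithinAt

theorem pd_eq (hT : 0 < T) (hu : IsTest T u) {t : ℝ} (ht : t ∈ Icc 0 T) (x : E3) (β : Fin 4) :
    pd T β u t x = fderivWithin ℝ (Function.uncurry u) (slab T) (t, x) (dir β) :=
  pd_eq_of_hasFDerivWithinAt hT ht (hu.hasFDerivWithinAt ht x) β

theorem contDiff_slice (hu : IsTest T u) {t : ℝ} (ht : t ∈ Icc 0 T) : ContDiff ℝ ∞ (u t) := by
  rw [← contDiffOn_univ]
  exact hu.smooth.comp (contDiff_prodMk_right t).contDiffOn (fun y _ => mem_slab ht y)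

theorem contDiffOn_fderivWithin_apply (hT : 0 < T) (hu : IsTest T u) (w : ℝ × E3) :
    ContDiffOn ℝ ∞ (fun p => fderivWithin ℝ (Function.uncurry u) (slab T) p w) (slab T) :=
  (hu.smooth.fderivWithin (uniqueDiffOn_slab hT) (by simp)).clm_apply contDiffOn_const

theorem pd (hT : 0 < T) (hu : IsTest T u) (β : Fin 4) : IsTest T (pd T β u) where
  smooth := (hu.contDiffOn_fderivWithin_apply hT (dir β)).congr
    fun p hp => hu.pd_eq hT hp.1 p.2 β
  supp := by
    obtain ⟨K, hK, h0⟩ := hu.supp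
    refine ⟨K, hK, fun t ht x hx => ?_⟩
    refine Fin.cases ?_ (fun i => ?_) β
    · change derivWithin (fun s => u s x) (Icc 0 T) t = 0
      rw [derivWithin_congr (fun s hs => h0 s hs x hx) (h0 t ht x hx)]
      simp
    · change fderiv ℝ (u t) x (EuclideanSpace.single i 1) = 0
      have : u t =ᶠ[𝓝 x] fun _ => 0 := by
        filter_upwards [hK.isClosed.isOpen_compl.mem_nhds hx] with y hy
        exact h0 t ht y hy
      rw [this.fderiv_eq]
      simp

theorem rot (hT : 0 < T) (hu : IsTest T u) (l : Fin 3) : IsTest T (rot l u) where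
  smooth := by
    have hc : ∀ m : Fin 3, ContDiff ℝ ∞ (fun p : ℝ × E3 => p.2 m) :=
      fun m => (contDiff_coord m).comp contDiff_snd
    have hL : ContDiff ℝ ∞ (fun w : E3 => Matrix.toEuclideanLin (rotMat l) w) := by
      simp only [toEuclideanLin_rotMat]
      exact (gen l).contDiff.neg
    exact (((hc (l + 1)).contDiffOn.smul (hu.pd hT (l + 2).succ).smooth).sub
      ((hc (l + 2)).contDiffOn.smul (hu.pd hT (l + 1).succ).smooth)).add
      (hL.comp_contDiffOn hu.smooth)
  supp := by
    obtain ⟨K, hK, h0⟩ := hu.supp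
    obtain ⟨K₁, hK₁, h1⟩ := (hu.pd hT (l + 1).succ).supp
    obtain ⟨K₂, hK₂, h2⟩ := (hu.pd hT (l + 2).succ).supp
    refine ⟨K ∪ K₁ ∪ K₂, (hK.union hK₁).union hK₂, fun t ht x hx => ?_⟩
    simp only [mem_union, not_or] at hx
    change (x (l + 1) • PrestressedElastic.pd T (l + 2).succ u t x
      - x (l + 2) • PrestressedElastic.pd T (l + 1).succ u t x)
      + Matrix.toEuclideanLin (rotMat l) (u t x) = 0
    rw [h0 t ht x hx.1.1, h1 t ht x hx.1.2, h2 t ht x hx.2]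
    simp

theorem scal (hT : 0 < T) (hu : IsTest T u) : IsTest T (scal T u) where
  smooth := by
    have hc : ∀ m : Fin 3, ContDiff ℝ ∞ (fun p : ℝ × E3 => p.2 m) :=
      fun m => (contDiff_coord m).comp contDiff_snd
    have hs : ContDiffOn ℝ ∞ (fun p : ℝ × E3 => ∑ i : Fin 3, p.2 i • dx i u p.1 p.2) (slab T) :=
      ContDiffOn.sum fun i _ => (hc i).contDiffOn.smul (hu.pd hT i.succ).smooth
    exact ((contDiff_fst.contDiffOn.smul (hu.pd hT 0).smooth).add hs).sub hu.smooth
  supp := by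
    obtain ⟨K, hK, h0⟩ := hu.supp
    choose K' hK' h1 using fun β => (hu.pd hT β).supp
    refine ⟨K ∪ ⋃ β, K' β, hK.union (isCompact_iUnion hK'), fun t ht x hx => ?_⟩
    simp only [mem_union, mem_iUnion, not_or, not_exists] at hx
    change t • PrestressedElastic.pd T 0 u t x
      + (∑ i : Fin 3, x i • PrestressedElastic.pd T i.succ u t x) - u t x = 0
    simp only [h0 t ht x hx.1, h1 _ t ht x (hx.2 _)]
    simp

theorem gam (hT : 0 < T) (hu : IsTest T u) : ∀ j, IsTest T (gam T j u)
  | Sum.inl β => hu.pd hT β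
  | Sum.inr (Sum.inl l) => hu.rot hT l
  | Sum.inr (Sum.inr _) => hu.scal hT

theorem gamPow (hT : 0 < T) (hu : IsTest T u) (a : List GIdx) : IsTest T (gamPow T a u) := by
  induction a with
  | nil => exact hu
  | cons j a ih => exact ih.gam hT j

theorem sub (hu : IsTest T u) (hv : IsTest T v) : IsTest T (u - v) where
  smooth := hu.smooth.sub hv.smooth
  supp := by
    obtain ⟨K, hK, h0⟩ := hu.supp
    obtain ⟨K₁, hK₁, h1⟩ := hv.supp
    refine ⟨K ∪ K₁, hK.union hK₁, fun t ht x hx => ?_⟩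
    simp only [mem_union, not_or] at hx
    simp [h0 t ht x hx.1, h1 t ht x hx.2]

theorem hasCompactSupport_slice (hu : IsTest T u) {t : ℝ} (ht : t ∈ Icc 0 T) :
    HasCompactSupport (u t) := by
  obtain ⟨K, hK, h0⟩ := hu.supp
  exact HasCompactSupport.intro hK fun x hx => h0 t ht x hx

end IsTest

variable {T : ℝ} {u v w : Field}

/-- On the slab the operator `∂_β` depends on the values on the slab only, and is linear there. -/
theorem pd_comb (hT : 0 < T) (hu : IsTest T u) (hv : IsTest T v) {c d : ℝ}
    (h : ∀ t ∈ Icc 0 T, ∀ x, w t x = c • u t x + d • v t x) (β : Fin 4) {t : ℝ}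
    (ht : t ∈ Icc 0 T) (x : E3) :
    pd T β w t x = c • pd T β u t x + d • pd T β v t x := by
  have h1 := ((hu.hasFDerivWithinAt ht x).const_smul c).add
    ((hv.hasFDerivWithinAt ht x).const_smul d)
  have h2 : HasFDerivWithinAt (Function.uncurry w)
      (c • fderivWithin ℝ (Function.uncurry u) (slab T) (t, x)
        + d • fderivWithin ℝ (Function.uncurry v) (slab T) (t, x)) (slab T) (t, x) :=
    h1.congr (fun p hp => h p.1 hp.1 p.2) (h t ht x)
  rw [pd_eq_of_hasFDerivWithinAt hT ht h2, hu.pd_eq hT ht, hv.pd_eq hT ht]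
  rfl

theorem gam_sub (hT : 0 < T) (hu : IsTest T u) (hv : IsTest T v)
    (h : ∀ t ∈ Icc 0 T, ∀ x, w t x = u t x - v t x) (j : GIdx) {t : ℝ} (ht : t ∈ Icc 0 T) (x : E3) :
    gam T j w t x = gam T j u t x - gam T j v t x := by
  have hp : ∀ β, pd T β w t x = pd T β u t x - pd T β v t x := fun β => by
    rw [pd_comb hT hu hv (c := 1) (d := -1) (fun t ht x => by rw [h t ht x]; module) β ht x]
    module
  match j with
  | Sum.inl β => exact hp β
  | Sum.inr (Sum.inl l) =>
    change (x (l + 1) • pd T (l + 2).succ w t x - x (l + 2) • pd T (l + 1).succ w t x)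
        + Matrix.toEuclideanLin (rotMat l) (w t x)
      = ((x (l + 1) • pd T (l + 2).succ u t x - x (l + 2) • pd T (l + 1).succ u t x)
        + Matrix.toEuclideanLin (rotMat l) (u t x))
      - ((x (l + 1) • pd T (l + 2).succ v t x - x (l + 2) • pd T (l + 1).succ v t x)
        + Matrix.toEuclideanLin (rotMat l) (v t x))
    rw [hp, hp, h t ht x, map_sub]
    module
  | Sum.inr (Sum.inr _) =>
    change t • pd T 0 w t x + (∑ i : Fin 3, x i • pd T i.succ w t x) - w t x
      = (t • pd T 0 u t x + (∑ i : Fin 3, x i • pd T i.succ u t x) - u t x)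
        - (t • pd T 0 v t x + (∑ i : Fin 3, x i • pd T i.succ v t x) - v t x)
    simp only [hp, h t ht x, Fin.sum_univ_three]
    module

theorem gamPow_sub (hT : 0 < T) (hu : IsTest T u) (hv : IsTest T v) (a : List GIdx) :
    ∀ t ∈ Icc 0 T, ∀ x, gamPow T a (u - v) t x = gamPow T a u t x - gamPow T a v t x := by
  induction a with
  | nil => exact fun t _ x => rfl
  | cons j a ih =>
    exact fun t ht x => gam_sub hT (hu.gamPow hT a) (hv.gamPow hT a) ih j ht x

/-- The coordinate derivatives commute, also at the boundary of the slab. -/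
theorem pd_comm (hT : 0 < T) (hu : IsTest T u) (β γ : Fin 4) {t : ℝ} (ht : t ∈ Icc 0 T) (x : E3) :
    pd T β (pd T γ u) t x = pd T γ (pd T β u) t x := by
  have e : ∀ β γ, pd T β (pd T γ u) t x
      = fderivWithin ℝ (fderivWithin ℝ (Function.uncurry u) (slab T)) (slab T) (t, x) (dir β)
        (dir γ) := by
    intro β γ
    have hd : DifferentiableWithinAt ℝ (fderivWithin ℝ (Function.uncurry u) (slab T)) (slab T)
        (t, x) := (hu.smooth.fderivWithin (m := ∞) (uniqueDiffOn_slab hT) (by simp)).differentiableOn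
          (by simp) _ (mem_slab ht x)
    have h1 := (hd.hasFDerivWithinAt.clm_apply (hasFDerivWithinAt_const (dir γ) (t, x) (slab T)))
    have h2 := h1.congr (f₁ := Function.uncurry (pd T γ u))
      (fun p hp => hu.pd_eq hT hp.1 p.2 γ) (hu.pd_eq hT ht x γ)
    rw [pd_eq_of_hasFDerivWithinAt hT ht h2]
    simp
  rw [e, e]
  have hcl : (t, x) ∈ closure (interior (slab T)) := by
    rw [slab, interior_prod_eq, interior_Icc, interior_univ, closure_prod_eq, closure_Ioo hT.ne,
      closure_univ]
    exact mem_slab ht x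
  have hs : IsSymmSndFDerivWithinAt ℝ (Function.uncurry u) (slab T) (t, x) := by
    refine (hu.smooth (t, x) (mem_slab ht x)).isSymmSndFDerivWithinAt ?_ (uniqueDiffOn_slab hT)
      hcl (mem_slab ht x)
    simp only [minSmoothness_of_isRCLikeNormedField]
    exact WithTop.coe_le_coe.2 (le_top : (2 : ℕ∞) ≤ ⊤)
  exact hs _ _

theorem pdv_coord (i m : Fin 3) (x : E3) : pdv i (fun y : E3 => y m) x = if i = m then 1 else 0 := by
  have : HasFDerivAt (fun y : E3 => y m) (EuclideanSpace.proj m : E3 →L[ℝ] ℝ) x :=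
    (EuclideanSpace.proj m : E3 →L[ℝ] ℝ).hasFDerivAt
  rw [pdv, this.fderiv]
  simp [eq_comm]

theorem rotv_pdv {f : E3 → E3} (hf : ContDiff ℝ ∞ f) (l i : Fin 3) (x : E3) :
    rotv l (pdv i f) x = pdv i (rotv l f) x
      - (if i = l + 1 then (1 : ℝ) else 0) • pdv (l + 2) f x
      + (if i = l + 2 then (1 : ℝ) else 0) • pdv (l + 1) f x := by
  have h1 : ∀ m k : Fin 3, ContDiff ℝ ∞ (fun y : E3 => y m • pdv k f y) :=
    fun m k => (contDiff_coord m).smul (hf.pdv k)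
  have e : rotv l f = fun y => (y (l + 1) • pdv (l + 2) f y + (-1 : ℝ) • (y (l + 2) • pdv (l + 1) f y))
      + (-gen l) (f y) := by
    funext y
    rw [rotv, toEuclideanLin_rotMat]
    simp [sub_eq_add_neg]
  have h2 : ContDiff ℝ ∞ (fun y : E3 => (-1 : ℝ) • (y (l + 2) • pdv (l + 1) f y)) :=
    (h1 _ _).const_smul (-1 : ℝ)
  have h3 : ContDiff ℝ ∞ (fun y => (-gen l) (f y)) := (-gen l).contDiff.comp hf
  rw [e, pdv_add (((h1 _ _).add h2).differentiableAt_infty x) (h3.differentiableAt_infty x),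
    pdv_add ((h1 _ _).differentiableAt_infty x) (h2.differentiableAt_infty x),
    pdv_clm (-gen l) (hf.differentiableAt_infty x),
    pdv_smul (contDiff_const.differentiableAt_infty x) ((h1 _ _).differentiableAt_infty x),
    pdv_smul ((contDiff_coord _).differentiableAt_infty x) ((hf.pdv _).differentiableAt_infty x),
    pdv_smul ((contDiff_coord _).differentiableAt_infty x) ((hf.pdv _).differentiableAt_infty x),
    pdv_coord, pdv_coord, rotv, toEuclideanLin_rotMat, pdv_comm hf i, pdv_comm hf i]
  have h0 : pdv i (fun _ : E3 => (-1 : ℝ)) x = 0 := by simp [pdv]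
  rw [h0]
  simp only [neg_apply]
  module

/-- The commutator of `Ω̃_l` with a coordinate derivative is zero or, up to the sign, a spatial
derivative. -/
theorem exists_rot_pd (hT : 0 < T) (l : Fin 3) (β : Fin 4) : ∃ (γ : Fin 3) (ε : ℝ), |ε| ≤ 1 ∧
    ∀ u : Field, IsTest T u → ∀ t ∈ Icc 0 T, ∀ x,
      rot l (pd T β u) t x = pd T β (rot l u) t x + ε • pd T γ.succ u t x := by
  refine Fin.cases ?_ (fun i => ?_) β
  · refine ⟨0, 0, by simp, fun u hu t ht x => ?_⟩
    have hd : ∀ {v : Field}, IsTest T v →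
        HasDerivWithinAt (fun s => v s x) (pd T 0 v t x) (Icc 0 T) t := fun {v} hv => by
      have h1 : HasDerivWithinAt (fun s : ℝ => (s, x)) ((1 : ℝ), (0 : E3)) (Icc 0 T) t :=
        ((hasDerivAt_id t).prodMk (hasDerivAt_const t x)).hasDerivWithinAt
      have h2 := (hv.hasFDerivWithinAt ht x).comp_hasDerivWithinAt t h1
        (fun s hs => mem_slab hs x)
      rw [hv.pd_eq hT ht]
      exact h2
    have h := (((hd (hu.pd hT (l + 2).succ)).const_smul (x (l + 1))).sub
      ((hd (hu.pd hT (l + 1).succ)).const_smul (x (l + 2)))).add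
      ((-gen l).hasFDerivAt.comp_hasDerivWithinAt t (hd hu))
    have h' : HasDerivWithinAt (fun s => rot l u s x) (x (l + 1) • pd T 0 (pd T (l + 2).succ u) t x
        - x (l + 2) • pd T 0 (pd T (l + 1).succ u) t x + (-gen l) (pd T 0 u t x)) (Icc 0 T) t := by
      refine h.congr_of_mem (fun s _ => ?_) ht
      change (x (l + 1) • pd T (l + 2).succ u s x - x (l + 2) • pd T (l + 1).succ u s x)
        + Matrix.toEuclideanLin (rotMat l) (u s x) = _
      rw [toEuclideanLin_rotMat]
      rfl
    have e : pd T 0 (rot l u) t x = _ := h'.derivWithin (uniqueDiffOn_Icc hT t ht)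
    rw [e, zero_smul, add_zero, pd_comm hT hu 0 _ ht, pd_comm hT hu 0 _ ht, neg_apply,
      ← toEuclideanLin_rotMat]
    rfl
  · have key := fun (u : Field) (hu : IsTest T u) (t : ℝ) (ht : t ∈ Icc 0 T) (x : E3) =>
      rotv_pdv (hu.contDiff_slice ht) l i x
    by_cases h1 : i = l + 1
    · have h2 : ¬ i = l + 2 := by rw [h1]; fin_cases l <;> decide
      refine ⟨l + 2, -1, by simp, fun u hu t ht x => ?_⟩
      have := key u hu t ht x
      rw [if_pos h1, if_neg h2] at this
      change rotv l (pdv i (u t)) x = pdv i (rotv l (u t)) x + (-1 : ℝ) • pdv (l + 2) (u t) x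
      rw [this]
      module
    · by_cases h2 : i = l + 2
      · refine ⟨l + 1, 1, by simp, fun u hu t ht x => ?_⟩
        have := key u hu t ht x
        rw [if_neg h1, if_pos h2] at this
        change rotv l (pdv i (u t)) x = pdv i (rotv l (u t)) x + (1 : ℝ) • pdv (l + 1) (u t) x
        rw [this]
        module
      · refine ⟨0, 0, by simp, fun u hu t ht x => ?_⟩
        have := key u hu t ht x
        rw [if_neg h1, if_neg h2] at this
        change rotv l (pdv i (u t)) x = pdv i (rotv l (u t)) x + (0 : ℝ) • pdv 0 (u t) x
        rw [this]
        module

/-! ### Commutation with the rotation fields -/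

/-- `Comb S K f` says that `f` is a sum of `K` elements of `S` with coefficients in `[-1, 1]`. -/
inductive Comb (S : Set (E3 → E3)) : ℕ → (E3 → E3) → Prop
  | base {f : E3 → E3} : f ∈ S → Comb S 1 f
  | smul {K : ℕ} {f : E3 → E3} {c : ℝ} : |c| ≤ 1 → Comb S K f → Comb S K (fun x => c • f x)
  | add {K K' : ℕ} {f g : E3 → E3} : Comb S K f → Comb S K' g →
      Comb S (K + K') (fun x => f x + g x)

namespace Comb

variable {S S' : Set (E3 → E3)} {K n : ℕ} {f : E3 → E3}

theorem contDiff (hS : ∀ f ∈ S, ContDiff ℝ ∞ f) (h : Comb S K f) : ContDiff ℝ ∞ f := by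
  induction h with
  | base hf => exact hS _ hf
  | smul _ _ ih => exact ih.const_smul _
  | add _ _ ih ih' => exact ih.add ih'

/-- A linear operator which maps `S` into sums of `n` elements of `S'`. -/
theorem bind {op : (E3 → E3) → E3 → E3} (hS : ∀ f ∈ S, ContDiff ℝ ∞ f)
    (hsmul : ∀ (c : ℝ) (f : E3 → E3), ContDiff ℝ ∞ f → op (fun x => c • f x) = fun x => c • op f x)
    (hadd : ∀ f g : E3 → E3, ContDiff ℝ ∞ f → ContDiff ℝ ∞ g →
      op (fun x => f x + g x) = fun x => op f x + op g x)
    (h : ∀ f ∈ S, Comb S' n (op f)) (hf : Comb S K f) : Comb S' (n * K) (op f) := by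
  induction hf with
  | base hf => simpa using h _ hf
  | smul hc hg ih =>
    rw [hsmul _ _ (hg.contDiff hS)]
    exact smul hc ih
  | add hf hg ih ih' =>
    rw [hadd _ _ (hf.contDiff hS) (hg.contDiff hS), mul_add]
    exact add ih ih'

/-- A seminorm which is bounded by `B` on `S`. -/
theorem bound {p : (E3 → E3) → ENNReal} {B : ENNReal} (hS : ∀ f ∈ S, ContDiff ℝ ∞ f)
    (hsmul : ∀ (c : ℝ) (f : E3 → E3), |c| ≤ 1 → p (fun x => c • f x) ≤ p f)
    (hadd : ∀ f g : E3 → E3, ContDiff ℝ ∞ f → ContDiff ℝ ∞ g →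
      p (fun x => f x + g x) ≤ p f + p g)
    (h : ∀ f ∈ S, p f ≤ B) (hf : Comb S K f) : p f ≤ K * B := by
  induction hf with
  | base hf => simpa using h _ hf
  | smul hc hg ih => exact (hsmul _ _ hc).trans ih
  | add hf hg ih ih' =>
    refine (hadd _ _ (hf.contDiff hS) (hg.contDiff hS)).trans ((add_le_add ih ih').trans_eq ?_)
    push_cast
    ring

theorem pdv (hS : ∀ f ∈ S, ContDiff ℝ ∞ f) (i : Fin 3) (h : ∀ f ∈ S, Comb S' n (pdv i f))
    (hf : Comb S K f) : Comb S' (n * K) (pdv i f) := by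
  refine hf.bind hS (fun c f hf => funext fun x => ?_) (fun f g hf hg => funext fun x => ?_) h
  · rw [pdv_smul (contDiff_const.differentiableAt_infty x) (hf.differentiableAt_infty x)]
    simp [PrestressedElastic.pdv]
  · exact pdv_add (hf.differentiableAt_infty x) (hg.differentiableAt_infty x) i

theorem rotv (hS : ∀ f ∈ S, ContDiff ℝ ∞ f) (l : Fin 3) (h : ∀ f ∈ S, Comb S' n (rotv l f))
    (hf : Comb S K f) : Comb S' (n * K) (rotv l f) := by
  refine hf.bind hS (fun c f hf => funext fun x => ?_) (fun f g hf hg => funext fun x => ?_) h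
  · have h1 : ∀ i, PrestressedElastic.pdv i (fun x => c • f x) x
        = c • PrestressedElastic.pdv i f x := fun i => by
      rw [pdv_smul (contDiff_const.differentiableAt_infty x) (hf.differentiableAt_infty x)]
      simp [PrestressedElastic.pdv]
    simp only [PrestressedElastic.rotv, h1, map_smul]
    module
  · simp only [PrestressedElastic.rotv,
      pdv_add (hf.differentiableAt_infty x) (hg.differentiableAt_infty x), map_add]
    module

end Comb

/-- The derivatives `∂_β Γ^b φ(t)`, `|b| ≤ m`, which enter the energy. -/
def energyJets (T : ℝ) (φ : Field) (t : ℝ) (m : ℕ) : Set (E3 → E3) :=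
  {f | ∃ (β : Fin 4) (b : List GIdx), b.length ≤ m ∧ f = jet T φ t β b}

/-- The derivatives `∂_β ∂_l Γ^b φ(t)`, `|b| ≤ m`, which enter the weighted norm. -/
def weightedJets (T : ℝ) (φ : Field) (t : ℝ) (m : ℕ) : Set (E3 → E3) :=
  {f | ∃ (β : Fin 4) (l : Fin 3) (b : List GIdx), b.length ≤ m ∧
    f = jet T φ t β (Sum.inl l.succ :: b)}

section jets

variable {T t : ℝ} {φ : Field} {m : ℕ} {f : E3 → E3}

theorem energyJets_mono {m' : ℕ} (h : m ≤ m') : energyJets T φ t m ⊆ energyJets T φ t m' :=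
  fun _ ⟨β, b, hb, hf⟩ => ⟨β, b, hb.trans h, hf⟩

theorem weightedJets_mono {m' : ℕ} (h : m ≤ m') : weightedJets T φ t m ⊆ weightedJets T φ t m' :=
  fun _ ⟨β, l, b, hb, hf⟩ => ⟨β, l, b, hb.trans h, hf⟩

variable (hT : 0 < T) (hφ : IsTest T φ) (ht : t ∈ Icc 0 T)
include hT hφ ht

theorem contDiff_jet (β : Fin 4) (b : List GIdx) : ContDiff ℝ ∞ (jet T φ t β b) :=
  ((hφ.gamPow hT b).pd hT β).contDiff_slice ht

theorem contDiff_of_mem_energyJets (h : f ∈ energyJets T φ t m) : ContDiff ℝ ∞ f := by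
  obtain ⟨β, b, -, rfl⟩ := h
  exact contDiff_jet hT hφ ht β b

theorem contDiff_of_mem_weightedJets (h : f ∈ weightedJets T φ t m) : ContDiff ℝ ∞ f := by
  obtain ⟨β, l, b, -, rfl⟩ := h
  exact contDiff_jet hT hφ ht β _

theorem pdv_jet (i : Fin 3) (β : Fin 4) (b : List GIdx) :
    pdv i (jet T φ t β b) = jet T φ t β (Sum.inl i.succ :: b) :=
  funext fun x => pd_comm hT (hφ.gamPow hT b) i.succ β ht x

theorem pdv_mem_weightedJets (i : Fin 3) (h : f ∈ energyJets T φ t m) :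
    pdv i f ∈ weightedJets T φ t m := by
  obtain ⟨β, b, hb, rfl⟩ := h
  exact ⟨β, i, b, hb, pdv_jet hT hφ ht i β b⟩

theorem pdv_mem_energyJets (i : Fin 3) (h : f ∈ energyJets T φ t m) :
    pdv i f ∈ energyJets T φ t (m + 1) := by
  obtain ⟨β, b, hb, rfl⟩ := h
  exact ⟨β, Sum.inl i.succ :: b, by simpa using hb, pdv_jet hT hφ ht i β b⟩

theorem pdv_mem_weightedJets_succ (i : Fin 3) (h : f ∈ weightedJets T φ t m) :
    pdv i f ∈ weightedJets T φ t (m + 1) := by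
  obtain ⟨β, l, b, hb, rfl⟩ := h
  exact ⟨β, i, Sum.inl l.succ :: b, by simpa using hb, pdv_jet hT hφ ht i β _⟩

theorem comb_rotv_energyJets (l : Fin 3) (h : f ∈ energyJets T φ t m) :
    Comb (energyJets T φ t (m + 1)) 2 (rotv l f) := by
  obtain ⟨β, b, hb, rfl⟩ := h
  obtain ⟨γ, ε, hε, hc⟩ := exists_rot_pd hT l β
  have e : rotv l (jet T φ t β b)
      = fun x => jet T φ t β (Sum.inr (Sum.inl l) :: b) x + ε • jet T φ t γ.succ b x :=
    funext fun x => hc _ (hφ.gamPow hT b) t ht x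
  rw [e]
  have h1 : jet T φ t β (Sum.inr (Sum.inl l) :: b) ∈ energyJets T φ t (m + 1) :=
    ⟨β, _, by simpa using hb, rfl⟩
  have h2 : jet T φ t γ.succ b ∈ energyJets T φ t (m + 1) := ⟨γ.succ, b, by omega, rfl⟩
  exact Comb.add (Comb.base h1) (Comb.smul hε (Comb.base h2))

theorem comb_rotv_weightedJets (l : Fin 3) (h : f ∈ weightedJets T φ t m) :
    Comb (weightedJets T φ t (m + 1)) 3 (rotv l f) := by
  obtain ⟨β, n, b, hb, rfl⟩ := h
  obtain ⟨γ, ε, hε, hc⟩ := exists_rot_pd hT l β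
  obtain ⟨γ', ε', hε', hc'⟩ := exists_rot_pd hT l n.succ
  have hu := hφ.gamPow hT b
  have e : rotv l (jet T φ t β (Sum.inl n.succ :: b))
      = fun x => (jet T φ t β (Sum.inl n.succ :: Sum.inr (Sum.inl l) :: b) x
        + ε' • jet T φ t β (Sum.inl γ'.succ :: b) x)
        + ε • jet T φ t γ.succ (Sum.inl n.succ :: b) x := by
    funext x
    refine (hc _ (hu.pd hT n.succ) t ht x).trans ?_
    have := pd_comb hT ((hu.rot hT l).pd hT n.succ) (hu.pd hT γ'.succ) (c := 1) (d := ε')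
      (w := rot l (pd T n.succ (gamPow T b φ)))
      (fun t ht x => by rw [hc' _ hu t ht x, one_smul]) β ht x
    rw [this, one_smul]
    rfl
  rw [e]
  have h1 : jet T φ t β (Sum.inl n.succ :: Sum.inr (Sum.inl l) :: b)
      ∈ weightedJets T φ t (m + 1) := ⟨β, n, _, by simpa using hb, rfl⟩
  have h2 : jet T φ t β (Sum.inl γ'.succ :: b) ∈ weightedJets T φ t (m + 1) :=
    ⟨β, γ', b, by omega, rfl⟩
  have h3 : jet T φ t γ.succ (Sum.inl n.succ :: b) ∈ weightedJets T φ t (m + 1) :=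
    ⟨γ.succ, n, b, by omega, rfl⟩
  exact Comb.add (Comb.add (Comb.base h1) (Comb.smul hε' (Comb.base h2)))
    (Comb.smul hε (Comb.base h3))

end jets

/-- The `L²` norm of `g P_α f` with respect to `μ`. -/
def weightedNorm (μ : Measure E3) (g : E3 → ℝ) (α : Fin 2) (f : E3 → E3) : ENNReal :=
  eLpNorm (fun x => g x • proj α x (f x)) 2 μ

theorem proj_add (α : Fin 2) (x v w : E3) : proj α x (v + w) = proj α x v + proj α x w := by
  simp only [← projL_apply, map_add]

theorem proj_smul (α : Fin 2) (c : ℝ) (x v : E3) : proj α x (c • v) = c • proj α x v := by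
  simp only [← projL_apply, map_smul]

theorem weightedNorm_add_le (μ : Measure E3) {g : E3 → ℝ} (hg : Measurable g) (α : Fin 2)
    {f f' : E3 → E3} (hf : Measurable f) (hf' : Measurable f') :
    weightedNorm μ g α (fun x => f x + f' x) ≤ weightedNorm μ g α f + weightedNorm μ g α f' := by
  have e : (fun x => g x • proj α x (f x + f' x))
      = (fun x => g x • proj α x (f x)) + fun x => g x • proj α x (f' x) := by
    funext x
    rw [proj_add, smul_add]
    rfl
  rw [weightedNorm, e]
  exact eLpNorm_add_le (hg.smul (measurable_proj α hf)).aestronglyMeasurable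
    (hg.smul (measurable_proj α hf')).aestronglyMeasurable (by norm_num)

theorem weightedNorm_smul_le (μ : Measure E3) (g : E3 → ℝ) (α : Fin 2) (f : E3 → E3) {c : ℝ}
    (hc : |c| ≤ 1) : weightedNorm μ g α (fun x => c • f x) ≤ weightedNorm μ g α f := by
  refine eLpNorm_mono fun x => ?_
  rw [proj_smul, smul_comm, norm_smul, Real.norm_eq_abs]
  exact mul_le_of_le_one_left (norm_nonneg _) hc

theorem Comb.weightedNorm_le {S : Set (E3 → E3)} {K : ℕ} {f : E3 → E3} {μ : Measure E3}
    {g : E3 → ℝ} (hg : Measurable g) {α : Fin 2} {B : ENNReal} (hS : ∀ f ∈ S, ContDiff ℝ ∞ f)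
    (h : ∀ f ∈ S, weightedNorm μ g α f ≤ B) (hf : Comb S K f) :
    weightedNorm μ g α f ≤ K * B :=
  hf.bound hS (fun _ f hc => weightedNorm_smul_le μ g α f hc)
    (fun _ _ h h' => weightedNorm_add_le μ hg α h.continuous.measurable h'.continuous.measurable) h

theorem Comb.eLpNorm_le {S : Set (E3 → E3)} {K : ℕ} {f : E3 → E3} {B : ENNReal}
    (hS : ∀ f ∈ S, ContDiff ℝ ∞ f) (h : ∀ f ∈ S, eLpNorm f 2 volume ≤ B) (hf : Comb S K f) :
    eLpNorm f 2 volume ≤ K * B := by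
  refine hf.bound (p := fun f => eLpNorm f 2 volume) hS (fun c f hc => ?_) (fun f g hf hg => ?_) h
  · refine eLpNorm_mono fun x => ?_
    rw [norm_smul, Real.norm_eq_abs]
    exact mul_le_of_le_one_left (norm_nonneg _) hc
  · exact eLpNorm_add_le hf.continuous.aestronglyMeasurable hg.continuous.aestronglyMeasurable
      (by norm_num)

/-! ### Radial cutoff functions -/

theorem eLpNorm_smul_le_ofReal_mul {μ : Measure E3} {a : E3 → ℝ} {A : ℝ} (ha : ∀ x, |a x| ≤ A)
    (f : E3 → E3) :
    eLpNorm (fun x => a x • f x) 2 μ ≤ ENNReal.ofReal A * eLpNorm f 2 μ := by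
  refine eLpNorm_le_mul_eLpNorm_of_ae_le_mul (Eventually.of_forall fun x => ?_) 2
  rw [norm_smul]
  exact mul_le_mul_of_nonneg_right (ha x) (norm_nonneg _)

theorem inner_gen_self (l : Fin 3) (x : E3) : inner ℝ x (gen l x) = (0 : ℝ) := by
  rw [PiLp.inner_apply, Fin.sum_univ_three]
  simp only [gen_apply]
  fin_cases l <;> simp <;> ring

/-- A smooth radial cutoff function, equal to `1` on the ball of radius `τ` and supported in the
ball of radius `2 τ`. -/
def cutoff (τ : ℝ) (x : E3) : ℝ := Real.smoothTransition (2 - ‖τ⁻¹ • x‖ ^ 2)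

theorem contDiff_cutoff (τ : ℝ) : ContDiff ℝ ∞ (cutoff τ) :=
  Real.smoothTransition.contDiff.comp
    (contDiff_const.sub ((contDiff_id.const_smul τ⁻¹).norm_sq ℝ))

theorem abs_cutoff_le (τ : ℝ) (x : E3) : |cutoff τ x| ≤ 1 :=
  abs_le.2 ⟨by linarith [Real.smoothTransition.nonneg (2 - ‖τ⁻¹ • x‖ ^ 2),
    show cutoff τ x = Real.smoothTransition (2 - ‖τ⁻¹ • x‖ ^ 2) from rfl],
    Real.smoothTransition.le_one _⟩

theorem cutoff_eq_one {τ : ℝ} (hτ : 0 < τ) {x : E3} (hx : ‖x‖ ≤ τ) : cutoff τ x = 1 := by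
  refine Real.smoothTransition.one_of_one_le ?_
  have : ‖τ⁻¹ • x‖ ≤ 1 := by
    rw [norm_smul, norm_inv, Real.norm_of_nonneg hτ.le]
    exact (inv_mul_le_one₀ hτ).2 hx
  nlinarith [norm_nonneg (τ⁻¹ • x)]

theorem tsupport_cutoff_subset {τ : ℝ} (hτ : 0 < τ) :
    tsupport (cutoff τ) ⊆ Metric.closedBall 0 (2 * τ) := by
  refine closure_minimal (fun x hx => ?_) Metric.isClosed_closedBall
  by_contra h
  rw [mem_closedBall_zero_iff, not_le] at h
  refine hx (Real.smoothTransition.zero_of_nonpos ?_)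
  have : 2 < ‖τ⁻¹ • x‖ := by
    rw [norm_smul, norm_inv, Real.norm_of_nonneg hτ.le, lt_inv_mul_iff₀ hτ, mul_comm]
    exact h
  nlinarith

theorem hasCompactSupport_cutoff {τ : ℝ} (hτ : 0 < τ) : HasCompactSupport (cutoff τ) :=
  HasCompactSupport.of_support_subset_isCompact (isCompact_closedBall 0 (2 * τ))
    ((subset_tsupport _).trans (tsupport_cutoff_subset hτ))

theorem pdv_comp_smul {V : Type*} [NormedAddCommGroup V] [NormedSpace ℝ V] (a : ℝ) {f : E3 → V}
    (hf : ContDiff ℝ ∞ f) (i : Fin 3) :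
    pdv i (fun x => f (a • x)) = fun x => a • pdv i f (a • x) := by
  funext x
  have h1 : HasFDerivAt (fun x : E3 => a • x) (a • ContinuousLinearMap.id ℝ E3) x :=
    (hasFDerivAt_id x).const_smul a
  have h2 := (hf.differentiableAt_infty (a • x)).hasFDerivAt.comp x h1
  have h3 : HasFDerivAt (fun x => f (a • x)) _ x := h2
  rw [pdv, h3.fderiv]
  simp [pdv]

/-- The derivatives of first order of the cutoff at radius `τ ≥ 1` are `O(1/τ)`, and so are those
of second order. -/
theorem exists_bound_cutoff : ∃ M : ℝ, 0 ≤ M ∧ ∀ τ, 1 ≤ τ → ∀ x,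
    (∀ i, |pdv i (cutoff τ) x| ≤ M / τ) ∧ ∀ i j, |pdv j (pdv i (cutoff τ)) x| ≤ M / τ := by
  obtain ⟨M, hM, h⟩ := exists_bound_pdv (contDiff_cutoff 1) (hasCompactSupport_cutoff one_pos)
  refine ⟨M, hM, fun τ hτ x => ?_⟩
  have h0 : 0 < τ := by linarith
  have e0 : cutoff τ = fun x => cutoff 1 (τ⁻¹ • x) := by
    funext x
    simp [cutoff]
  have e1 : ∀ i, pdv i (cutoff τ) = fun x => τ⁻¹ • pdv i (cutoff 1) (τ⁻¹ • x) := fun i => by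
    rw [e0, pdv_comp_smul _ (contDiff_cutoff 1)]
  have e2 : ∀ i j, pdv j (pdv i (cutoff τ)) x
      = τ⁻¹ • τ⁻¹ • pdv j (pdv i (cutoff 1)) (τ⁻¹ • x) := fun i j => by
    have hd : ContDiff ℝ ∞ fun x => pdv i (cutoff 1) (τ⁻¹ • x) :=
      ((contDiff_cutoff 1).pdv i).comp (contDiff_id.const_smul τ⁻¹)
    rw [e1, pdv_smul (contDiff_const.differentiableAt_infty x) (hd.differentiableAt_infty x),
      pdv_comp_smul _ ((contDiff_cutoff 1).pdv i)]
    simp [pdv]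
  have hi : 0 ≤ τ⁻¹ := by positivity
  have hi1 : τ⁻¹ ≤ 1 := inv_le_one_of_one_le₀ hτ
  refine ⟨fun i => ?_, fun i j => ?_⟩
  · rw [e1]
    change |τ⁻¹ * pdv i (cutoff 1) (τ⁻¹ • x)| ≤ _
    rw [abs_mul, abs_of_nonneg hi, div_eq_inv_mul]
    exact mul_le_mul_of_nonneg_left ((h _).2.1 i) hi
  · rw [e2, smul_eq_mul, smul_eq_mul, abs_mul, abs_mul, abs_of_nonneg hi, div_eq_inv_mul]
    refine mul_le_mul_of_nonneg_left ?_ hi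
    exact (mul_le_of_le_one_left (abs_nonneg _) hi1).trans ((h _).2.2 i j)

/-- Multiplication by a radial function commutes with `Ω̃_l`. -/
theorem rotv_cutoff_smul (τ : ℝ) {f : E3 → E3} (hf : ContDiff ℝ ∞ f) (l : Fin 3) :
    rotv l (fun x => cutoff τ x • f x) = fun x => cutoff τ x • rotv l f x := by
  funext x
  have h1 : HasFDerivAt (fun x : E3 => 2 - ‖τ⁻¹ • x‖ ^ 2)
      (-(2 • (innerSL ℝ (τ⁻¹ • x)).comp (τ⁻¹ • ContinuousLinearMap.id ℝ E3))) x :=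
    (((hasFDerivAt_id x).const_smul τ⁻¹).norm_sq).const_sub 2
  have hg : DifferentiableAt ℝ Real.smoothTransition (2 - ‖τ⁻¹ • x‖ ^ 2) :=
    (Real.smoothTransition.contDiff (n := 1)).differentiable (by simp) _
  have h2 : HasFDerivAt (cutoff τ) _ x := hg.hasFDerivAt.comp x h1
  have h3 : fderiv ℝ (cutoff τ) x (gen l x) = 0 := by
    rw [h2.fderiv]
    simp [inner_gen_self]
  rw [rotv_eq, rotv_eq, fderiv_fun_smul ((contDiff_cutoff τ).differentiableAt_infty x)
    (hf.differentiableAt_infty x)]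
  simp [h3, smul_sub]

/-- The `L²` norm over the ball of radius `2 τ` around the origin. -/
def ballNorm (τ : ℝ) (f : E3 → E3) : ENNReal :=
  eLpNorm f 2 (volume.restrict (Metric.closedBall 0 (2 * τ)))

theorem eLpNorm_eq_ballNorm {τ : ℝ} {f : E3 → E3} (h : tsupport f ⊆ Metric.closedBall 0 (2 * τ)) :
    eLpNorm f 2 volume = ballNorm τ f :=
  (eLpNorm_restrict_eq_of_support_subset ((subset_tsupport f).trans h)).symm

theorem eLpNorm_cutoff_smul_le {τ : ℝ} (hτ : 0 < τ) (f : E3 → E3) :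
    eLpNorm (fun x => cutoff τ x • f x) 2 volume ≤ ballNorm τ f := by
  rw [eLpNorm_eq_ballNorm ((tsupport_smul_subset_left _ _).trans (tsupport_cutoff_subset hτ))]
  refine (eLpNorm_smul_le_ofReal_mul (abs_cutoff_le τ) f).trans_eq ?_
  rw [ENNReal.ofReal_one, one_mul, ballNorm]

theorem exists_eLpNorm_pdv_cutoff_smul_le : ∃ M : NNReal, ∀ τ, 1 ≤ τ → ∀ f : E3 → E3,
    ContDiff ℝ ∞ f →
      (∀ i, eLpNorm (pdv i (fun x => cutoff τ x • f x)) 2 volume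
        ≤ ballNorm τ (pdv i f) + ENNReal.ofReal (M / τ) * ballNorm τ f) ∧
      ∀ i j, eLpNorm (pdv j (pdv i (fun x => cutoff τ x • f x))) 2 volume
        ≤ ballNorm τ (pdv j (pdv i f)) + ENNReal.ofReal (M / τ) * (ballNorm τ (pdv i f)
          + ballNorm τ (pdv j f) + ballNorm τ f) := by
  obtain ⟨M, hM, hb⟩ := exists_bound_cutoff
  refine ⟨⟨M, hM⟩, fun τ hτ f hf => ?_⟩
  have h0 : 0 < τ := by linarith
  set μ := (volume : Measure E3).restrict (Metric.closedBall 0 (2 * τ)) with hμ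
  have hsub : tsupport (fun x => cutoff τ x • f x) ⊆ Metric.closedBall 0 (2 * τ) :=
    (tsupport_smul_subset_left _ _).trans (tsupport_cutoff_subset h0)
  have hχ := contDiff_cutoff τ
  have l1 : ∀ g : E3 → E3, eLpNorm (fun x => cutoff τ x • g x) 2 μ ≤ ballNorm τ g := fun g => by
    refine (eLpNorm_smul_le_ofReal_mul (abs_cutoff_le τ) g).trans_eq ?_
    rw [ENNReal.ofReal_one, one_mul, ballNorm]
  have l2 : ∀ (i : Fin 3) (g : E3 → E3), eLpNorm (fun x => pdv i (cutoff τ) x • g x) 2 μ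
      ≤ ENNReal.ofReal (M / τ) * ballNorm τ g := fun i g =>
    eLpNorm_smul_le_ofReal_mul (fun x => (hb τ hτ x).1 i) g
  have l3 : ∀ (i j : Fin 3) (g : E3 → E3),
      eLpNorm (fun x => pdv j (pdv i (cutoff τ)) x • g x) 2 μ
        ≤ ENNReal.ofReal (M / τ) * ballNorm τ g := fun i j g =>
    eLpNorm_smul_le_ofReal_mul (fun x => (hb τ hτ x).2 i j) g
  have cm : ∀ {a : E3 → ℝ} {g : E3 → E3}, ContDiff ℝ ∞ a → ContDiff ℝ ∞ g →
      AEStronglyMeasurable (fun x => a x • g x) μ :=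
    fun ha hg => (ha.continuous.smul hg.continuous).aestronglyMeasurable
  refine ⟨fun i => ?_, fun i j => ?_⟩
  · rw [eLpNorm_eq_ballNorm ((tsupport_pdv_subset _ i).trans hsub)]
    have e : pdv i (fun x => cutoff τ x • f x)
        = (fun x => cutoff τ x • pdv i f x) + fun x => pdv i (cutoff τ) x • f x :=
      funext fun x => pdv_smul (hχ.differentiableAt_infty x) (hf.differentiableAt_infty x) i
    rw [e]
    exact (eLpNorm_add_le (cm hχ (hf.pdv i)) (cm (hχ.pdv i) hf) (by norm_num)).trans
      (add_le_add (l1 _) (l2 i _))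
  · rw [eLpNorm_eq_ballNorm ((tsupport_pdv_subset _ j).trans
      ((tsupport_pdv_subset _ i).trans hsub))]
    have e : pdv j (pdv i (fun x => cutoff τ x • f x))
        = ((fun x => cutoff τ x • pdv j (pdv i f) x) + fun x => pdv j (cutoff τ) x • pdv i f x)
          + ((fun x => pdv i (cutoff τ) x • pdv j f x)
            + fun x => pdv j (pdv i (cutoff τ)) x • f x) :=
      funext fun x => pdv_pdv_smul hχ hf i j x
    have m1 := cm hχ ((hf.pdv i).pdv j)
    have m2 := cm (hχ.pdv j) (hf.pdv i)
    have m3 := cm (hχ.pdv i) (hf.pdv j)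
    have m4 := cm ((hχ.pdv i).pdv j) hf
    rw [e]
    refine (eLpNorm_add_le (m1.add m2) (m3.add m4) (by norm_num)).trans ?_
    refine (add_le_add ((eLpNorm_add_le m1 m2 (by norm_num)).trans (add_le_add (l1 _) (l2 j _)))
      ((eLpNorm_add_le m3 m4 (by norm_num)).trans (add_le_add (l2 i _) (l3 i j _)))).trans_eq ?_
    change _ = _ + ENNReal.ofReal (M / τ) * _
    ring

/-! ### Light cones, and the decay of test fields -/

theorem jb_le_add (a b : ℝ) : jb a ≤ jb b + |a - b| := by
  have h1 := jb_nonneg b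
  have h2 := abs_le_jb b
  have h3 := abs_nonneg (a - b)
  have h4 : jb b ^ 2 = 1 + b ^ 2 := Real.sq_sqrt (by positivity)
  refine Real.sqrt_le_iff.2 ⟨by positivity, ?_⟩
  have h5 : |a| ≤ |b| + |a - b| := by
    have := abs_add_le b (a - b)
    rwa [add_sub_cancel] at this
  have h6 : |a| ^ 2 ≤ (|b| + |a - b|) ^ 2 := pow_le_pow_left₀ (abs_nonneg a) h5 2
  rw [sq_abs] at h6
  nlinarith [mul_le_mul_of_nonneg_right h2 h3, sq_abs b]

theorem continuous_jb : Continuous jb := by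
  unfold jb
  fun_prop

/-- With `τ = max(1, δ t)` the ball of radius `2 τ` stays away from both light cones
`r = c_α t`, and outside the ball of radius `τ` the weights are `O(r)`. -/
theorem exists_cone_separation {c : Fin 2 → ℝ} (hc : ∀ α, 0 < c α) :
    ∃ M : NNReal, 1 ≤ M ∧ ∀ t : ℝ, 0 ≤ t → ∃ τ : ℝ, 1 ≤ τ ∧
      (∀ (α : Fin 2) (y : E3), ‖y‖ ≤ 2 * τ → τ ≤ jb (c α * t - ‖y‖)) ∧
      ∀ (α : Fin 2) (r ρ : ℝ), 0 ≤ r → r ≤ ρ → τ ≤ ρ → jb (c α * t - r) ≤ M * ρ := by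
  obtain ⟨δ, hδ, hδc⟩ : ∃ δ : ℝ, 0 < δ ∧ ∀ α, 4 * δ ≤ c α := by
    refine ⟨min (c 0) (c 1) / 4, by have := lt_min (hc 0) (hc 1); positivity, fun α => ?_⟩
    fin_cases α
    · exact (by ring : 4 * (min (c 0) (c 1) / 4) = min (c 0) (c 1)).trans_le (min_le_left _ _)
    · exact (by ring : 4 * (min (c 0) (c 1) / 4) = min (c 0) (c 1)).trans_le (min_le_right _ _)
  have h0 := hc 0
  have h1 := hc 1
  have hcm : ∀ α, c α ≤ c 0 + c 1 := fun α => by fin_cases α <;> simp <;> linarith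
  have hM : 0 ≤ (c 0 + c 1) / δ := by positivity
  refine ⟨⟨2 + (c 0 + c 1) / δ, by positivity⟩, ?_, fun t ht => ⟨max 1 (δ * t), le_max_left _ _,
    fun α y hy => ?_, fun α r ρ hr hrρ hρ => ?_⟩⟩
  · exact NNReal.coe_le_coe.1 (show (1 : ℝ) ≤ 2 + (c 0 + c 1) / δ by linarith)
  · rcases le_total 1 (δ * t) with h | h
    · rw [max_eq_right h] at hy ⊢
      refine le_trans ?_ (abs_le_jb _)
      refine le_trans ?_ (le_abs_self _)
      nlinarith [mul_le_mul_of_nonneg_right (hδc α) ht]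
    · rw [max_eq_left h]
      exact one_le_jb _
  · have h1ρ : 1 ≤ ρ := (le_max_left _ _).trans hρ
    have htρ : δ * t ≤ ρ := (le_max_right _ _).trans hρ
    have hct : c α * t ≤ (c 0 + c 1) / δ * ρ := by
      calc c α * t ≤ (c 0 + c 1) * t := mul_le_mul_of_nonneg_right (hcm α) ht
        _ = (c 0 + c 1) / δ * (δ * t) := by field_simp
        _ ≤ _ := mul_le_mul_of_nonneg_left htρ hM
    have h3 : |c α * t - r| ≤ c α * t + r := by
      have := mul_nonneg (hc α).le ht
      rw [abs_le]
      constructor <;> linarith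
    refine (jb_le_one_add_abs _).trans ?_
    change _ ≤ (2 + (c 0 + c 1) / δ) * ρ
    linarith

/-- On a set where `A ≤ B g`, a multiple of the norm of `P_α f` is dominated by the weighted norm. -/
theorem ofReal_mul_projNorm_le {S S' : Set E3} (hS : MeasurableSet S) (hSS : S ⊆ S') {g : E3 → ℝ}
    {A B : ℝ} (hA : 0 ≤ A) (hB : 0 ≤ B) (h : ∀ y ∈ S, A ≤ B * g y) (α : Fin 2) (f : E3 → E3) :
    ENNReal.ofReal A * projNorm (volume.restrict S) α f
      ≤ ENNReal.ofReal B * weightedNorm (volume.restrict S') g α f := by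
  have e : ENNReal.ofReal A * projNorm (volume.restrict S) α f
      = eLpNorm (fun x => A • proj α x (f x)) 2 (volume.restrict S) := by
    rw [projNorm, ← Real.enorm_of_nonneg hA]
    exact (eLpNorm_const_smul A _ _ _).symm
  rw [e]
  refine (eLpNorm_le_mul_eLpNorm_of_ae_le_mul (g := fun x => g x • proj α x (f x)) (c := B)
    ((ae_restrict_iff' hS).2 (Eventually.of_forall fun y hy => ?_)) 2).trans
    (mul_le_mul' le_rfl (eLpNorm_mono_measure _ (Measure.restrict_mono hSS le_rfl)))
  rw [norm_smul, norm_smul, Real.norm_of_nonneg hA, ← mul_assoc]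
  refine mul_le_mul_of_nonneg_right ((h y hy).trans ?_) (norm_nonneg _)
  exact mul_le_mul_of_nonneg_left (le_abs_self _) hB

theorem ballNorm_le_projNorm {τ : ℝ} {f : E3 → E3} (hf : ContDiff ℝ ∞ f) :
    ballNorm τ f ≤ projNorm (volume.restrict (Metric.closedBall 0 (2 * τ))) 0 f
      + projNorm (volume.restrict (Metric.closedBall 0 (2 * τ))) 1 f := by
  have e : f = (fun x => proj 0 x (f x)) + fun x => proj 1 x (f x) :=
    funext fun x => (proj_zero_add_proj_one x (f x)).symm
  rw [ballNorm]
  conv_lhs => rw [e]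
  exact eLpNorm_add_le (measurable_proj 0 hf.continuous.measurable).aestronglyMeasurable
    (measurable_proj 1 hf.continuous.measurable).aestronglyMeasurable (by norm_num)

theorem ballNorm_le (τ : ℝ) (f : E3 → E3) : ballNorm τ f ≤ eLpNorm f 2 volume :=
  eLpNorm_restrict_le _ _

section decay

variable {T t : ℝ} {φ : Field} {m K : ℕ} {f : E3 → E3}

theorem Comb.rotv_energyJets (hT : 0 < T) (hφ : IsTest T φ) (ht : t ∈ Icc 0 T)
    (h : Comb (energyJets T φ t m) K f) (l : Fin 3) :
    Comb (energyJets T φ t (m + 1)) (2 * K) (PrestressedElastic.rotv l f) :=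
  h.rotv (fun _ => contDiff_of_mem_energyJets hT hφ ht) l
    fun _ => comb_rotv_energyJets hT hφ ht l

theorem Comb.pdv_energyJets (hT : 0 < T) (hφ : IsTest T φ) (ht : t ∈ Icc 0 T)
    (h : Comb (energyJets T φ t m) K f) (i : Fin 3) :
    Comb (energyJets T φ t (m + 1)) (1 * K) (PrestressedElastic.pdv i f) :=
  h.pdv (fun _ => contDiff_of_mem_energyJets hT hφ ht) i
    fun _ hg => Comb.base (pdv_mem_energyJets hT hφ ht i hg)

theorem Comb.pdv_energyJets_weightedJets (hT : 0 < T) (hφ : IsTest T φ) (ht : t ∈ Icc 0 T)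
    (h : Comb (energyJets T φ t m) K f) (i : Fin 3) :
    Comb (weightedJets T φ t m) (1 * K) (PrestressedElastic.pdv i f) :=
  h.pdv (fun _ => contDiff_of_mem_energyJets hT hφ ht) i
    fun _ hg => Comb.base (pdv_mem_weightedJets hT hφ ht i hg)

theorem Comb.rotv_weightedJets (hT : 0 < T) (hφ : IsTest T φ) (ht : t ∈ Icc 0 T)
    (h : Comb (weightedJets T φ t m) K f) (l : Fin 3) :
    Comb (weightedJets T φ t (m + 1)) (3 * K) (PrestressedElastic.rotv l f) :=
  h.rotv (fun _ => contDiff_of_mem_weightedJets hT hφ ht) l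
    fun _ => comb_rotv_weightedJets hT hφ ht l

theorem Comb.pdv_weightedJets (hT : 0 < T) (hφ : IsTest T φ) (ht : t ∈ Icc 0 T)
    (h : Comb (weightedJets T φ t m) K f) (i : Fin 3) :
    Comb (weightedJets T φ t (m + 1)) (1 * K) (PrestressedElastic.pdv i f) :=
  h.pdv (fun _ => contDiff_of_mem_weightedJets hT hφ ht) i
    fun _ hg => Comb.base (pdv_mem_weightedJets_succ hT hφ ht i hg)

/-- A bound with the number of summands rounded up to a common value. -/
theorem Comb.eLpNorm_energyJets_le (hT : 0 < T) (hφ : IsTest T φ) (ht : t ∈ Icc 0 T)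
    {m' n : ℕ} {N : ENNReal} (hN : ∀ f ∈ energyJets T φ t m', eLpNorm f 2 volume ≤ N)
    (hm : m ≤ m') (hK : K ≤ n) (h : Comb (energyJets T φ t m) K f) :
    eLpNorm f 2 volume ≤ n * N :=
  (h.eLpNorm_le (fun _ => contDiff_of_mem_energyJets hT hφ ht)
    fun _ hf => hN _ (energyJets_mono hm hf)).trans (by gcongr)

theorem Comb.weightedNorm_weightedJets_le (hT : 0 < T) (hφ : IsTest T φ) (ht : t ∈ Icc 0 T)
    {m' n : ℕ} {X : ENNReal} {μ : Measure E3} {g : E3 → ℝ} (hg : Measurable g) {α : Fin 2}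
    (hX : ∀ f ∈ weightedJets T φ t m', weightedNorm μ g α f ≤ X)
    (hm : m ≤ m') (hK : K ≤ n) (h : Comb (weightedJets T φ t m) K f) :
    weightedNorm μ g α f ≤ n * X :=
  (h.weightedNorm_le hg (fun _ => contDiff_of_mem_weightedJets hT hφ ht)
    fun _ hf => hX _ (weightedJets_mono hm hf)).trans (by gcongr)

/-- The decay of `Γ^a φ` for a test field, in terms of bounds for its derivatives in `L²`. -/
theorem exists_sqrt_decay_gamPow : ∃ C : NNReal, ∀ (T t : ℝ) (φ : Field), 0 < T → IsTest T φ →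
    t ∈ Icc 0 T → ∀ (a : List GIdx) (N : ENNReal),
    (∀ f ∈ energyJets T φ t (a.length + 1), eLpNorm f 2 volume ≤ N) → ∀ x : E3,
    ENNReal.ofReal (Real.sqrt (jb ‖x‖)) * ‖gamPow T a φ t x‖ₑ ≤ C * N := by
  obtain ⟨C, hC⟩ := exists_sqrt_decay
  refine ⟨C * 21, fun T t φ hT hφ ht a N hN x => ?_⟩
  have hu := hφ.gamPow hT a
  refine (hC _ (hu.contDiff_slice ht) (hu.hasCompactSupport_slice ht) x).trans ?_
  have h0 : gradNorm (gamPow T a φ t) ≤ 3 * N := by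
    refine (Finset.sum_le_sum (g := fun _ => N) fun i _ => ?_).trans_eq (by simp)
    exact hN _ ⟨i.succ, a, by omega, rfl⟩
  have h1 : ∀ j : Fin 3, gradNorm (pdv j (gamPow T a φ t)) ≤ 3 * N := fun j => by
    refine (Finset.sum_le_sum (g := fun _ => N) fun i _ => ?_).trans_eq (by simp)
    exact hN _ (pdv_mem_energyJets hT hφ ht i ⟨j.succ, a, le_rfl, rfl⟩)
  have h2 : ∀ l : Fin 3, gradNorm (rotv l (gamPow T a φ t)) ≤ 3 * N := fun l => by
    refine (Finset.sum_le_sum (g := fun _ => N) fun i _ => ?_).trans_eq (by simp)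
    exact hN _ ⟨i.succ, Sum.inr (Sum.inl l) :: a, le_rfl, rfl⟩
  calc _ ≤ C * (3 * N + ∑ j : Fin 3, 3 * N + ∑ l : Fin 3, 3 * N) := by
        refine mul_le_mul' le_rfl (add_le_add (add_le_add h0 ?_) ?_)
        · exact Finset.sum_le_sum fun j _ => h1 j
        · exact Finset.sum_le_sum fun j _ => h2 j
    _ = _ := by
        simp only [Finset.sum_const, Finset.card_univ, Fintype.card_fin, nsmul_eq_mul]
        push_cast
        ring

/-- The decay of `∂_β Γ^a φ` for a test field, in terms of bounds for its derivatives in `L²`. -/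
theorem exists_full_decay_jet : ∃ C : NNReal, ∀ (T t : ℝ) (φ : Field), 0 < T → IsTest T φ →
    t ∈ Icc 0 T → ∀ (β : Fin 4) (a : List GIdx) (N : ENNReal),
    (∀ f ∈ energyJets T φ t (a.length + 2), eLpNorm f 2 volume ≤ N) → ∀ x : E3,
    ENNReal.ofReal (jb ‖x‖) * ‖jet T φ t β a x‖ₑ ≤ C * N := by
  obtain ⟨C, hC⟩ := exists_full_decay
  refine ⟨C * 4, fun T t φ hT hφ ht β a N hN x => ?_⟩
  have hm : jet T φ t β a ∈ energyJets T φ t a.length := ⟨β, a, le_rfl, rfl⟩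
  have hv := Comb.base hm
  have hR := fun l => hv.rotv_energyJets hT hφ ht l
  rw [ENNReal.coe_mul, mul_assoc]
  refine hC _ (contDiff_jet hT hφ ht β a) _ ?_ (fun l => ?_) (fun l m => ?_) (fun m => ?_)
    (fun l m => ?_) (fun i j => ?_) x
  · exact hv.eLpNorm_energyJets_le hT hφ ht (n := 4) hN (by omega) (by omega)
  · exact (hR l).eLpNorm_energyJets_le hT hφ ht (n := 4) hN (by omega) (by omega)
  · exact ((hR l).rotv_energyJets hT hφ ht m).eLpNorm_energyJets_le hT hφ ht (n := 4) hN
      (by omega) (by omega)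
  · exact (hv.pdv_energyJets hT hφ ht m).eLpNorm_energyJets_le hT hφ ht (n := 4) hN
      (by omega) (by omega)
  · exact ((hR l).pdv_energyJets hT hφ ht m).eLpNorm_energyJets_le hT hφ ht (n := 4) hN
      (by omega) (by omega)
  · exact ((hv.pdv_energyJets hT hφ ht i).pdv_energyJets hT hφ ht j).eLpNorm_energyJets_le
      hT hφ ht (n := 4) hN (by omega) (by omega)

end decay

/-! ### Weighted decay of test fields -/

/-- On a shell around `|x|` of half-width `s / 4 ≤ L / 4` the weight is comparable to its value
`L` at `x`. -/
theorem le_two_mul_jb_of_mem_shell {ρ r s : ℝ} (hs : s ≤ jb (ρ - r)) {y : E3}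
    (hy : y ∈ shell r (s / 4)) : jb (ρ - r) ≤ 2 * jb (ρ - ‖y‖) := by
  have h1 := jb_le_add (ρ - r) (ρ - ‖y‖)
  have h2 : |‖y‖ - r| ≤ s / 4 := hy
  rw [show ρ - r - (ρ - ‖y‖) = ‖y‖ - r by ring] at h1
  linarith [jb_nonneg (ρ - r)]

theorem shell_subset_closedBall {r s R : ℝ} (hs : s ≤ r) (hr : 0 ≤ r) (hR : 2 * r ≤ R) :
    shell r (s / 4) ⊆ Metric.closedBall 0 R := by
  intro y hy
  have := abs_le.1 (show |‖y‖ - r| ≤ s / 4 from hy)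
  rw [mem_closedBall_zero_iff]
  linarith

theorem ofReal_mul_ballNorm_le {τ R : ℝ} (hτ : 0 ≤ τ) (hR : 2 * τ ≤ R) {g : Fin 2 → E3 → ℝ}
    (hg : ∀ α y, ‖y‖ ≤ 2 * τ → τ ≤ g α y) {f : E3 → E3} (hf : ContDiff ℝ ∞ f) {Y : ENNReal}
    (hY : ∀ α, weightedNorm (volume.restrict (Metric.closedBall 0 R)) (g α) α f ≤ Y) :
    ENNReal.ofReal τ * ballNorm τ f ≤ 2 * Y := by
  have h : ∀ α, ENNReal.ofReal τ * projNorm (volume.restrict (Metric.closedBall 0 (2 * τ))) α f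
      ≤ Y := fun α => by
    refine (ofReal_mul_projNorm_le (g := g α) Metric.isClosed_closedBall.measurableSet
      (Metric.closedBall_subset_closedBall hR) hτ zero_le_one (fun y hy => ?_) α f).trans ?_
    · rw [one_mul]
      exact hg α y (mem_closedBall_zero_iff.1 hy)
    · rw [ENNReal.ofReal_one, one_mul]
      exact hY α
  refine (mul_le_mul' le_rfl (ballNorm_le_projNorm hf)).trans ?_
  rw [mul_add, two_mul Y]
  exact add_le_add (h 0) (h 1)

/-- The decay of `P_α ∂_β Γ^a φ` for a test field. The weighted norms enter only over a ball, whose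
radius `R` depends on the point `(t, x)`; this makes the estimate stable under limits. -/
theorem exists_weighted_decay_jet {c : Fin 2 → ℝ} (hc : ∀ α, 0 < c α) :
    ∃ C : NNReal, ∀ (t : ℝ) (x : E3), 0 ≤ t → ∃ R : ℝ, ∀ (T : ℝ) (φ : Field), 0 < T → IsTest T φ →
    t ∈ Icc 0 T → ∀ (β : Fin 4) (a : List GIdx) (N X : ENNReal),
    (∀ f ∈ energyJets T φ t (a.length + 2), eLpNorm f 2 volume ≤ N) →
    (∀ α, ∀ f ∈ weightedJets T φ t (a.length + 1),
      weightedNorm (volume.restrict (Metric.closedBall 0 R)) (fun y => jb (c α * t - ‖y‖)) α f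
        ≤ X) → ∀ α : Fin 2,
    ENNReal.ofReal (jb ‖x‖ * Real.sqrt (jb (c α * t - ‖x‖))) * ‖proj α x (jet T φ t β a x)‖ₑ
      ≤ C * (N + X) := by
  obtain ⟨C₁, hC₁⟩ := exists_norm_proj_le_shellNorm
  obtain ⟨C₂, hC₂⟩ := exists_sqrt_decay
  obtain ⟨Mc, hMc⟩ := exists_eLpNorm_pdv_cutoff_smul_le
  obtain ⟨M, hM1, hsep⟩ := exists_cone_separation hc
  refine ⟨2 * NNReal.sqrt M * (C₁ * (25 * 4)) + NNReal.sqrt (2 * M) * (C₂ * (21 * (4 + 3 * Mc))),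
    fun t x ht0 => ?_⟩
  obtain ⟨τ, hτ1, hcone, hweight⟩ := hsep t ht0
  refine ⟨2 * (τ + ‖x‖), fun T φ hT hφ ht β a N X hN hX α => ?_⟩
  have hτ0 : 0 < τ := by linarith
  have hM0 : (1 : ℝ) ≤ M := hM1
  have hr0 := norm_nonneg x
  set L := jb (c α * t - ‖x‖) with hL
  have hL1 : 1 ≤ L := one_le_jb _
  have hm : jet T φ t β a ∈ energyJets T φ t a.length := ⟨β, a, le_rfl, rfl⟩
  have hv := Comb.base hm
  have hvc := contDiff_jet hT hφ ht β a
  have hR := fun l => hv.rotv_energyJets hT hφ ht l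
  have hgm : ∀ α, Measurable fun y : E3 => jb (c α * t - ‖y‖) := fun α =>
    (continuous_jb.comp (by fun_prop)).measurable
  rcases lt_or_ge τ ‖x‖ with hx | hx
  · -- away from the origin: a shell whose width is comparable to the weight
    have hLr : L ≤ M * ‖x‖ := hweight α _ _ hr0 le_rfl hx.le
    set s := L / M with hs
    have hs0 : 0 < s := by positivity
    have hsL : s ≤ L := div_le_self (by linarith) hM0
    have hsr : s ≤ ‖x‖ := (div_le_iff₀' (by linarith)).2 hLr
    have hres : ∀ f, projNorm (volume.restrict (shell ‖x‖ (s / 4))) α f ≤ eLpNorm f 2 volume :=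
      fun f => (projNorm_le _ _ _).trans (eLpNorm_restrict_le _ _)
    have hw : ∀ {f : E3 → E3} {K m : ℕ}, Comb (weightedJets T φ t m) K f → m ≤ a.length + 1 →
        K ≤ 2 → ENNReal.ofReal s * projNorm (volume.restrict (shell ‖x‖ (s / 4))) α f
          ≤ 4 * (N + X) := fun {f K m} hf hm hK => by
      refine (ofReal_mul_projNorm_le (g := fun y => jb (c α * t - ‖y‖))
        (S' := Metric.closedBall 0 (2 * (τ + ‖x‖))) (measurableSet_shell _ _)
        (shell_subset_closedBall hsr hr0 (by linarith)) hs0.le zero_le_two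
        (fun y hy => hsL.trans (le_two_mul_jb_of_mem_shell hsL hy)) α f).trans ?_
      refine (mul_le_mul' le_rfl (hf.weightedNorm_weightedJets_le hT hφ ht (hgm α) (hX α) hm
        hK)).trans ?_
      rw [ENNReal.ofReal_ofNat, Nat.cast_ofNat, ← mul_assoc,
        show (2 * 2 : ENNReal) = 4 by norm_num]
      gcongr
      exact le_add_self
    have hn : ∀ {f : E3 → E3} {K m : ℕ}, Comb (energyJets T φ t m) K f → m ≤ a.length + 2 →
        K ≤ 4 → projNorm (volume.restrict (shell ‖x‖ (s / 4))) α f ≤ 4 * (N + X) :=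
      fun {f K m} hf hm hK => by
      refine (hres f).trans ((hf.eLpNorm_energyJets_le hT hφ ht hN hm hK).trans ?_)
      rw [Nat.cast_ofNat]
      gcongr
      exact le_self_add
    have hsh : shellNorm (volume.restrict (shell ‖x‖ (s / 4))) α s (jet T φ t β a)
        ≤ 25 * (4 * (N + X)) := by
      refine shellNorm_le ?_ (fun l => ?_) (fun l m => ?_) (fun m => ?_) (fun l m => ?_)
      · exact hn hv (by omega) (by omega)
      · exact hn (hR l) (by omega) (by omega)
      · exact hn ((hR l).rotv_energyJets hT hφ ht m) (by omega) (by omega)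
      · exact hw (hv.pdv_energyJets_weightedJets hT hφ ht m) (by omega) (by omega)
      · exact hw ((hR l).pdv_energyJets_weightedJets hT hφ ht m) (by omega) (by omega)
    have hj : jb ‖x‖ ≤ 2 * ‖x‖ := by
      have := jb_le_one_add_abs ‖x‖
      rw [abs_norm] at this
      linarith
    have hsq : Real.sqrt L = Real.sqrt M * Real.sqrt s := by
      rw [← Real.sqrt_mul (by positivity), hs, mul_div_cancel₀ _ (by positivity)]
    have hfac : jb ‖x‖ * Real.sqrt L ≤ 2 * Real.sqrt M * (Real.sqrt s * ‖x‖) := by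
      rw [hsq]
      calc _ ≤ 2 * ‖x‖ * (Real.sqrt M * Real.sqrt s) := by gcongr
        _ = _ := by ring
    have hofM : ENNReal.ofReal (2 * Real.sqrt M) = (2 * NNReal.sqrt M : NNReal) := by
      rw [ENNReal.ofReal, ENNReal.coe_inj]
      refine NNReal.eq ?_
      rw [Real.coe_toNNReal _ (by positivity)]
      simp
    calc _ ≤ ENNReal.ofReal (2 * Real.sqrt M * (Real.sqrt s * ‖x‖))
            * ‖proj α x (jet T φ t β a x)‖ₑ := by gcongr
      _ = ENNReal.ofReal (2 * Real.sqrt M) * (ENNReal.ofReal (Real.sqrt s * ‖x‖)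
            * ‖proj α x (jet T φ t β a x)‖ₑ) := by
          rw [ENNReal.ofReal_mul (by positivity), mul_assoc]
      _ ≤ ENNReal.ofReal (2 * Real.sqrt M) * (C₁ * (25 * (4 * (N + X)))) := by
          refine mul_le_mul' le_rfl ((hC₁ _ hvc α x s hs0 hsr).trans ?_)
          exact mul_le_mul' le_rfl hsh
      _ = (2 * NNReal.sqrt M * (C₁ * (25 * 4)) : NNReal) * (N + X) := by
          rw [hofM]
          push_cast
          ring
      _ ≤ _ := by
          gcongr
          exact le_self_add
  · -- near the origin both weights are comparable to `τ`, and the field can be cut off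
    have hLτ : L ≤ M * τ := hweight α _ _ hr0 hx le_rfl
    set B : ENNReal := (4 + 3 * Mc) * (N + X) with hB
    have hcanc : ENNReal.ofReal τ * ENNReal.ofReal (Mc / τ) = Mc := by
      rw [← ENNReal.ofReal_mul hτ0.le, mul_div_cancel₀ _ hτ0.ne', ENNReal.ofReal_coe_nnreal]
    have hq : ∀ {f : E3 → E3} {K m : ℕ}, Comb (weightedJets T φ t m) K f → m ≤ a.length + 1 →
        K ≤ 2 → ENNReal.ofReal τ * ballNorm τ f ≤ 4 * (N + X) := fun {f K m} hf hm hK => by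
      refine (ofReal_mul_ballNorm_le hτ0.le (by linarith) hcone
        (hf.contDiff fun _ => contDiff_of_mem_weightedJets hT hφ ht) fun α =>
        hf.weightedNorm_weightedJets_le hT hφ ht (hgm α) (hX α) hm hK).trans ?_
      rw [Nat.cast_ofNat, ← mul_assoc, show (2 * 2 : ENNReal) = 4 by norm_num]
      gcongr
      exact le_add_self
    have hn : ∀ {f : E3 → E3} {K m n : ℕ}, Comb (energyJets T φ t m) K f → m ≤ a.length + 2 →
        K ≤ n → ballNorm τ f ≤ n * (N + X) := fun {f K m n} hf hm hK => by
      refine (ballNorm_le τ f).trans ((hf.eLpNorm_energyJets_le hT hφ ht hN hm hK).trans ?_)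
      gcongr
      exact le_self_add
    -- first derivatives of a cut off field
    have h1 : ∀ {f : E3 → E3} {K m : ℕ}, Comb (energyJets T φ t m) K f → m ≤ a.length + 1 →
        K ≤ 2 → ENNReal.ofReal τ * gradNorm (fun y => cutoff τ y • f y) ≤ 3 * B :=
      fun {f K m} hf hm hK => by
      rw [gradNorm, Finset.mul_sum]
      refine (Finset.sum_le_sum (g := fun _ => B) fun i _ => ?_).trans_eq (by simp)
      refine (mul_le_mul' le_rfl ((hMc τ hτ1 f (hf.contDiff
        fun _ => contDiff_of_mem_energyJets hT hφ ht)).1 i)).trans ?_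
      rw [mul_add, ← mul_assoc, hcanc]
      refine (add_le_add (hq (hf.pdv_energyJets_weightedJets hT hφ ht i) hm (by omega))
        (mul_le_mul' le_rfl (hn (n := 3) hf (by omega) (by omega)))).trans_eq ?_
      rw [hB]
      push_cast
      ring
    have h2 : ∀ j, ENNReal.ofReal τ * gradNorm (pdv j (fun y => cutoff τ y • jet T φ t β a y))
        ≤ 3 * B := fun j => by
      rw [gradNorm, Finset.mul_sum]
      refine (Finset.sum_le_sum (g := fun _ => B) fun i _ => ?_).trans_eq (by simp)
      refine (mul_le_mul' le_rfl ((hMc τ hτ1 _ hvc).2 j i)).trans ?_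
      have hd := fun i => hv.pdv_energyJets hT hφ ht i
      rw [mul_add, ← mul_assoc, hcanc]
      refine (add_le_add (hq ((hv.pdv_energyJets_weightedJets hT hφ ht j).pdv_weightedJets
        hT hφ ht i) (by omega) (by omega)) (mul_le_mul' le_rfl (add_le_add (add_le_add
        (hn (n := 1) (hd j) (by omega) (by omega)) (hn (n := 1) (hd i) (by omega) (by omega)))
        (hn (n := 1) hv (by omega) (by omega))))).trans_eq ?_
      rw [hB]
      push_cast
      ring
    have hsum : ENNReal.ofReal (Real.sqrt (jb ‖x‖) * τ) * ‖jet T φ t β a x‖ₑ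
        ≤ C₂ * (21 * B) := by
      have h := hC₂ (fun y => cutoff τ y • jet T φ t β a y) ((contDiff_cutoff τ).smul hvc)
        ((hasCompactSupport_cutoff hτ0).smul_right) x
      simp only [cutoff_eq_one hτ0 hx, one_smul] at h
      rw [ENNReal.ofReal_mul (Real.sqrt_nonneg _)]
      calc _ = ENNReal.ofReal τ * (ENNReal.ofReal (Real.sqrt (jb ‖x‖)) * ‖jet T φ t β a x‖ₑ) := by
            ring
        _ ≤ _ := mul_le_mul' le_rfl h
        _ = C₂ * (ENNReal.ofReal τ * gradNorm (fun y => cutoff τ y • jet T φ t β a y)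
            + ∑ j, ENNReal.ofReal τ * gradNorm (pdv j (fun y => cutoff τ y • jet T φ t β a y))
            + ∑ l, ENNReal.ofReal τ
              * gradNorm (rotv l (fun y => cutoff τ y • jet T φ t β a y))) := by
            rw [← Finset.mul_sum, ← Finset.mul_sum]
            ring
        _ ≤ C₂ * (3 * B + ∑ j : Fin 3, 3 * B + ∑ l : Fin 3, 3 * B) := by
            refine mul_le_mul' le_rfl (add_le_add (add_le_add (h1 hv (by omega) (by omega))
              (Finset.sum_le_sum fun j _ => h2 j)) (Finset.sum_le_sum fun l _ => ?_))
            rw [rotv_cutoff_smul τ hvc]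
            exact h1 (hR l) (by omega) (by omega)
        _ = _ := by
            simp only [Finset.sum_const, Finset.card_univ, Fintype.card_fin, nsmul_eq_mul]
            push_cast
            ring
    have hj : jb ‖x‖ ≤ 2 * τ := by
      have := jb_le_one_add_abs ‖x‖
      rw [abs_norm] at this
      linarith
    have hfac : jb ‖x‖ * Real.sqrt L ≤ Real.sqrt (2 * M) * (Real.sqrt (jb ‖x‖) * τ) := by
      calc jb ‖x‖ * Real.sqrt L
          = Real.sqrt (jb ‖x‖) * (Real.sqrt (jb ‖x‖) * Real.sqrt L) := by
            rw [← mul_assoc, Real.mul_self_sqrt (jb_nonneg _)]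
        _ ≤ Real.sqrt (jb ‖x‖) * (Real.sqrt (2 * τ) * Real.sqrt (M * τ)) := by gcongr
        _ = Real.sqrt (jb ‖x‖) * (Real.sqrt (2 * M) * τ) := by
            rw [← Real.sqrt_mul (by positivity), show 2 * τ * (M * τ) = 2 * M * τ ^ 2 by ring,
              Real.sqrt_mul (by positivity), Real.sqrt_sq hτ0.le]
        _ = _ := by ring
    have hofM : ENNReal.ofReal (Real.sqrt (2 * M)) = NNReal.sqrt (2 * M) := by
      rw [ENNReal.ofReal, ENNReal.coe_inj]
      refine NNReal.eq ?_
      rw [Real.coe_toNNReal _ (by positivity)]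
      simp
    calc _ ≤ ENNReal.ofReal (Real.sqrt (2 * M) * (Real.sqrt (jb ‖x‖) * τ))
            * ‖jet T φ t β a x‖ₑ := by
          gcongr
          rw [enorm_le_iff_norm_le]
          exact norm_proj_le _ _ _
      _ = ENNReal.ofReal (Real.sqrt (2 * M)) * (ENNReal.ofReal (Real.sqrt (jb ‖x‖) * τ)
            * ‖jet T φ t β a x‖ₑ) := by
          rw [ENNReal.ofReal_mul (by positivity), mul_assoc]
      _ ≤ ENNReal.ofReal (Real.sqrt (2 * M)) * (C₂ * (21 * B)) := mul_le_mul' le_rfl hsum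
      _ = (NNReal.sqrt (2 * M) * (C₂ * (21 * (4 + 3 * Mc))) : NNReal) * (N + X) := by
          rw [hofM, hB]
          push_cast
          ring
      _ ≤ _ := by
          gcongr
          exact le_add_self

/-- The decay of `P_α ∂_β ∂_l Γ^a φ` for a test field. Only weighted norms occur on the right-hand
side. -/
theorem exists_weighted_decay_second {c : Fin 2 → ℝ} (hc : ∀ α, 0 < c α) :
    ∃ C : NNReal, ∀ (t : ℝ) (x : E3), 0 ≤ t → ∃ R : ℝ, ∀ (T : ℝ) (φ : Field), 0 < T → IsTest T φ →
    t ∈ Icc 0 T → ∀ (β : Fin 4) (l : Fin 3) (a : List GIdx) (X : ENNReal),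
    (∀ α, ∀ f ∈ weightedJets T φ t (a.length + 2),
      weightedNorm (volume.restrict (Metric.closedBall 0 R)) (fun y => jb (c α * t - ‖y‖)) α f
        ≤ X) → ∀ α : Fin 2,
    ENNReal.ofReal (jb ‖x‖ * jb (c α * t - ‖x‖))
        * ‖proj α x (jet T φ t β (Sum.inl l.succ :: a) x)‖ₑ
      ≤ C * X := by
  obtain ⟨C₁, hC₁⟩ := exists_norm_proj_le_shellNorm
  obtain ⟨C₂, hC₂⟩ := exists_full_decay
  obtain ⟨Mc, hMc⟩ := exists_eLpNorm_pdv_cutoff_smul_le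
  obtain ⟨M, hM1, hsep⟩ := exists_cone_separation hc
  refine ⟨2 * (C₁ * (25 * 18)) + M * (C₂ * ((1 + 3 * Mc) * 18)), fun t x ht0 => ?_⟩
  obtain ⟨τ, hτ1, hcone, hweight⟩ := hsep t ht0
  refine ⟨2 * (τ + ‖x‖), fun T φ hT hφ ht β l a X hX α => ?_⟩
  have hτ0 : 0 < τ := by linarith
  have hr0 := norm_nonneg x
  set L := jb (c α * t - ‖x‖) with hL
  have hL1 : 1 ≤ L := one_le_jb _
  set v := jet T φ t β (Sum.inl l.succ :: a) with hvd
  have hm : v ∈ weightedJets T φ t a.length := ⟨β, l, a, le_rfl, rfl⟩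
  have hv := Comb.base hm
  have hvc : ContDiff ℝ ∞ v := contDiff_jet hT hφ ht β _
  have hR := fun l => hv.rotv_weightedJets hT hφ ht l
  have hRc := fun l => hvc.rotv l
  have hgm : ∀ α, Measurable fun y : E3 => jb (c α * t - ‖y‖) := fun α =>
    (continuous_jb.comp (by fun_prop)).measurable
  rcases lt_or_ge τ ‖x‖ with hx | hx
  · -- away from the origin: a shell of unit width
    have hL0 : ENNReal.ofReal L ≠ 0 := by simpa using (by linarith : 0 < L)
    have hw : ∀ {f : E3 → E3} {K m : ℕ}, Comb (weightedJets T φ t m) K f → m ≤ a.length + 2 →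
        K ≤ 9 → projNorm (volume.restrict (shell ‖x‖ (1 / 4))) α f
          ≤ 18 * X / ENNReal.ofReal L := fun {f K m} hf hm hK => by
      rw [ENNReal.le_div_iff_mul_le (Or.inl hL0) (Or.inl ENNReal.ofReal_ne_top), mul_comm]
      refine (ofReal_mul_projNorm_le (g := fun y => jb (c α * t - ‖y‖))
        (S' := Metric.closedBall 0 (2 * (τ + ‖x‖))) (measurableSet_shell _ _)
        (shell_subset_closedBall (by linarith) hr0 (by linarith)) (by linarith) zero_le_two
        (fun y hy => le_two_mul_jb_of_mem_shell hL1 hy) α f).trans ?_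
      refine (mul_le_mul' le_rfl (hf.weightedNorm_weightedJets_le hT hφ ht (hgm α) (hX α) hm
        hK)).trans_eq ?_
      rw [ENNReal.ofReal_ofNat, Nat.cast_ofNat, ← mul_assoc,
        show (2 * 9 : ENNReal) = 18 by norm_num]
    have hsh : shellNorm (volume.restrict (shell ‖x‖ (1 / 4))) α 1 v
        ≤ 25 * (18 * X / ENNReal.ofReal L) := by
      refine shellNorm_le ?_ (fun l => ?_) (fun l m => ?_) (fun m => ?_) (fun l m => ?_)
      · exact hw hv (by omega) (by omega)
      · exact hw (hR l) (by omega) (by omega)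
      · exact hw ((hR l).rotv_weightedJets hT hφ ht m) (by omega) (by omega)
      · rw [ENNReal.ofReal_one, one_mul]
        exact hw (hv.pdv_weightedJets hT hφ ht m) (by omega) (by omega)
      · rw [ENNReal.ofReal_one, one_mul]
        exact hw ((hR l).pdv_weightedJets hT hφ ht m) (by omega) (by omega)
    have hj : jb ‖x‖ ≤ 2 * ‖x‖ := by
      have := jb_le_one_add_abs ‖x‖
      rw [abs_norm] at this
      linarith
    have h := (hC₁ v hvc α x 1 one_pos (by linarith)).trans (mul_le_mul' le_rfl hsh)
    rw [Real.sqrt_one, one_mul] at h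
    calc _ ≤ ENNReal.ofReal (2 * ‖x‖ * L) * ‖proj α x (v x)‖ₑ := by gcongr
      _ = ENNReal.ofReal L * (2 * (ENNReal.ofReal ‖x‖ * ‖proj α x (v x)‖ₑ)) := by
          rw [ENNReal.ofReal_mul (by positivity), ENNReal.ofReal_mul zero_le_two,
            ENNReal.ofReal_ofNat]
          ring
      _ ≤ ENNReal.ofReal L * (2 * (C₁ * (25 * (18 * X / ENNReal.ofReal L)))) := by gcongr
      _ = 2 * (C₁ * (25 * (ENNReal.ofReal L * (18 * X / ENNReal.ofReal L)))) := by ring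
      _ = (2 * (C₁ * (25 * 18)) : NNReal) * X := by
          rw [ENNReal.mul_div_cancel hL0 ENNReal.ofReal_ne_top]
          push_cast
          ring
      _ ≤ _ := by
          gcongr
          exact le_self_add
  · -- near the origin: the field cut off at radius `τ`
    have hLτ : L ≤ M * τ := hweight α _ _ hr0 hx le_rfl
    have hτe : ENNReal.ofReal τ ≠ 0 := by simpa using hτ0
    set B : ENNReal := 18 * X / ENNReal.ofReal τ with hB
    have hq : ∀ {f : E3 → E3} {K m : ℕ}, Comb (weightedJets T φ t m) K f → m ≤ a.length + 2 →
        K ≤ 9 → ballNorm τ f ≤ B := fun {f K m} hf hm hK => by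
      rw [hB, ENNReal.le_div_iff_mul_le (Or.inl hτe) (Or.inl ENNReal.ofReal_ne_top), mul_comm]
      refine (ofReal_mul_ballNorm_le hτ0.le (by linarith) hcone
        (hf.contDiff fun _ => contDiff_of_mem_weightedJets hT hφ ht) fun α =>
        hf.weightedNorm_weightedJets_le hT hφ ht (hgm α) (hX α) hm hK).trans_eq ?_
      rw [Nat.cast_ofNat, ← mul_assoc, show (2 * 9 : ENNReal) = 18 by norm_num]
    have hMτ : ENNReal.ofReal (Mc / τ) ≤ Mc := by
      rw [← ENNReal.ofReal_coe_nnreal]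
      exact ENNReal.ofReal_le_ofReal (div_le_self Mc.2 hτ1)
    have b0 : ∀ {f : E3 → E3} {K m : ℕ}, Comb (weightedJets T φ t m) K f → m ≤ a.length + 2 →
        K ≤ 9 → eLpNorm (fun y => cutoff τ y • f y) 2 volume ≤ (1 + 3 * Mc) * B :=
      fun {f K m} hf hm hK => (eLpNorm_cutoff_smul_le hτ0 f).trans ((hq hf hm hK).trans
        (le_mul_of_one_le_left' le_self_add))
    have b1 : ∀ {f : E3 → E3} {K m : ℕ}, Comb (weightedJets T φ t m) K f → m ≤ a.length + 1 →
        K ≤ 9 → ∀ i, eLpNorm (pdv i (fun y => cutoff τ y • f y)) 2 volume ≤ (1 + 3 * Mc) * B :=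
      fun {f K m} hf hm hK i => by
      refine ((hMc τ hτ1 f (hf.contDiff fun _ => contDiff_of_mem_weightedJets hT hφ ht)).1
        i).trans ?_
      calc _ ≤ B + Mc * B := add_le_add (hq (hf.pdv_weightedJets hT hφ ht i) (by omega) (by omega))
            (mul_le_mul' hMτ (hq hf (by omega) hK))
        _ ≤ B + Mc * B + 2 * (Mc * B) := le_self_add
        _ = _ := by ring
    have hd := fun i => hv.pdv_weightedJets hT hφ ht i
    have h := hC₂ (fun y => cutoff τ y • v y) ((contDiff_cutoff τ).smul hvc) ((1 + 3 * Mc) * B)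
      (b0 hv (by omega) (by omega))
      (fun l => by
        rw [rotv_cutoff_smul τ hvc]
        exact b0 (hR l) (by omega) (by omega))
      (fun l m => by
        rw [rotv_cutoff_smul τ hvc, rotv_cutoff_smul τ (hRc l)]
        exact b0 ((hR l).rotv_weightedJets hT hφ ht m) (by omega) (by omega))
      (fun m => b1 hv (by omega) (by omega) m)
      (fun l m => by
        rw [rotv_cutoff_smul τ hvc]
        exact b1 (hR l) (by omega) (by omega) m)
      (fun i j => by
        refine ((hMc τ hτ1 v hvc).2 i j).trans ?_
        calc _ ≤ B + Mc * (B + B + B) := add_le_add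
              (hq ((hd i).pdv_weightedJets hT hφ ht j) (by omega) (by omega))
              (mul_le_mul' hMτ (add_le_add (add_le_add (hq (hd i) (by omega) (by omega))
                (hq (hd j) (by omega) (by omega))) (hq hv (by omega) (by omega))))
          _ = _ := by ring) x
    simp only [cutoff_eq_one hτ0 hx, one_smul] at h
    calc _ ≤ ENNReal.ofReal (M * τ * jb ‖x‖) * ‖v x‖ₑ := by
          rw [mul_comm (jb ‖x‖)]
          have := jb_nonneg ‖x‖
          gcongr
          rw [enorm_le_iff_norm_le]
          exact norm_proj_le _ _ _
      _ = M * ENNReal.ofReal τ * (ENNReal.ofReal (jb ‖x‖) * ‖v x‖ₑ) := by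
          rw [ENNReal.ofReal_mul (by positivity), ENNReal.ofReal_mul (NNReal.coe_nonneg M),
            ENNReal.ofReal_coe_nnreal]
          ring
      _ ≤ M * ENNReal.ofReal τ * (C₂ * ((1 + 3 * Mc) * B)) := by gcongr
      _ = M * (C₂ * ((1 + 3 * Mc) * (ENNReal.ofReal τ * B))) := by ring
      _ = (M * (C₂ * ((1 + 3 * Mc) * 18)) : NNReal) * X := by
          rw [hB, ENNReal.mul_div_cancel hτe ENNReal.ofReal_ne_top]
          push_cast
          ring
      _ ≤ _ := by
          gcongr
          exact le_add_self

/-! ### Coercivity, and uniform limits of test fields -/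

section coercivity

variable {c : Fin 2 → ℝ} {g : Fin 4 → E3 → E3}

theorem energyOne_nonneg (h : c 1 ^ 2 ≤ c 0 ^ 2) (g : Fin 4 → E3 → E3) : 0 ≤ energyOne c g := by
  refine mul_nonneg (by norm_num) (integral_nonneg fun x => ?_)
  have : 0 ≤ c 0 ^ 2 - c 1 ^ 2 := by linarith
  positivity

theorem integrable_energyDensity (hg : ∀ β, MemLp (g β) 2 volume) :
    Integrable fun x => ‖g 0 x‖ ^ 2 + c 1 ^ 2 * ∑ i : Fin 3, ‖g i.succ x‖ ^ 2
      + (c 0 ^ 2 - c 1 ^ 2) * (∑ i : Fin 3, g i.succ x i) ^ 2 := by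
  have h1 : ∀ β, Integrable fun x => ‖g β x‖ ^ 2 := fun β =>
    (memLp_two_iff_integrable_sq_norm (hg β).1).1 (hg β)
  have h2 : MemLp (fun x => ∑ i : Fin 3, g i.succ x i) 2 volume :=
    memLp_finsetSum _ fun i _ =>
      (EuclideanSpace.proj i : E3 →L[ℝ] ℝ).comp_memLp' (hg i.succ)
  exact ((h1 0).add ((integrable_finsetSum _ fun i _ => h1 i.succ).const_mul _)).add
    (h2.integrable_sq.const_mul _)

/-- The energy is coercive, as the coefficient of the divergence term is nonnegative. -/
theorem eLpNorm_le_energyOne (hc : 0 < c 1) (h : c 1 ^ 2 ≤ c 0 ^ 2)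
    (hg : ∀ β, MemLp (g β) 2 volume) (β : Fin 4) :
    eLpNorm (g β) 2 volume
      ≤ ENNReal.ofReal (Real.sqrt (2 / min 1 (c 1 ^ 2)) * Real.sqrt (energyOne c g)) := by
  set k := min 1 (c 1 ^ 2) with hk
  have hk0 : 0 < k := lt_min one_pos (by positivity)
  have hi : Integrable fun x => ‖g β x‖ ^ 2 :=
    (memLp_two_iff_integrable_sq_norm (hg β).1).1 (hg β)
  have hd : 0 ≤ c 0 ^ 2 - c 1 ^ 2 := by linarith
  have key : k * ∫ x, ‖g β x‖ ^ 2 ≤ 2 * energyOne c g := by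
    rw [energyOne, ← mul_assoc, ← integral_const_mul]
    norm_num only [one_mul]
    refine integral_mono (hi.const_mul _) (integrable_energyDensity hg) fun x => ?_
    have h3 : 0 ≤ (c 0 ^ 2 - c 1 ^ 2) * (∑ i : Fin 3, g i.succ x i) ^ 2 := by positivity
    have h4 : 0 ≤ c 1 ^ 2 * ∑ i : Fin 3, ‖g i.succ x‖ ^ 2 := by positivity
    refine Fin.cases ?_ (fun i => ?_) β
    · have := mul_le_mul_of_nonneg_right (min_le_left 1 (c 1 ^ 2)) (sq_nonneg ‖g 0 x‖)
      change k * ‖g 0 x‖ ^ 2 ≤ _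
      linarith
    · have h5 := mul_le_mul_of_nonneg_right (min_le_right 1 (c 1 ^ 2)) (sq_nonneg ‖g i.succ x‖)
      have h6 : ‖g i.succ x‖ ^ 2 ≤ ∑ i : Fin 3, ‖g i.succ x‖ ^ 2 :=
        Finset.single_le_sum (f := fun i : Fin 3 => ‖g i.succ x‖ ^ 2) (fun _ _ => sq_nonneg _)
          (Finset.mem_univ i)
      have h7 := mul_le_mul_of_nonneg_left h6 (sq_nonneg (c 1))
      have h8 := sq_nonneg ‖g 0 x‖
      change k * ‖g i.succ x‖ ^ 2 ≤ _
      linarith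
  refine le_of_sq_le_sq ?_
  have e : ∀ x, ‖g β x‖ₑ ^ 2 = ENNReal.ofReal (‖g β x‖ ^ 2) := fun x => by
    rw [← ofReal_norm, ENNReal.ofReal_pow (norm_nonneg _)]
  rw [eLpNorm_two_sq, lintegral_congr e, ← ofReal_integral_eq_lintegral_ofReal hi
    (Eventually.of_forall fun x => sq_nonneg _), ← ENNReal.ofReal_pow (by positivity), mul_pow,
    Real.sq_sqrt (by positivity), Real.sq_sqrt (energyOne_nonneg h g)]
  refine ENNReal.ofReal_le_ofReal ?_
  rw [div_mul_eq_mul_div, le_div_iff₀' hk0]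
  exact key

theorem eLpNorm_le_energy (hc : 0 < c 1) (h : c 1 ^ 2 ≤ c 0 ^ 2) {κ : ℕ}
    {D : Fin 4 → List GIdx → E3 → E3}
    (hD : ∀ β a, a.length + 1 ≤ κ → MemLp (D β a) 2 volume) {β : Fin 4} {a : List GIdx}
    (ha : a.length + 1 ≤ κ) :
    eLpNorm (D β a) 2 volume
      ≤ ENNReal.ofReal (Real.sqrt (2 / min 1 (c 1 ^ 2)) * Real.sqrt (energy c κ D)) := by
  refine (eLpNorm_le_energyOne hc h (g := fun β => D β a) (fun β => hD β a ha) β).trans ?_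
  refine ENNReal.ofReal_le_ofReal (mul_le_mul_of_nonneg_left (Real.sqrt_le_sqrt ?_)
    (Real.sqrt_nonneg _))
  have hnn : ∀ a, 0 ≤ energyOne c fun β => D β a := fun a => energyOne_nonneg h _
  have h1 : energyOne c (fun β => D β a)
      ≤ ∑ b : Fin a.length → GIdx, energyOne c fun β => D β (List.ofFn b) := by
    have := Finset.single_le_sum (f := fun b : Fin a.length → GIdx =>
      energyOne c fun β => D β (List.ofFn b)) (fun _ _ => hnn _) (Finset.mem_univ a.get)
    simpa using this
  refine h1.trans ?_
  exact Finset.single_le_sum (f := fun k => ∑ b : Fin k → GIdx,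
    energyOne c fun β => D β (List.ofFn b)) (fun _ _ => Finset.sum_nonneg fun _ _ => hnn _)
    (Finset.mem_range.2 (by omega))

end coercivity

/-- The linear map with given values on the coordinate directions of space-time. -/
def ofPartials (d : Fin 4 → E3) : ℝ × E3 →L[ℝ] E3 :=
  (ContinuousLinearMap.fst ℝ ℝ E3).smulRight (d 0)
    + ∑ i : Fin 3, ((EuclideanSpace.proj i : E3 →L[ℝ] ℝ).comp
        (ContinuousLinearMap.snd ℝ ℝ E3)).smulRight (d i.succ)

theorem ofPartials_apply (d : Fin 4 → E3) (w : ℝ × E3) :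
    ofPartials d w = w.1 • d 0 + ∑ i : Fin 3, w.2 i • d i.succ := by
  simp [ofPartials]

theorem ofPartials_dir (d : Fin 4 → E3) (β : Fin 4) : ofPartials d (dir β) = d β := by
  rw [ofPartials_apply]
  refine Fin.cases ?_ (fun i => ?_) β
  · simp [dir]
  · simp [dir]

theorem ofPartials_eq (L : ℝ × E3 →L[ℝ] E3) : ofPartials (fun β => L (dir β)) = L := by
  refine ContinuousLinearMap.ext fun w => ?_
  have hw : w = w.1 • dir 0 + ∑ i : Fin 3, w.2 i • dir i.succ := by
    refine Prod.ext ?_ ?_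
    · simp [dir, Fin.sum_univ_three]
    · ext m
      simp [dir, Fin.sum_univ_three]
      fin_cases m <;> simp
  rw [ofPartials_apply]
  conv_rhs => rw [hw]
  simp only [map_add, map_smul, map_sum]

theorem norm_le_sum_dir (L : ℝ × E3 →L[ℝ] E3) : ‖L‖ ≤ ∑ β, ‖L (dir β)‖ := by
  refine ContinuousLinearMap.opNorm_le_bound _ (Finset.sum_nonneg fun _ _ => norm_nonneg _)
    fun w => ?_
  conv_lhs => rw [← ofPartials_eq L, ofPartials_apply]
  rw [Fin.sum_univ_succ (fun β => ‖L (dir β)‖), add_mul, Finset.sum_mul]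
  refine (norm_add_le _ _).trans (add_le_add ?_ ((norm_sum_le _ _).trans
    (Finset.sum_le_sum fun i _ => ?_)))
  · rw [norm_smul, mul_comm]
    exact mul_le_mul_of_nonneg_left (norm_fst_le w) (norm_nonneg _)
  · rw [norm_smul, mul_comm]
    exact mul_le_mul_of_nonneg_left ((abs_coord_le_norm _ _).trans (norm_snd_le w)) (norm_nonneg _)

/-- Differentiation of a limit on a convex set, where the points of the set need not be interior:
the derivatives within the set are assumed to be a uniform Cauchy sequence. -/
theorem hasFDerivWithinAt_of_uniformCauchySeqOn {E F : Type*} [NormedAddCommGroup E]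
    [NormedSpace ℝ E] [NormedAddCommGroup F] [NormedSpace ℝ F] {s : Set E} (hs : Convex ℝ s)
    {f : ℕ → E → F} {f' : ℕ → E → E →L[ℝ] F} {g : E → F} {g' : E →L[ℝ] F} {p : E} (hp : p ∈ s)
    (hf : ∀ n, ∀ q ∈ s, HasFDerivWithinAt (f n) (f' n q) s q)
    (hf' : UniformCauchySeqOn f' atTop s) (hg : ∀ q ∈ s, Tendsto (fun n => f n q) atTop (𝓝 (g q)))
    (hg' : Tendsto (fun n => f' n p) atTop (𝓝 g')) : HasFDerivWithinAt g g' s p := by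
  rw [hasFDerivWithinAt_iff_isLittleO, Asymptotics.isLittleO_iff]
  intro ε hε
  obtain ⟨N, hN⟩ := Metric.uniformCauchySeqOn_iff.1 hf' (ε / 3) (by positivity)
  obtain ⟨N', hN'⟩ := Metric.tendsto_atTop.1 hg' (ε / 3) (by positivity)
  set n := max N N'
  have h1 : ∀ q ∈ s, ‖(g q - f n q) - (g p - f n p)‖ ≤ ε / 3 * ‖q - p‖ := fun q hq => by
    refine le_of_tendsto ((((hg q hq).sub_const _).sub ((hg p hp).sub_const _)).norm)
      (eventually_atTop.2 ⟨N, fun m hm => ?_⟩)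
    refine hs.norm_image_sub_le_of_norm_hasFDerivWithin_le (f := fun q => f m q - f n q)
      (fun z hz => (hf m z hz).sub (hf n z hz)) (fun z hz => ?_) hp hq
    rw [← dist_eq_norm]
    exact (hN m hm n (le_max_left _ _) z hz).le
  have h2 : ‖f' n p - g'‖ ≤ ε / 3 := by
    rw [← dist_eq_norm]
    exact (hN' n (le_max_right _ _)).le
  have h3 := Asymptotics.isLittleO_iff.1 (hasFDerivWithinAt_iff_isLittleO.1 (hf n p hp))
    (show 0 < ε / 3 by positivity)
  filter_upwards [h3, self_mem_nhdsWithin] with q hq hqs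
  have e : g q - g p - g' (q - p) = ((g q - f n q) - (g p - f n p))
      + (f n q - f n p - f' n p (q - p)) + (f' n p - g') (q - p) := by
    rw [sub_apply]
    abel
  rw [e]
  calc _ ≤ ε / 3 * ‖q - p‖ + ε / 3 * ‖q - p‖ + ε / 3 * ‖q - p‖ := by
        refine (norm_add_le _ _).trans (add_le_add ((norm_add_le _ _).trans
          (add_le_add (h1 q hqs) hq)) (((f' n p - g').le_opNorm _).trans ?_))
        exact mul_le_mul_of_nonneg_right h2 (norm_nonneg _)
    _ = _ := by ring

section limit

variable {T : ℝ} {φ : ℕ → Field} {u : Field} {m : ℕ}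

/-- If a field is the limit of test fields and all `∂_β` of these are uniformly Cauchy, then the
limit is differentiable, and its derivatives are the limits of the derivatives. -/
theorem hasFDerivWithinAt_limit (hT : 0 < T) {v : ℕ → Field} {w : Field}
    (hv : ∀ n, IsTest T (v n))
    (hlim : ∀ t ∈ Icc 0 T, ∀ x, Tendsto (fun n => v n t x) atTop (𝓝 (w t x)))
    (hC : ∀ β, UniformCauchySeqOn (fun n => Function.uncurry (pd T β (v n))) atTop (slab T))
    {t : ℝ} (ht : t ∈ Icc 0 T) (x : E3) :
    HasFDerivWithinAt (Function.uncurry w) (ofPartials fun β => pd T β w t x) (slab T) (t, x) ∧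
      ∀ β, Tendsto (fun n => pd T β (v n) t x) atTop (𝓝 (pd T β w t x)) := by
  have hp := mem_slab ht x
  choose G hG using fun β => cauchySeq_tendsto_of_complete ((hC β).cauchySeq hp)
  have hconv : Tendsto (fun n => fderivWithin ℝ (Function.uncurry (v n)) (slab T) (t, x)) atTop
      (𝓝 (ofPartials G)) := by
    have h1 : (fun n => fderivWithin ℝ (Function.uncurry (v n)) (slab T) (t, x))
        = fun n => ofPartials fun β => pd T β (v n) t x := funext fun n => by
      conv_lhs => rw [← ofPartials_eq (fderivWithin ℝ (Function.uncurry (v n)) (slab T) (t, x))]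
      congr 1
      funext β
      exact ((hv n).pd_eq hT ht x β).symm
    rw [h1, tendsto_iff_norm_sub_tendsto_zero]
    have h2 : Tendsto (fun n => ∑ β, ‖pd T β (v n) t x - G β‖) atTop (𝓝 0) := by
      have := tendsto_finsetSum (Finset.univ : Finset (Fin 4))
        fun β _ => tendsto_iff_norm_sub_tendsto_zero.1 (hG β)
      simpa using this
    refine squeeze_zero (fun _ => norm_nonneg _) (fun n => ?_) h2
    refine (norm_le_sum_dir _).trans_eq (Finset.sum_congr rfl fun β _ => ?_)
    rw [sub_apply, ofPartials_dir, ofPartials_dir]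
  have hder : UniformCauchySeqOn (fun n => fderivWithin ℝ (Function.uncurry (v n)) (slab T)) atTop
      (slab T) := by
    rw [Metric.uniformCauchySeqOn_iff]
    intro ε hε
    choose N hN using fun β => Metric.uniformCauchySeqOn_iff.1 (hC β) (ε / 5) (by positivity)
    refine ⟨Finset.univ.sup N, fun m hm n hn q hq => ?_⟩
    have hle : ∀ β, N β ≤ Finset.univ.sup N := fun β => Finset.le_sup (Finset.mem_univ β)
    rw [dist_eq_norm]
    refine ((norm_le_sum_dir _).trans (Finset.sum_le_sum (g := fun _ => ε / 5)
      fun β _ => ?_)).trans_lt ?_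
    · rw [sub_apply]
      have := hN β m ((hle β).trans hm) n ((hle β).trans hn) q hq
      rw [dist_eq_norm] at this
      rw [← (hv m).pd_eq hT hq.1 q.2, ← (hv n).pd_eq hT hq.1 q.2]
      exact this.le
    · simp only [Finset.sum_const, Finset.card_univ, Fintype.card_fin, nsmul_eq_mul]
      push_cast
      linarith
  have hfd : HasFDerivWithinAt (Function.uncurry w) (ofPartials G) (slab T) (t, x) :=
    hasFDerivWithinAt_of_uniformCauchySeqOn ((convex_Icc 0 T).prod convex_univ) hp
      (fun n q hq => (hv n).hasFDerivWithinAt hq.1 q.2) hder (fun q hq => hlim q.1 hq.1 q.2) hconv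
  have hGw : ∀ β, pd T β w t x = G β := fun β => by
    rw [pd_eq_of_hasFDerivWithinAt hT ht hfd, ofPartials_dir]
  refine ⟨?_, fun β => ?_⟩
  · rwa [show (fun β => pd T β w t x) = G from funext hGw]
  · rw [hGw]
    exact hG β

variable (hT : 0 < T) (hφ : ∀ n, IsTest T (φ n))
  (hu : ∀ t ∈ Icc 0 T, ∀ x, Tendsto (fun n => φ n t x) atTop (𝓝 (u t x)))
  (hC : ∀ a : List GIdx, a.length ≤ m →
    UniformCauchySeqOn (fun n => Function.uncurry (gamPow T a (φ n))) atTop (slab T))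
include hT hφ hu hC

theorem tendsto_gamPow {a : List GIdx} (ha : a.length ≤ m) :
    ∀ t ∈ Icc 0 T, ∀ x, Tendsto (fun n => gamPow T a (φ n) t x) atTop (𝓝 (gamPow T a u t x)) := by
  induction a with
  | nil => exact hu
  | cons j a ih =>
    intro t ht x
    have ha' : a.length + 1 ≤ m := by simpa using ha
    have ih' := ih (by omega)
    have hp := (hasFDerivWithinAt_limit hT (fun n => (hφ n).gamPow hT a) ih'
      (fun β => hC (Sum.inl β :: a) (by simpa using ha')) ht x).2
    match j with
    | Sum.inl β => exact hp β
    | Sum.inr (Sum.inl l) =>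
      refine (((hp (l + 2).succ).const_smul (x (l + 1))).sub
        ((hp (l + 1).succ).const_smul (x (l + 2)))).add ?_
      have := ((-gen l).continuous.tendsto _).comp (ih' t ht x)
      simp only [toEuclideanLin_rotMat]
      exact this
    | Sum.inr (Sum.inr _) =>
      exact (((hp 0).const_smul t).add (tendsto_finsetSum _
        fun i _ => (hp (Fin.succ i)).const_smul (x i))).sub (ih' t ht x)

theorem contDiffOn_gamPow (k : ℕ) : ∀ a : List GIdx, a.length + k ≤ m →
    ContDiffOn ℝ k (Function.uncurry (gamPow T a u)) (slab T) := by
  induction k with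
  | zero =>
    intro a ha
    rw [Nat.cast_zero, contDiffOn_zero]
    refine ((hC a ha).tendstoUniformlyOn_of_tendsto fun p hp =>
      tendsto_gamPow hT hφ hu hC (a := a) ha p.1 hp.1 p.2).continuousOn
      (Frequently.of_forall fun n => ((hφ n).gamPow hT a).smooth.continuousOn)
  | succ k ih =>
    intro a ha
    have hd : ∀ p ∈ slab T, HasFDerivWithinAt (Function.uncurry (gamPow T a u))
        (ofPartials fun β => pd T β (gamPow T a u) p.1 p.2) (slab T) p := fun p hp =>
      (hasFDerivWithinAt_limit hT (fun n => (hφ n).gamPow hT a)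
        (tendsto_gamPow hT hφ hu hC (by omega))
        (fun β => hC (Sum.inl β :: a) (by simp; omega)) hp.1 p.2).1
    rw [Nat.cast_succ, contDiffOn_succ_iff_fderivWithin (uniqueDiffOn_slab hT)]
    refine ⟨fun p hp => (hd p hp).differentiableWithinAt, by simp, ?_⟩
    have h1 : ∀ β, ContDiffOn ℝ k (fun p : ℝ × E3 => pd T β (gamPow T a u) p.1 p.2) (slab T) :=
      fun β => ih (Sum.inl β :: a) (by simp; omega)
    have h2 : ContDiffOn ℝ k (fun p : ℝ × E3 => ofPartials fun β => pd T β (gamPow T a u) p.1 p.2)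
        (slab T) :=
      (contDiffOn_const.smulRight (h1 0)).add
        (ContDiffOn.sum fun i _ => contDiffOn_const.smulRight (h1 i.succ))
    exact h2.congr fun p hp => (hd p hp).fderivWithin (uniqueDiffOn_slab hT p hp)

end limit

/-! ### Passage to the limit -/

theorem memLp_jet {T t : ℝ} {φ : Field} (hT : 0 < T) (hφ : IsTest T φ) (ht : t ∈ Icc 0 T)
    (β : Fin 4) (a : List GIdx) : MemLp (jet T φ t β a) 2 volume :=
  (contDiff_jet hT hφ ht β a).continuous.memLp_of_hasCompactSupport
    (((hφ.gamPow hT a).pd hT β).hasCompactSupport_slice ht)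

/-- A sequence of test fields which is Cauchy for the energy is uniformly Cauchy on the closed slab,
together with its derivatives `Γ^a`, `|a| ≤ κ - 2`. The energy is controlled for `t < T` only, and
the final time is reached by continuity. -/
theorem IsEnergyCauchy.uniformCauchySeqOn {c : Fin 2 → ℝ} (hc : 0 < c 1) (h : c 1 ^ 2 ≤ c 0 ^ 2)
    {κ : ℕ} {T : ℝ} (hT : 0 < T) {φ : ℕ → Field} (hφ : ∀ n, IsTest T (φ n))
    (hC : IsEnergyCauchy c κ T φ) {a : List GIdx} (ha : a.length + 2 ≤ κ) :
    UniformCauchySeqOn (fun n => Function.uncurry (gamPow T a (φ n))) atTop (slab T) := by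
  obtain ⟨C, hCd⟩ := exists_sqrt_decay_gamPow
  set K := Real.sqrt (2 / min 1 (c 1 ^ 2)) with hK
  have hK0 : 0 ≤ K := Real.sqrt_nonneg _
  have hC0 : (0 : ℝ) ≤ C := C.2
  rw [Metric.uniformCauchySeqOn_iff]
  intro ε hε
  have hCK : 0 < C * K + 1 := by positivity
  obtain ⟨N, hN⟩ := hC (ε / (2 * (C * K + 1))) (by positivity)
  refine ⟨N, fun m hm n hn p hp => ?_⟩
  have hψ := (hφ m).sub (hφ n)
  have hIco : ∀ t ∈ Ico 0 T, ‖gamPow T a (φ m - φ n) t p.2‖ ≤ ε / 2 := fun t ht => by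
    have ht' : t ∈ Icc 0 T := ⟨ht.1, ht.2.le⟩
    have h1 := hCd T t _ hT hψ ht' a
      (ENNReal.ofReal (K * Real.sqrt (energy c κ (jet T (φ m - φ n) t)))) (by
        rintro f ⟨β, b, hb, rfl⟩
        exact eLpNorm_le_energy hc h (fun β a _ => memLp_jet hT hψ ht' β a) (by omega)) p.2
    have h2 : ENNReal.ofReal ‖gamPow T a (φ m - φ n) t p.2‖
        ≤ ENNReal.ofReal (C * (K * (ε / (2 * (C * K + 1))))) := by
      rw [ofReal_norm, ENNReal.ofReal_mul hC0, ENNReal.ofReal_coe_nnreal]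
      refine le_trans ?_ (h1.trans (mul_le_mul' le_rfl (ENNReal.ofReal_le_ofReal
        (mul_le_mul_of_nonneg_left (hN m hm n hn t ht) hK0))))
      refine le_mul_of_one_le_left' ?_
      rw [ENNReal.one_le_ofReal, Real.one_le_sqrt]
      exact one_le_jb _
    refine ((ENNReal.ofReal_le_ofReal_iff (by positivity)).1 h2).trans ?_
    rw [show C * (K * (ε / (2 * (C * K + 1)))) = (C * K) * ε / (2 * (C * K + 1)) by ring,
      div_le_div_iff₀ (by positivity) two_pos]
    nlinarith
  have hcont : ContinuousOn (fun t => ‖gamPow T a (φ m - φ n) t p.2‖) (Icc 0 T) :=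
    ((hψ.gamPow hT a).smooth.continuousOn.comp (Continuous.prodMk_left p.2).continuousOn
      fun t ht => mem_slab ht p.2).norm
  have hcl : p.1 ∈ closure (Ico 0 T) := by
    rw [closure_Ico hT.ne]
    exact hp.1
  have hle : ‖gamPow T a (φ m - φ n) p.1 p.2‖ ≤ ε / 2 :=
    ContinuousWithinAt.closure_le hcl ((hcont p.1 hp.1).mono Ico_subset_Icc_self)
      continuousWithinAt_const hIco
  rw [gamPow_sub hT (hφ m) (hφ n) a p.1 hp.1 p.2, ← dist_eq_norm] at hle
  exact hle.trans_lt (by linarith)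

theorem aestronglyMeasurable_proj (α : Fin 2) {f : E3 → E3} {μ : Measure E3}
    (hf : AEStronglyMeasurable f μ) : AEStronglyMeasurable (fun x => proj α x (f x)) μ :=
  (measurable_proj α hf.stronglyMeasurable_mk.measurable).aestronglyMeasurable.congr
    (hf.ae_eq_mk.mono fun x hx => by simp only [← hx])

/-- A pointwise estimate passes to the limit if its right-hand side does so up to any `ε > 0`. -/
theorem le_of_tendsto_of_eventually_le {W : ℝ} {C : NNReal} {B : ENNReal} {v : ℕ → E3} {w : E3}
    (hv : Tendsto v atTop (𝓝 w))
    (h : ∀ ε : NNReal, 0 < ε → ∀ᶠ n in atTop, ENNReal.ofReal W * ‖v n‖ₑ ≤ C * (B + ε)) :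
    ENNReal.ofReal W * ‖w‖ₑ ≤ C * B := by
  refine ENNReal.le_of_forall_pos_le_add fun ε hε _ => ?_
  have h1 : Tendsto (fun n => ENNReal.ofReal W * ‖v n‖ₑ) atTop
      (𝓝 (ENNReal.ofReal W * ‖w‖ₑ)) :=
    ENNReal.Tendsto.const_mul hv.enorm (Or.inr ENNReal.ofReal_ne_top)
  refine (le_of_tendsto h1 (h (ε / (C + 1)) (by positivity))).trans ?_
  rw [mul_add]
  refine add_le_add le_rfl ?_
  rw [← ENNReal.coe_mul, ENNReal.coe_le_coe, ← mul_div_assoc]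
  refine div_le_of_le_mul₀ (by positivity) (by positivity) ?_
  rw [mul_comm]
  gcongr
  exact le_self_add

theorem norm_le_of_enorm_le {W b : ℝ} {C : NNReal} {w : E3} (hW : 0 ≤ W) (hb : 0 ≤ b)
    (h : ENNReal.ofReal W * ‖w‖ₑ ≤ C * ENNReal.ofReal b) : W * ‖w‖ ≤ C * b := by
  rw [← ofReal_norm, ← ENNReal.ofReal_mul hW, ← ENNReal.ofReal_coe_nnreal,
    ← ENNReal.ofReal_mul C.coe_nonneg] at h
  exact (ENNReal.ofReal_le_ofReal_iff (mul_nonneg C.2 hb)).1 h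

section approximation

variable {T t : ℝ} {κ : ℕ} {φ : ℕ → Field} {D : Fin 4 → List GIdx → E3 → E3}

/-- The `L²` norms of finitely many derivatives are eventually close to those of the limit. -/
theorem eventually_eLpNorm_energyJets_le (hT : 0 < T) (hφ : ∀ n, IsTest T (φ n))
    (ht : t ∈ Icc 0 T) (hD : ∀ β a, a.length + 1 ≤ κ → MemLp (D β a) 2 volume)
    (hlim : ∀ β a, a.length + 1 ≤ κ →
      Tendsto (fun n => eLpNorm (jet T (φ n) t β a - D β a) 2 volume) atTop (𝓝 0))
    {N : ENNReal} (hN : ∀ β a, a.length + 1 ≤ κ → eLpNorm (D β a) 2 volume ≤ N)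
    {m : ℕ} (hm : m + 1 ≤ κ) {ε : NNReal} (hε : 0 < ε) :
    ∀ᶠ n in atTop, ∀ f ∈ energyJets T (φ n) t m, eLpNorm f 2 volume ≤ N + ε := by
  have h1 : ∀ᶠ n in atTop, ∀ a ∈ {a : List GIdx | a.length ≤ m}, ∀ β,
      eLpNorm (jet T (φ n) t β a) 2 volume ≤ N + ε := by
    rw [eventually_all_finite (List.finite_length_le GIdx m)]
    intro a ha
    have ha' : a.length + 1 ≤ κ := by
      have : a.length ≤ m := ha
      omega
    rw [eventually_all]
    intro β
    filter_upwards [(hlim β a ha').eventually_le_const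
      (show (0 : ENNReal) < ε by exact_mod_cast hε)] with n hn
    have e : jet T (φ n) t β a = D β a + (jet T (φ n) t β a - D β a) := by abel
    rw [e]
    exact (eLpNorm_add_le (hD β a ha').1 ((memLp_jet hT (hφ n) ht β a).1.sub (hD β a ha').1)
      (by norm_num)).trans (add_le_add (hN β a ha') hn)
  filter_upwards [h1] with n hn f hf
  obtain ⟨β, a, ha, rfl⟩ := hf
  exact hn a ha β

/-- The same for weighted norms over a ball; in the limit they are bounded by the weighted norm over
the whole space. -/
theorem eventually_weightedNorm_weightedJets_le (hT : 0 < T) (hφ : ∀ n, IsTest T (φ n))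
    (ht : t ∈ Icc 0 T) (hD : ∀ β a, a.length + 1 ≤ κ → MemLp (D β a) 2 volume)
    (hlim : ∀ β a, a.length + 1 ≤ κ →
      Tendsto (fun n => eLpNorm (jet T (φ n) t β a - D β a) 2 volume) atTop (𝓝 0))
    (c : Fin 2 → ℝ) (R : ℝ) {m : ℕ} (hm : m + 2 ≤ κ) {ε : NNReal} (hε : 0 < ε) :
    ∀ᶠ n in atTop, ∀ α, ∀ f ∈ weightedJets T (φ n) t m,
      weightedNorm (volume.restrict (Metric.closedBall 0 R)) (fun y => jb (c α * t - ‖y‖)) α f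
        ≤ wnorm c κ t D + ε := by
  set μ := (volume : Measure E3).restrict (Metric.closedBall 0 R) with hμ
  have hgm : ∀ α, Continuous fun y : E3 => jb (c α * t - ‖y‖) := fun α =>
    continuous_jb.comp (by fun_prop)
  have hX : ∀ (α : Fin 2) (β : Fin 4) (l : Fin 3) (a : List GIdx), a.length ≤ m →
      weightedNorm μ (fun y => jb (c α * t - ‖y‖)) α (D β (Sum.inl l.succ :: a))
        ≤ wnorm c κ t D := fun α β l a ha => by
    refine (eLpNorm_mono_measure _ Measure.restrict_le_self).trans ?_
    have h1 := Finset.single_le_sum (f := fun b : Fin a.length → GIdx =>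
      eLpNorm (fun x => jb (c α * t - ‖x‖) • proj α x (D β (Sum.inl l.succ :: List.ofFn b) x))
        2 volume) (fun _ _ => zero_le) (Finset.mem_univ a.get)
    rw [List.ofFn_get] at h1
    refine h1.trans ?_
    refine le_trans ?_ (Finset.single_le_sum (fun _ _ => zero_le) (Finset.mem_univ α))
    refine le_trans ?_ (Finset.single_le_sum (fun _ _ => zero_le) (Finset.mem_univ β))
    refine le_trans ?_ (Finset.single_le_sum (fun _ _ => zero_le) (Finset.mem_univ l))
    exact Finset.single_le_sum (f := fun k => ∑ b : Fin k → GIdx, eLpNorm (fun x =>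
      jb (c α * t - ‖x‖) • proj α x (D β (Sum.inl l.succ :: List.ofFn b) x)) 2 volume)
      (fun _ _ => zero_le) (Finset.mem_range.2 (by omega))
  have h1 : ∀ᶠ n in atTop, ∀ a ∈ {a : List GIdx | a.length ≤ m}, ∀ (α : Fin 2) (β : Fin 4)
      (l : Fin 3), weightedNorm μ (fun y => jb (c α * t - ‖y‖)) α
        (jet T (φ n) t β (Sum.inl l.succ :: a)) ≤ wnorm c κ t D + ε := by
    rw [eventually_all_finite (List.finite_length_le GIdx m)]
    intro a ha
    have ha' : ∀ l : Fin 3, (Sum.inl l.succ :: a : List GIdx).length + 1 ≤ κ := fun l => by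
      have : a.length ≤ m := ha
      simp only [List.length_cons]
      omega
    simp only [eventually_all]
    intro α β l
    have hd := hD β (Sum.inl l.succ :: a) (ha' l)
    -- on a bounded set the weight is bounded, so the weighted norms converge as well
    have hG : Tendsto (fun n => ENNReal.ofReal (1 + (|c α * t| + R))
        * eLpNorm (jet T (φ n) t β (Sum.inl l.succ :: a) - D β (Sum.inl l.succ :: a)) 2 volume)
        atTop (𝓝 0) := by
      have := ENNReal.Tendsto.const_mul (a := ENNReal.ofReal (1 + (|c α * t| + R)))
        (hlim β _ (ha' l)) (Or.inr ENNReal.ofReal_ne_top)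
      rwa [mul_zero] at this
    filter_upwards [hG.eventually_le_const
      (show (0 : ENNReal) < ε by exact_mod_cast hε)] with n hn
    set f := jet T (φ n) t β (Sum.inl l.succ :: a) with hf
    set d := D β (Sum.inl l.succ :: a) with hdd
    have hfd : AEStronglyMeasurable (f - d) μ :=
      ((memLp_jet hT (hφ n) ht β _).1.sub hd.1).restrict
    have e : (fun x => jb (c α * t - ‖x‖) • proj α x (f x))
        = (fun x => jb (c α * t - ‖x‖) • proj α x (d x))
          + fun x => jb (c α * t - ‖x‖) • proj α x ((f - d) x) := by
      funext x
      have : f x = d x + (f - d) x := by simp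
      conv_lhs => rw [this, proj_add, smul_add]
      rfl
    rw [weightedNorm, e]
    refine (eLpNorm_add_le ((hgm α).aestronglyMeasurable.smul
      (aestronglyMeasurable_proj α hd.1.restrict)) ((hgm α).aestronglyMeasurable.smul
      (aestronglyMeasurable_proj α hfd)) (by norm_num)).trans
      (add_le_add (hX α β l a ha) (le_trans ?_ hn))
    refine (eLpNorm_le_mul_eLpNorm_of_ae_le_mul (g := f - d) (c := 1 + (|c α * t| + R))
      ((ae_restrict_iff' Metric.isClosed_closedBall.measurableSet).2
      (Eventually.of_forall fun y hy => ?_)) 2).trans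
      (mul_le_mul' le_rfl (eLpNorm_restrict_le _ _))
    change ‖jb (c α * t - ‖y‖) • proj α y ((f - d) y)‖ ≤ _
    rw [norm_smul, Real.norm_of_nonneg (jb_nonneg _)]
    have hy' : ‖y‖ ≤ R := mem_closedBall_zero_iff.1 hy
    have hR : 0 ≤ R := (norm_nonneg y).trans hy'
    refine mul_le_mul ?_ (norm_proj_le _ _ _) (norm_nonneg _) (by positivity)
    refine (jb_le_one_add_abs _).trans (add_le_add le_rfl ((abs_sub _ _).trans ?_))
    rw [abs_norm]
    linarith
  filter_upwards [h1] with n hn α f hf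
  obtain ⟨β, l, a, ha, rfl⟩ := hf
  exact hn a ha α β l

end approximation

end PrestressedElastic

end

open PrestressedElastic in
theorem proposition3p3 (c : Fin 2 → ℝ) (hc : ∀ α, 0 < c α)
    (hH : 4 / 3 * c 1 ^ 2 < c 0 ^ 2) (κ : ℕ) (hκ : 2 ≤ κ) :
    ∃ C : ℝ, 0 < C ∧ ∀ (T : ℝ), 0 < T → ∀ U : HGamma c κ T,
      -- the pointwise derivatives below exist in the classical sense
      ContDiffOn ℝ ((κ - 2 : ℕ) : WithTop ℕ∞) (Function.uncurry U.u) (Set.Icc 0 T ×ˢ Set.univ) ∧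
      ∀ t ∈ Set.Icc 0 T,
        (∀ (a : List GIdx) (x : E3), a.length + 2 ≤ κ →
          Real.sqrt (jb ‖x‖) * ‖gamPow T a U.u t x‖ ≤ C * Real.sqrt (U.E t)) ∧
        (∀ (a : List GIdx) (β : Fin 4) (x : E3), a.length + 3 ≤ κ →
          jb ‖x‖ * ‖pd T β (gamPow T a U.u) t x‖ ≤ C * Real.sqrt (U.E t)) ∧
        (U.X t < ⊤ →
          (∀ (a : List GIdx) (α : Fin 2) (β : Fin 4) (x : E3), a.length + 3 ≤ κ →
            jb ‖x‖ * Real.sqrt (jb (c α * t - ‖x‖)) *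
                ‖proj α x (pd T β (gamPow T a U.u) t x)‖
              ≤ C * (Real.sqrt (U.E t) + (U.X t).toReal)) ∧
          (∀ (a : List GIdx) (α : Fin 2) (β : Fin 4) (l : Fin 3) (x : E3), a.length + 4 ≤ κ →
            jb ‖x‖ * jb (c α * t - ‖x‖) *
                ‖proj α x (pd T β (dx l (gamPow T a U.u)) t x)‖
              ≤ C * (U.X t).toReal)) := by
  obtain ⟨C₁, h₁⟩ := exists_sqrt_decay_gamPow
  obtain ⟨C₂, h₂⟩ := exists_full_decay_jet
  obtain ⟨C₃, h₃⟩ := exists_weighted_decay_jet hc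
  obtain ⟨C₄, h₄⟩ := exists_weighted_decay_second hc
  set K := Real.sqrt (2 / min 1 (c 1 ^ 2)) with hK
  have hK0 : 0 ≤ K := Real.sqrt_nonneg _
  have n₁ : (0 : ℝ) ≤ C₁ := C₁.2
  have n₂ : (0 : ℝ) ≤ C₂ := C₂.2
  have n₃ : (0 : ℝ) ≤ C₃ := C₃.2
  have n₄ : (0 : ℝ) ≤ C₄ := C₄.2
  have m₁ := mul_nonneg n₁ hK0
  have m₂ := mul_nonneg n₂ hK0
  have m₃ := mul_nonneg n₃ hK0
  have hH' : c 1 ^ 2 ≤ c 0 ^ 2 := by nlinarith [sq_nonneg (c 1)]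
  refine ⟨1 + C₁ * K + C₂ * K + C₃ * (K + 1) + C₄, by positivity, fun T hT U => ?_⟩
  -- an approximating sequence, which converges pointwise together with its `Γ^a`, `|a| ≤ κ - 2`
  obtain ⟨φ, hφ, hCauchy, hu, hD⟩ := U.exists_approx
  have hunif : ∀ a : List GIdx, a.length ≤ κ - 2 →
      UniformCauchySeqOn (fun n => Function.uncurry (gamPow T a (φ n))) atTop (slab T) :=
    fun a ha => hCauchy.uniformCauchySeqOn (hc 1) hH' hT hφ (by omega)
  have hpt : ∀ (a : List GIdx), a.length ≤ κ - 2 → ∀ t ∈ Icc 0 T, ∀ x,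
      Tendsto (fun n => gamPow T a (φ n) t x) atTop (𝓝 (gamPow T a U.u t x)) :=
    fun a ha => tendsto_gamPow hT hφ hu hunif ha
  refine ⟨contDiffOn_gamPow hT hφ hu hunif (κ - 2) [] (by simp), fun t ht => ?_⟩
  set e := Real.sqrt (U.E t) with he
  have he0 : 0 ≤ e := Real.sqrt_nonneg _
  have hN : ∀ β a, a.length + 1 ≤ κ → eLpNorm (U.D t β a) 2 volume ≤ ENNReal.ofReal (K * e) :=
    fun β a ha => eLpNorm_le_energy (hc 1) hH' (U.memLp t ht) ha
  -- the hypotheses of the estimates for test fields, up to `ε`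
  have hNe : ∀ {m : ℕ}, m + 1 ≤ κ → ∀ ε : NNReal, 0 < ε → ∀ᶠ n in atTop,
      ∀ f ∈ energyJets T (φ n) t m, eLpNorm f 2 volume ≤ ENNReal.ofReal (K * e) + ε :=
    fun hm ε hε => eventually_eLpNorm_energyJets_le hT hφ ht (U.memLp t ht) (hD t ht) hN hm hε
  have hXe : ∀ (R : ℝ) {m : ℕ}, m + 2 ≤ κ → ∀ ε : NNReal, 0 < ε → ∀ᶠ n in atTop,
      ∀ α, ∀ f ∈ weightedJets T (φ n) t m,
        weightedNorm (volume.restrict (Metric.closedBall 0 R)) (fun y => jb (c α * t - ‖y‖)) α f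
          ≤ U.X t + ε := fun R {m} hm ε hε =>
    eventually_weightedNorm_weightedJets_le hT hφ ht (U.memLp t ht) (hD t ht) c R hm hε
  have hproj : ∀ (α : Fin 2) (a : List GIdx) (x : E3), a.length ≤ κ - 2 →
      Tendsto (fun n => proj α x (gamPow T a (φ n) t x)) atTop
        (𝓝 (proj α x (gamPow T a U.u t x))) := fun α a x ha => by
    simp only [← projL_apply]
    exact ((projL α x).continuous.tendsto _).comp (hpt a ha t ht x)
  refine ⟨fun a x ha => ?_, fun a β x ha => ?_, fun hX => ⟨fun a α β x ha => ?_,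
    fun a α β l x ha => ?_⟩⟩
  · have hl : ENNReal.ofReal (Real.sqrt (jb ‖x‖)) * ‖gamPow T a U.u t x‖ₑ
        ≤ C₁ * ENNReal.ofReal (K * e) :=
      le_of_tendsto_of_eventually_le (hpt a (by omega) t ht x) fun ε hε => by
        filter_upwards [hNe (m := a.length + 1) (by omega) ε hε] with n hn
        exact h₁ T t (φ n) hT (hφ n) ht a _ hn x
    refine (norm_le_of_enorm_le (Real.sqrt_nonneg _) (by positivity) hl).trans ?_
    rw [← mul_assoc]
    exact mul_le_mul_of_nonneg_right (by linarith) he0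
  · have hl : ENNReal.ofReal (jb ‖x‖) * ‖gamPow T (Sum.inl β :: a) U.u t x‖ₑ
        ≤ C₂ * ENNReal.ofReal (K * e) :=
      le_of_tendsto_of_eventually_le
        (hpt (Sum.inl β :: a) (by simp only [List.length_cons]; omega) t ht x) fun ε hε => by
        filter_upwards [hNe (m := a.length + 2) (by omega) ε hε] with n hn
        exact h₂ T t (φ n) hT (hφ n) ht β a _ hn x
    refine (norm_le_of_enorm_le (jb_nonneg _) (by positivity) hl).trans ?_
    rw [← mul_assoc]
    exact mul_le_mul_of_nonneg_right (by linarith) he0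
  · obtain ⟨R, hR⟩ := h₃ t x ht.1
    have hx0 : 0 ≤ (U.X t).toReal := ENNReal.toReal_nonneg
    have hl : ENNReal.ofReal (jb ‖x‖ * Real.sqrt (jb (c α * t - ‖x‖)))
        * ‖proj α x (gamPow T (Sum.inl β :: a) U.u t x)‖ₑ
          ≤ C₃ * (ENNReal.ofReal (K * e) + U.X t) :=
      le_of_tendsto_of_eventually_le (hproj α (Sum.inl β :: a) x
        (by simp only [List.length_cons]; omega)) fun ε hε => by
        have hε' : 0 < ε / 2 := by positivity
        filter_upwards [hNe (m := a.length + 2) (by omega) (ε / 2) hε',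
          hXe R (m := a.length + 1) (by omega) (ε / 2) hε'] with n hn hn'
        refine (hR T (φ n) hT (hφ n) ht β a _ _ hn hn' α).trans_eq ?_
        rw [add_add_add_comm, ← ENNReal.coe_add, add_halves]
    rw [← ENNReal.ofReal_toReal hX.ne, ← ENNReal.ofReal_add (by positivity) hx0] at hl
    refine (norm_le_of_enorm_le (mul_nonneg (jb_nonneg _) (Real.sqrt_nonneg _)) (by positivity)
      hl).trans ?_
    have t1 : C₃ * (K * e + (U.X t).toReal) ≤ C₃ * ((K + 1) * (e + (U.X t).toReal)) :=
      mul_le_mul_of_nonneg_left (by nlinarith) n₃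
    rw [← mul_assoc] at t1
    exact t1.trans (mul_le_mul_of_nonneg_right (by linarith) (by positivity))
  · obtain ⟨R, hR⟩ := h₄ t x ht.1
    have hx0 : 0 ≤ (U.X t).toReal := ENNReal.toReal_nonneg
    have hl : ENNReal.ofReal (jb ‖x‖ * jb (c α * t - ‖x‖))
        * ‖proj α x (gamPow T (Sum.inl β :: Sum.inl l.succ :: a) U.u t x)‖ₑ ≤ C₄ * U.X t :=
      le_of_tendsto_of_eventually_le (hproj α (Sum.inl β :: Sum.inl l.succ :: a) x
        (by simp only [List.length_cons]; omega)) fun ε hε => by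
        filter_upwards [hXe R (m := a.length + 2) (by omega) ε hε] with n hn
        exact hR T (φ n) hT (hφ n) ht β l a _ hn α
    rw [← ENNReal.ofReal_toReal hX.ne] at hl
    refine (norm_le_of_enorm_le (mul_nonneg (jb_nonneg _) (jb_nonneg _)) hx0 hl).trans
      (mul_le_mul_of_nonneg_right ?_ hx0)
    have := mul_nonneg n₃ (add_nonneg hK0 zero_le_one)
    linarith
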